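/- **Setting.** Let $\Omega\subset\mathbb R^3$ be a bounded or unbounded Lipschitz domain with (possibly empty) boundary $\Gamma$; if $\Gamma$ is not compact, the local Lipschitz graph representations are assumed to hold with a radius and a Lipschitz constant independent of the boundary point. Let $0<\lambda\le\Lambda<\infty$ and $s_0>0$. Let $\mathbb A\in L^\infty(\mathbb R^3,\mathbb R^{3\times3}_{\rm sym})$ and $p\in L^\infty(\mathbb R^3,\mathbb R)$ satisfy $\lambda|\xi|^2\le\langle\mathbb A(x)\xi,\xi\rangle\le\Lambda|\xi|^2$ for all $\xi\in\mathbb R^3$ and $\lambda\le p(x)\le\Lambda$, for almost every $x$, and let $s\in\mathbb C$ with $\operatorname{Re}s>0$ and $|s|\ge s_0$. All functions are complex valued and $\langle f,g\rangle=\int fg$ (resp. $\int\sum_i f_ig_i$) is the bilinear pairing on $\mathbb R^3$. Put $\mathsf L(s)v=-\operatorname{div}(\mathbb A\nabla v)+s^2pv$. Let $H^1(\mathbb R^3,\mathbb A)$ be the space of all $v\in H^1(\mathbb R^3)$ with $\operatorname{div}(\mathbb A\nabla v)\in L^2(\mathbb R^3)$, with norm $(\|v\|_{H^1}^2+\|\operatorname{div}(\mathbb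 A\nabla v)\|_{L^2}^2)^{1/2}$, and $\mathbf H(\mathbb R^3,\operatorname{div})$ the space of all $\mathbf m\in L^2(\mathbb R^3)^3$ with $\operatorname{div}\mathbf m\in L^2(\mathbb R^3)$, with norm $(\|\mathbf m\|_{L^2}^2+\|\operatorname{div}\mathbf m\|_{L^2}^2)^{1/2}$. Let $H^{1/2}(\Gamma)$ carry the Sobolev–Slobodeckij norm $\bigl(\|\psi\|_{L^2(\Gamma)}^2+\int_{\Gamma\times\Gamma}\frac{|\psi(x)-\psi(y)|^2}{\|x-y\|^3}\,d\Gamma_x\,d\Gamma_y\bigr)^{1/2}$, and let $H^{-1/2}(\Gamma)$ be its dual, with bilinear pairing $\langle\cdot,\cdot\rangle_\Gamma$. For $\mathbf m\in\mathbf H(\mathbb R^3,\operatorname{div})$ let $\gamma_{\mathbf n}\mathbf m\in H^{-1/2}(\Gamma)$ be its normal trace with respect to the normal pointing out of $\Omega$, that is, the element with $$\langle\gamma_{\rm D}w,\gamma_{\mathbf n}\mathbf m\rangle_\Gamma=\int_\Omega\bigl(\langle\mathbf m,\nabla w\rangle+(\operatorname{div}\mathbf m)\,w\bigr)$$ for all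 $w\in H^1(\mathbb R^3)$ whose Dirichlet trace $\gamma_{\rm D}w$ on $\Gamma$ lies in $H^{1/2}(\Gamma)$. Put $\gamma_{\mathbf n}(s)=s^{-1/2}\gamma_{\mathbf n}$ and $\gamma_{\rm N}^{\rm ext}(s)v=s^{-1/2}\gamma_{\mathbf n}(\mathbb A\nabla v)$ for $v\in H^1(\mathbb R^3,\mathbb A)$, with the principal branch of $s^{-1/2}$. For $\psi\in H^{1/2}(\Gamma)$ consider the following two problems. * **(UWVP)** Find $u\in L^2(\mathbb R^3)$ with $\langle u,\mathsf L(s)\overline v\rangle=\langle\psi,\gamma_{\rm N}^{\rm ext}(s)\overline v\rangle_\Gamma$ for all $v\in H^1(\mathbb R^3,\mathbb A)$. * **(MVP)** Find $(\mathbf j,u)\in\mathbf H(\mathbb R^3,\operatorname{div})\times L^2(\mathbb R^3)$ with $$-\langle\mathbb A^{-1}\mathbf j,\overline{\mathbf m}\rangle-\langle u,\operatorname{div}\overline{\mathbf m}\rangle=\langle\psi,\gamma_{\mathbf n}(s)\overline{\mathbf m}\rangle_\Gamma\quad\forall\,\mathbf m\in\mathbf H(\mathbb R^3,\operatorname{div}),\qquad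 -\langle\operatorname{div}\mathbf j,\overline q\rangle+s^2\langle pu,\overline q\rangle=0\quad\forall\,q\in L^2(\mathbb R^3).$$ The form of (UWVP) is $b(u,v)=\langle u,\mathsf L(s)\overline v\rangle$ on $X=L^2(\mathbb R^3)$, $Y=H^1(\mathbb R^3,\mathbb A)$. The form of (MVP) is $b((\mathbf j,u),(\mathbf m,q))=-\langle\mathbb A^{-1}\mathbf j,\overline{\mathbf m}\rangle-\langle u,\operatorname{div}\overline{\mathbf m}\rangle-\langle\operatorname{div}\mathbf j,\overline q\rangle+s^2\langle pu,\overline q\rangle$ on $X=Y=\mathbf H(\mathbb R^3,\operatorname{div})\times L^2(\mathbb R^3)$. **Statement.** The normal trace $\gamma_{\mathbf n}\mathbf m$ exists and is unique for every $\mathbf m\in\mathbf H(\mathbb R^3,\operatorname{div})$, and both problems are well posed: the form $b$ is bounded on $X\times Y$; the right-hand side is bounded by a constant times $\|\psi\|_{H^{1/2}(\Gamma)}$ times the norm of the test function; for every $x\in X$ there is $0\ne y\in Y$ with $|b(x,y)|\ge\beta\|x\|_X\|y\|_Y$; if $b(x,y)=0$ for all $x\in X$, then $y=0$; and for every $\psi\in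 H^{1/2}(\Gamma)$ there is exactly one solution, whose norm is at most a constant times $\|\psi\|_{H^{1/2}(\Gamma)}$. Here one can take $\beta=c\,\frac{\operatorname{Re}s}{|s|}$ for (UWVP) and $\beta=c\,\frac{\operatorname{Re}s}{|s|^3}$ for (MVP), with a constant $c>0$ that depends only on $\lambda$, $\Lambda$ and $s_0$; the other constants may depend on $\Omega$, $\mathbb A$, $p$ and $s$. -/

import Mathlib

open MeasureTheory Filter Topology
open scoped ENNReal NNReal ContDiff ComplexConjugate

noncomputable section

namespace UltraWeak

/-! ### Lebesgue and Sobolev spaces on the whole space -/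

/-- The Euclidean space `ℝ³`. -/
abbrev E3 : Type := EuclideanSpace ℝ (Fin 3)

/-- `L²(ℝ³)`, complex valued. -/
abbrev L2 : Type := Lp ℂ 2 (volume : Measure E3)

/-- `𝐋²(ℝ³) = L²(ℝ³)³` with its Hilbert norm. -/
abbrev L2vec : Type := PiLp 2 (fun _ : Fin 3 => L2)

/-- The classical partial derivative `∂ᵢ φ`. -/
def pderiv (i : Fin 3) (φ : E3 → ℂ) (x : E3) : ℂ :=
  fderiv ℝ φ x (EuclideanSpace.single i 1)

/-- `φ ∈ C₀^∞(ℝ³)`. -/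
structure IsTestFunction (φ : E3 → ℂ) : Prop where
  smooth : ContDiff ℝ ∞ φ
  compact : HasCompactSupport φ

/-- `g` is the weak gradient of `u`. -/
def IsWeakGrad (u : L2) (g : L2vec) : Prop :=
  ∀ φ : E3 → ℂ, IsTestFunction φ → ∀ i : Fin 3,
    ∫ x, u x * pderiv i φ x = -∫ x, g i x * φ x

/-- `d` is the weak divergence of `m`. -/
def IsWeakDiv (m : L2vec) (d : L2) : Prop :=
  ∀ φ : E3 → ℂ, IsTestFunction φ →
    ∫ x, ∑ i : Fin 3, m i x * pderiv i φ x = -∫ x, d x * φ x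

theorem IsTestFunction.memLp {φ : E3 → ℂ} (h : IsTestFunction φ) : MemLp φ 2 volume :=
  h.smooth.continuous.memLp_of_hasCompactSupport h.compact

theorem IsTestFunction.continuous_pderiv {φ : E3 → ℂ} (h : IsTestFunction φ) (i : Fin 3) :
    Continuous (pderiv i φ) :=
  (h.smooth.continuous_fderiv (by simp)).clm_apply continuous_const

theorem IsTestFunction.memLp_pderiv {φ : E3 → ℂ} (h : IsTestFunction φ) (i : Fin 3) :
    MemLp (pderiv i φ) 2 volume :=
  (h.continuous_pderiv i).memLp_of_hasCompactSupport (h.compact.fderiv_apply ℝ _)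

theorem IsTestFunction.conj {φ : E3 → ℂ} (h : IsTestFunction φ) :
    IsTestFunction (fun x => conj (φ x)) where
  smooth := Complex.conjCLE.contDiff.comp h.smooth
  compact := h.compact.comp_left (g := fun z : ℂ => conj z) (by simp)

theorem IsTestFunction.pderiv_conj {φ : E3 → ℂ} (h : IsTestFunction φ) (i : Fin 3) (x : E3) :
    pderiv i (fun y => conj (φ y)) x = conj (pderiv i φ x) := by
  have h1 : HasFDerivAt φ (fderiv ℝ φ x) x :=
    (h.smooth.differentiable (by simp) x).hasFDerivAt
  have h2 : HasFDerivAt (fun y => conj (φ y))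
      ((Complex.conjCLE : ℂ →L[ℝ] ℂ).comp (fderiv ℝ φ x)) x :=
    (Complex.conjCLE : ℂ →L[ℝ] ℂ).hasFDerivAt.comp x h1
  simp [pderiv, h2.fderiv]

theorem integrable_L2_mul (u : L2) {f : E3 → ℂ} (hf : MemLp f 2 volume) :
    Integrable (fun x => u x * f x) volume :=
  (Lp.memLp u).integrable_mul hf

theorem integral_add_mul (u v : L2) {f : E3 → ℂ} (hf : MemLp f 2 volume) :
    ∫ x, (u + v) x * f x = (∫ x, u x * f x) + ∫ x, v x * f x := by
  rw [← integral_add (integrable_L2_mul u hf) (integrable_L2_mul v hf)]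
  refine integral_congr_ae ?_
  filter_upwards [Lp.coeFn_add u v] with x hx
  rw [hx]; simp [add_mul]

theorem integral_smul_mul (c : ℂ) (u : L2) (f : E3 → ℂ) :
    ∫ x, (c • u) x * f x = c * ∫ x, u x * f x := by
  rw [← integral_const_mul]
  refine integral_congr_ae ?_
  filter_upwards [Lp.coeFn_smul c u] with x hx
  rw [hx]; simp [mul_assoc]

theorem integral_zero_mul (f : E3 → ℂ) : ∫ x, (0 : L2) x * f x = 0 := by
  rw [← zero_smul ℂ (0 : L2), integral_smul_mul, zero_mul]

theorem integral_star_mul (u : L2) (f : E3 → ℂ) :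
    ∫ x, (star u) x * f x = conj (∫ x, u x * conj (f x)) := by
  rw [← integral_conj]
  refine integral_congr_ae ?_
  filter_upwards [Lp.coeFn_star u] with x hx
  rw [hx]; simp

theorem integral_sum_mul (m : L2vec) {φ : E3 → ℂ} (h : IsTestFunction φ) :
    ∫ x, ∑ i : Fin 3, m i x * pderiv i φ x = ∑ i : Fin 3, ∫ x, m i x * pderiv i φ x :=
  integral_finsetSum _ fun i _ => integrable_L2_mul (m i) (h.memLp_pderiv i)

/-- `H¹(ℝ³)`, as the space of pairs `(u, ∇u)`; the weak gradient is determined by `u`, and the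
inherited norm is `(‖u‖² + ‖∇u‖²)^{1/2}`. -/
def H1Sub : Submodule ℂ (WithLp 2 (L2 × L2vec)) where
  carrier := {z | IsWeakGrad z.fst z.snd}
  add_mem' := by
    intro a b ha hb φ hφ i
    have h1 := ha φ hφ i
    have h2 := hb φ hφ i
    simp only [WithLp.add_fst, WithLp.add_snd, PiLp.add_apply]
    rw [integral_add_mul _ _ (hφ.memLp_pderiv i), integral_add_mul _ _ hφ.memLp, h1, h2]
    ring
  zero_mem' := by
    intro φ hφ i
    simp only [WithLp.zero_fst, WithLp.zero_snd, PiLp.zero_apply]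
    rw [integral_zero_mul, integral_zero_mul, neg_zero]
  smul_mem' := by
    intro c a ha φ hφ i
    have h1 := ha φ hφ i
    simp only [WithLp.smul_fst, WithLp.smul_snd, PiLp.smul_apply]
    rw [integral_smul_mul, integral_smul_mul, h1]
    ring

/-- `H¹(ℝ³)` as a Hilbert space. -/
abbrev H1 : Type := ↥H1Sub

/-- The function `u` underlying an element of `H¹(ℝ³)`. -/
def H1.val (v : H1) : L2 := v.1.fst

/-- The weak gradient of an element of `H¹(ℝ³)`. -/
def H1.grad (v : H1) : L2vec := v.1.snd

/-- `𝐇(ℝ³, div)`, as the space of pairs `(m, div m)`; the weak divergence is determined by `m`,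
and the inherited norm is `(‖m‖² + ‖div m‖²)^{1/2}`. -/
def HdivSub : Submodule ℂ (WithLp 2 (L2vec × L2)) where
  carrier := {z | IsWeakDiv z.fst z.snd}
  add_mem' := by
    intro a b ha hb φ hφ
    have h1 := ha φ hφ
    have h2 := hb φ hφ
    rw [integral_sum_mul _ hφ] at h1 h2 ⊢
    simp only [WithLp.add_fst, WithLp.add_snd, PiLp.add_apply]
    rw [integral_add_mul _ _ hφ.memLp, neg_add, ← h1, ← h2, ← Finset.sum_add_distrib]
    exact Finset.sum_congr rfl fun i _ => integral_add_mul _ _ (hφ.memLp_pderiv i)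
  zero_mem' := by
    intro φ hφ
    rw [integral_sum_mul _ hφ]
    simp only [WithLp.zero_fst, WithLp.zero_snd, PiLp.zero_apply]
    simp only [integral_zero_mul, neg_zero, Finset.sum_const_zero]
  smul_mem' := by
    intro c a ha φ hφ
    have h1 := ha φ hφ
    rw [integral_sum_mul _ hφ] at h1 ⊢
    simp only [WithLp.smul_fst, WithLp.smul_snd, PiLp.smul_apply]
    rw [integral_smul_mul, ← mul_neg, ← h1, Finset.mul_sum]
    exact Finset.sum_congr rfl fun i _ => integral_smul_mul _ _ _

/-- `𝐇(ℝ³, div)` as a Hilbert space. -/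
abbrev Hdiv : Type := ↥HdivSub

/-- The vector field underlying an element of `𝐇(ℝ³, div)`. -/
def Hdiv.field (m : Hdiv) : L2vec := m.1.fst

/-- The weak divergence of an element of `𝐇(ℝ³, div)`. -/
def Hdiv.div (m : Hdiv) : L2 := m.1.snd

/-- `m = B ∇v` almost everywhere, with `m ∈ 𝐇(ℝ³, div)`. -/
def IsFlux (B : E3 → Matrix (Fin 3) (Fin 3) ℝ) (v : H1) (m : Hdiv) : Prop :=
  ∀ i : Fin 3, ∀ᵐ x, m.field i x = ∑ k : Fin 3, (B x i k : ℂ) * v.grad k x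

/-- `H¹(ℝ³, B)`, the space of all `v ∈ H¹(ℝ³)` with `div(B ∇v) ∈ L²(ℝ³)`, as the space of pairs
`(v, div(B ∇v))`; the inherited norm is the graph norm `(‖v‖²_{H¹} + ‖div(B ∇v)‖²)^{1/2}`. -/
def H1BSub (B : E3 → Matrix (Fin 3) (Fin 3) ℝ) : Submodule ℂ (WithLp 2 (H1 × L2)) where
  carrier := {z | ∃ m : Hdiv, IsFlux B z.fst m ∧ m.div = z.snd}
  add_mem' := by
    rintro a b ⟨m, hm, hd⟩ ⟨n, hn, he⟩
    refine ⟨m + n, fun i => ?_, ?_⟩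
    · filter_upwards [hm i, hn i, Lp.coeFn_add (m.field i) (n.field i),
        ae_all_iff.2 fun k => Lp.coeFn_add (a.fst.grad k) (b.fst.grad k)] with x h1 h2 h3 h4
      have h5 : (m + n).field i x = m.field i x + n.field i x := h3
      have h6 : ∀ k, (a + b).fst.grad k x = a.fst.grad k x + b.fst.grad k x := h4
      simp only [h5, h6, h1, h2, mul_add, Finset.sum_add_distrib]
    · rw [WithLp.add_snd, ← hd, ← he]; rfl
  zero_mem' := by
    refine ⟨0, fun i => ?_, rfl⟩
    filter_upwards [Lp.coeFn_zero ℂ 2 (volume : Measure E3)] with x h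
    have h1 : (0 : Hdiv).field i x = 0 := h
    have h2 : ∀ k, (0 : WithLp 2 (H1 × L2)).fst.grad k x = 0 := fun _ => h
    rw [h1]
    exact (Finset.sum_eq_zero fun k _ => by rw [h2 k, mul_zero]).symm
  smul_mem' := by
    rintro c a ⟨m, hm, hd⟩
    refine ⟨c • m, fun i => ?_, ?_⟩
    · filter_upwards [hm i, Lp.coeFn_smul c (m.field i),
        ae_all_iff.2 fun k => Lp.coeFn_smul c (a.fst.grad k)] with x h1 h3 h4
      have h5 : (c • m).field i x = c * m.field i x := h3
      have h6 : ∀ k, (c • a).fst.grad k x = c * a.fst.grad k x := h4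
      simp only [h5, h6, h1, Finset.mul_sum]
      exact Finset.sum_congr rfl fun k _ => by ring
    · rw [WithLp.smul_snd, ← hd]; rfl

/-- `H¹(ℝ³, B)` as an inner product space. -/
abbrev H1B (B : E3 → Matrix (Fin 3) (Fin 3) ℝ) : Type := ↥(H1BSub B)

variable {B : E3 → Matrix (Fin 3) (Fin 3) ℝ}

/-- The `H¹` function underlying an element of `H¹(ℝ³, B)`. -/
def H1B.toH1 (v : H1B B) : H1 := v.1.fst

/-- `div(B ∇v)`. -/
def H1B.divFlux (v : H1B B) : L2 := v.1.snd

/-- The field `B ∇v ∈ 𝐇(ℝ³, div)` (it is determined by `v`). -/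
def H1B.flux (v : H1B B) : Hdiv := v.2.choose

theorem H1B.isFlux_flux (v : H1B B) : IsFlux B v.toH1 v.flux := v.2.choose_spec.1

theorem H1B.div_flux (v : H1B B) : v.flux.div = v.divFlux := v.2.choose_spec.2

/-! ### Complex conjugation -/

/-- Componentwise complex conjugation on `L²(ℝ³)³`. -/
def L2vec.conj (g : L2vec) : L2vec := WithLp.toLp 2 fun i => star (g i)

/-- The complex conjugate of an element of `H¹(ℝ³)`. -/
def H1.conj (v : H1) : H1 :=
  ⟨WithLp.toLp 2 (star v.val, L2vec.conj v.grad), by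
    intro φ hφ i
    have h := v.2 _ hφ.conj i
    simp only [hφ.pderiv_conj] at h
    change ∫ x, (star v.val) x * pderiv i φ x = -∫ x, (star (v.grad i)) x * φ x
    rw [integral_star_mul, integral_star_mul, ← map_neg]
    exact congrArg _ h⟩

/-- The complex conjugate of an element of `𝐇(ℝ³, div)`. -/
def Hdiv.conj (m : Hdiv) : Hdiv :=
  ⟨WithLp.toLp 2 (L2vec.conj m.field, star m.div), by
    intro φ hφ
    have h := m.2 _ hφ.conj
    rw [integral_sum_mul _ hφ.conj] at h
    rw [integral_sum_mul _ hφ]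
    simp only [hφ.pderiv_conj] at h
    change ∑ i, ∫ x, (star (m.field i)) x * pderiv i φ x = -∫ x, (star m.div) x * φ x
    simp only [integral_star_mul]
    rw [← map_neg, ← map_sum]
    exact congrArg _ h⟩

/-- The complex conjugate of an element of `H¹(ℝ³, B)`. -/
def H1B.conj (v : H1B B) : H1B B :=
  ⟨WithLp.toLp 2 (v.toH1.conj, star v.divFlux), by
    refine ⟨v.flux.conj, fun i => ?_, ?_⟩
    · filter_upwards [v.isFlux_flux i, Lp.coeFn_star (v.flux.field i),
        ae_all_iff.2 fun k => Lp.coeFn_star (v.toH1.grad k)] with x h1 h3 h4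
      have h5 : v.flux.conj.field i x = star (v.flux.field i x) := h3
      have h6 : ∀ k, v.toH1.conj.grad k x = star (v.toH1.grad k x) := h4
      change v.flux.conj.field i x = ∑ k, (B x i k : ℂ) * v.toH1.conj.grad k x
      simp [h5, h6, h1]
    · change star v.flux.div = star v.divFlux
      rw [v.div_flux]⟩

/-! ### Lipschitz domains and trace spaces -/

/-- A bounded or unbounded Lipschitz domain in `ℝ³` with possibly empty boundary: near each
boundary point the set is, in suitable Cartesian coordinates, the hypograph of a Lipschitz function,
with a radius and a Lipschitz constant that do not depend on the boundary point (for compact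
boundary this uniformity is automatic). -/
structure LipschitzDomain where
  carrier : Set E3
  isOpen : IsOpen carrier
  lipschitz : ∃ r : ℝ, 0 < r ∧ ∃ M : ℝ≥0, ∀ x ∈ frontier carrier,
    ∃ (e : E3 ≃ₗᵢ[ℝ] WithLp 2 (EuclideanSpace ℝ (Fin 2) × ℝ))
      (g : EuclideanSpace ℝ (Fin 2) → ℝ), LipschitzWith M g ∧
      ∀ y ∈ Metric.ball x r, y ∈ carrier ↔ (e y).snd < g (e y).fst

/-- The surface measure on the boundary `Γ = ∂Ω`. -/
def LipschitzDomain.surf (Ω : LipschitzDomain) : Measure E3 :=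
  μHE[2].restrict (frontier Ω.carrier)

theorem LipschitzDomain.isLocallyFinite_surf (Ω : LipschitzDomain) :
    IsLocallyFiniteMeasure Ω.surf := by
  refine ⟨fun x => ?_⟩
  by_cases hx : x ∈ frontier Ω.carrier
  · obtain ⟨r, hr, M, h⟩ := Ω.lipschitz
    obtain ⟨e, g, hg, hy⟩ := h x hx
    refine ⟨Metric.ball x r, Metric.ball_mem_nhds x hr, ?_⟩
    let G : EuclideanSpace ℝ (Fin 2) → E3 := fun z => e.symm (WithLp.toLp 2 (z, g z))
    have hG : ∃ K : ℝ≥0, LipschitzWith K G := by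
      have h1 : LipschitzWith (max 1 M) (fun z : EuclideanSpace ℝ (Fin 2) => (z, g z)) :=
        LipschitzWith.id.prodMk hg
      exact ⟨_, e.symm.lipschitz.comp ((WithLp.prod_lipschitzWith_toLp 2 _ _).comp h1)⟩
    obtain ⟨K, hK⟩ := hG
    have hsub : Metric.ball x r ∩ frontier Ω.carrier ⊆
        G '' Metric.closedBall (e x).fst r := by
      rintro y ⟨hyb, hyf⟩
      have hc : Continuous fun z : E3 => (e z).fst :=
        (WithLp.prod_continuous_ofLp 2 _ _).fst.comp e.continuous
      have hc2 : Continuous fun z : E3 => (e z).snd :=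
        (WithLp.prod_continuous_ofLp 2 _ _).snd.comp e.continuous
      have hset : Ω.carrier ∩ Metric.ball x r =
          {z | (e z).snd < g (e z).fst} ∩ Metric.ball x r := by
        ext z
        constructor
        · rintro ⟨h1, h2⟩; exact ⟨(hy z h2).1 h1, h2⟩
        · rintro ⟨h1, h2⟩; exact ⟨(hy z h2).2 h1, h2⟩
      have h3 := frontier_inter_open_inter (s := Ω.carrier)
        (t := Metric.ball x r) Metric.isOpen_ball
      have h4 := frontier_inter_open_inter (s := {z : E3 | (e z).snd < g (e z).fst})
        (t := Metric.ball x r) Metric.isOpen_ball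
      rw [hset] at h3
      have h5 : y ∈ frontier {z : E3 | (e z).snd < g (e z).fst} ∩ Metric.ball x r := by
        rw [← h4, h3]; exact ⟨hyf, hyb⟩
      have h6 : (e y).snd = g (e y).fst :=
        frontier_lt_subset_eq hc2 (hg.continuous.comp hc) h5.1
      refine ⟨(e y).fst, ?_, ?_⟩
      · rw [Metric.mem_closedBall, dist_eq_norm]
        have h7 : ‖(e y - e x).fst‖ ≤ ‖e y - e x‖ := WithLp.norm_fst_le _ _
        rw [← map_sub, e.norm_map] at h7
        rw [Metric.mem_ball, dist_eq_norm] at hyb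
        have h8 : (e y).fst - (e x).fst = (e (y - x)).fst := by
          rw [map_sub]; rfl
        rw [h8]; exact h7.trans hyb.le
      · change e.symm (WithLp.toLp 2 ((e y).fst, g (e y).fst)) = y
        rw [← h6]
        exact e.symm_apply_apply y
    rw [LipschitzDomain.surf, Measure.restrict_apply Metric.isOpen_ball.measurableSet]
    refine (measure_mono hsub).trans_lt ?_
    rw [Measure.euclideanHausdorffMeasure_def, Measure.smul_apply, ENNReal.smul_def, smul_eq_mul]
    refine ENNReal.mul_lt_top ENNReal.coe_lt_top ?_
    refine (hK.hausdorffMeasure_image_le (by simp) _).trans_lt ?_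
    exact ENNReal.mul_lt_top (ENNReal.rpow_lt_top_of_nonneg (by simp) (by simp))
      (isCompact_closedBall _ _).measure_lt_top
  · refine ⟨(frontier Ω.carrier)ᶜ, isClosed_frontier.isOpen_compl.mem_nhds hx, ?_⟩
    rw [LipschitzDomain.surf, Measure.restrict_apply isClosed_frontier.measurableSet.compl]
    simp

instance LipschitzDomain.sigmaFinite_surf (Ω : LipschitzDomain) : SigmaFinite Ω.surf :=
  haveI := Ω.isLocallyFinite_surf
  inferInstance

/-- The measure `‖x - y‖⁻³ dΓₓ dΓ_y` on `Γ × Γ`. -/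
def LipschitzDomain.slobMeasure (Ω : LipschitzDomain) : Measure (E3 × E3) :=
  (Ω.surf.prod Ω.surf).withDensity fun z => (edist z.1 z.2 ^ 3)⁻¹

theorem LipschitzDomain.ae_slob_fst (Ω : LipschitzDomain) {P : E3 → Prop}
    (h : ∀ᵐ x ∂Ω.surf, P x) : ∀ᵐ z ∂Ω.slobMeasure, P z.1 :=
  (withDensity_absolutelyContinuous _ _).ae_le (Measure.quasiMeasurePreserving_fst.ae h)

theorem LipschitzDomain.ae_slob_snd (Ω : LipschitzDomain) {P : E3 → Prop}
    (h : ∀ᵐ x ∂Ω.surf, P x) : ∀ᵐ z ∂Ω.slobMeasure, P z.2 :=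
  (withDensity_absolutelyContinuous _ _).ae_le (Measure.quasiMeasurePreserving_snd.ae h)

/-- `H^{1/2}(Γ)`, the space of all `ψ ∈ L²(Γ)` for which `ψ(x) - ψ(y)` is square integrable with
respect to `‖x - y‖⁻³ dΓₓ dΓ_y`, as the space of pairs `(ψ, ψ(x) - ψ(y))`; the inherited norm is
the Sobolev-Slobodeckij norm. -/
def HhalfSub (Ω : LipschitzDomain) :
    Submodule ℂ (WithLp 2 (Lp ℂ 2 Ω.surf × Lp ℂ 2 Ω.slobMeasure)) where
  carrier := {z | ∀ᵐ q ∂Ω.slobMeasure, z.snd q = z.fst q.1 - z.fst q.2}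
  add_mem' := by
    intro a b ha hb
    filter_upwards [ha, hb, Lp.coeFn_add a.snd b.snd,
      Ω.ae_slob_fst (Lp.coeFn_add a.fst b.fst),
      Ω.ae_slob_snd (Lp.coeFn_add a.fst b.fst)] with q h1 h2 h3 h4 h5
    rw [WithLp.add_snd, WithLp.add_fst, h3, h4, h5]
    simp only [Pi.add_apply, h1, h2]
    ring
  zero_mem' := by
    filter_upwards [Lp.coeFn_zero ℂ 2 Ω.slobMeasure,
      Ω.ae_slob_fst (Lp.coeFn_zero ℂ 2 Ω.surf),
      Ω.ae_slob_snd (Lp.coeFn_zero ℂ 2 Ω.surf)] with q h1 h2 h3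
    rw [WithLp.zero_snd, WithLp.zero_fst, h1, h2, h3]
    simp
  smul_mem' := by
    intro c a ha
    filter_upwards [ha, Lp.coeFn_smul c a.snd,
      Ω.ae_slob_fst (Lp.coeFn_smul c a.fst),
      Ω.ae_slob_snd (Lp.coeFn_smul c a.fst)] with q h1 h3 h4 h5
    rw [WithLp.smul_snd, WithLp.smul_fst, h3, h4, h5]
    simp only [Pi.smul_apply, h1, smul_eq_mul]
    ring

/-- `H^{1/2}(Γ)` as an inner product space. -/
abbrev Hhalf (Ω : LipschitzDomain) : Type := ↥(HhalfSub Ω)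

/-- The boundary function underlying an element of `H^{1/2}(Γ)`. -/
def Hhalf.val {Ω : LipschitzDomain} (ψ : Hhalf Ω) : Lp ℂ 2 Ω.surf := ψ.1.fst

/-- `H^{-1/2}(Γ)`, the dual of `H^{1/2}(Γ)`; the value `ℓ ψ` is the bilinear pairing
`⟨ψ, ℓ⟩_Γ`. -/
abbrev HmHalf (Ω : LipschitzDomain) : Type := StrongDual ℂ (Hhalf Ω)

/-- The Dirichlet trace of `w ∈ H¹(ℝ³)` on `Γ` is `ψ`: the trace is the continuous extension of
the restriction `φ ↦ φ|_Γ` from `C₀^∞(ℝ³)` to `H¹(ℝ³)`. -/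
def HasTrace (Ω : LipschitzDomain) (w : H1) (ψ : Lp ℂ 2 Ω.surf) : Prop :=
  ∃ φ : ℕ → E3 → ℂ, (∀ n, IsTestFunction (φ n)) ∧
    Tendsto (fun n => eLpNorm (fun x => φ n x - w.val x) 2 volume) atTop (𝓝 0) ∧
    (∀ i, Tendsto (fun n => eLpNorm (fun x => pderiv i (φ n) x - w.grad i x) 2 volume)
      atTop (𝓝 0)) ∧
    Tendsto (fun n => eLpNorm (fun x => φ n x - ψ x) 2 Ω.surf) atTop (𝓝 0)

/-- `ℓ ∈ H^{-1/2}(Γ)` is the normal trace `⟨m, n⟩|_Γ` of `m ∈ 𝐇(ℝ³, div)`, with `n` the unit normal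
pointing out of `Ω`: it satisfies `⟨γ_D w, ℓ⟩_Γ = ∫_Ω ⟨m, ∇w⟩ + (div m) w`. -/
def IsNormalTrace (Ω : LipschitzDomain) (m : Hdiv) (ℓ : HmHalf Ω) : Prop :=
  ∀ (w : H1) (ψ : Hhalf Ω), HasTrace Ω w ψ.val →
    ℓ ψ = ∫ x in Ω.carrier, ((∑ i : Fin 3, m.field i x * w.grad i x) + m.div x * w.val x)

open Classical in
/-- The normal trace `γ_n m ∈ H^{-1/2}(Γ)` (existence and uniqueness are asserted in the main
statement). -/
def normalTrace (Ω : LipschitzDomain) (m : Hdiv) : HmHalf Ω :=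
  if h : ∃ ℓ, IsNormalTrace Ω m ℓ then h.choose else 0

/-- The frequency-scaled normal trace `γ_n(s) = s^{-1/2} γ_n`. -/
def normalTraceS (Ω : LipschitzDomain) (s : ℂ) (m : Hdiv) : HmHalf Ω :=
  s ^ (-(1 / 2) : ℂ) • normalTrace Ω m

/-- The frequency-scaled co-normal derivative `γ_N(s) v = s^{-1/2} γ_n(B ∇v)`. -/
def conormalS (Ω : LipschitzDomain) (s : ℂ) (v : H1B B) : HmHalf Ω :=
  normalTraceS Ω s v.flux

/-! ### Coefficients and variational problems -/

/-- `A` is a measurable field of real symmetric matrices with spectral bounds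
`0 < lam ≤ λ(A)` and `Λ(A) ≤ Lam < ∞`. -/
structure IsMatrixCoeff (lam Lam : ℝ) (A : E3 → Matrix (Fin 3) (Fin 3) ℝ) : Prop where
  aemeasurable : ∀ i k, AEMeasurable (fun x => A x i k) volume
  symm : ∀ᵐ x, (A x).IsSymm
  lower : ∀ᵐ x, ∀ v : Fin 3 → ℝ, lam * (v ⬝ᵥ v) ≤ (A x).mulVec v ⬝ᵥ v
  upper : ∀ᵐ x, ∀ v : Fin 3 → ℝ, (A x).mulVec v ⬝ᵥ v ≤ Lam * (v ⬝ᵥ v)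

/-- `p` is a measurable real function with `0 < lam ≤ λ(p)` and `Λ(p) ≤ Lam < ∞`. -/
structure IsScalarCoeff (lam Lam : ℝ) (p : E3 → ℝ) : Prop where
  aemeasurable : AEMeasurable p volume
  lower : ∀ᵐ x, lam ≤ p x
  upper : ∀ᵐ x, p x ≤ Lam

/-- `L(s) v = -div(A ∇v) + s² p v`, a square integrable function for `v ∈ H¹(ℝ³, A)`. -/
def opL (A : E3 → Matrix (Fin 3) (Fin 3) ℝ) (p : E3 → ℝ) (s : ℂ) (v : H1B A) (x : E3) : ℂ :=
  -v.divFlux x + s ^ 2 * (p x : ℂ) * v.toH1.val x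

/-- The sesquilinear form `⟨u, L(s) v̄⟩` of the ultra-weak problem. -/
def uwForm (A : E3 → Matrix (Fin 3) (Fin 3) ℝ) (p : E3 → ℝ) (s : ℂ) (u : L2) (v : H1B A) : ℂ :=
  ∫ x, u x * opL A p s v.conj x

/-- The right-hand side `⟨ψ, γ_N(s) v̄⟩_Γ` of the ultra-weak problem. -/
def uwRhs (Ω : LipschitzDomain) (A : E3 → Matrix (Fin 3) (Fin 3) ℝ) (s : ℂ)
    (ψ : Hhalf Ω) (v : H1B A) : ℂ :=
  conormalS Ω s v.conj ψ

/-- `u` solves the ultra-weak variational problem with datum `ψ`. -/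
def IsUWSolution (Ω : LipschitzDomain) (A : E3 → Matrix (Fin 3) (Fin 3) ℝ) (p : E3 → ℝ) (s : ℂ)
    (ψ : Hhalf Ω) (u : L2) : Prop :=
  ∀ v : H1B A, uwForm A p s u v = uwRhs Ω A s ψ v

/-- `𝐇(ℝ³, div) × L²(ℝ³)` with its Hilbert norm. -/
abbrev MixedSpace : Type := WithLp 2 (Hdiv × L2)

/-- `⟨A⁻¹ j, m⟩` -/
def invPairing (A : E3 → Matrix (Fin 3) (Fin 3) ℝ) (j m : Hdiv) : ℂ :=
  ∫ x, ∑ i : Fin 3, (∑ k : Fin 3, ((A x)⁻¹ i k : ℂ) * j.field k x) * m.field i x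

/-- The sesquilinear form of the mixed problem,
`-⟨A⁻¹ j, m̄⟩ - ⟨u, div m̄⟩ - ⟨div j, q̄⟩ + s² ⟨p u, q̄⟩`. -/
def mixedForm (A : E3 → Matrix (Fin 3) (Fin 3) ℝ) (p : E3 → ℝ) (s : ℂ) (z t : MixedSpace) : ℂ :=
  -invPairing A z.fst t.fst.conj - (∫ x, z.snd x * t.fst.conj.div x)
    - (∫ x, z.fst.div x * (star t.snd) x) + s ^ 2 * ∫ x, (p x : ℂ) * z.snd x * (star t.snd) x

/-- The right-hand side `(m, q) ↦ ⟨ψ, γ_n(s) m̄⟩_Γ` of the mixed problem. -/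
def mixedRhs (Ω : LipschitzDomain) (s : ℂ) (ψ : Hhalf Ω) (t : MixedSpace) : ℂ :=
  normalTraceS Ω s t.fst.conj ψ

/-- `(j, u)` solves the mixed variational problem with datum `ψ`. -/
def IsMixedSolution (Ω : LipschitzDomain) (A : E3 → Matrix (Fin 3) (Fin 3) ℝ) (p : E3 → ℝ) (s : ℂ)
    (ψ : Hhalf Ω) (z : MixedSpace) : Prop :=
  (∀ m : Hdiv, -invPairing A z.fst m.conj - (∫ x, z.snd x * m.conj.div x)
    = normalTraceS Ω s m.conj ψ) ∧
  (∀ q : L2, -(∫ x, z.fst.div x * (star q) x)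
    + s ^ 2 * (∫ x, (p x : ℂ) * z.snd x * (star q) x) = 0)

/-- Well-posedness of a variational problem with trial space `X`, test space `Y`, data space `D`,
form `b`, right-hand side `f` and solution relation `sol`: continuity of form and right-hand side,
the inf-sup condition with constant `β`, nondegeneracy in the test argument, and unique solvability
with continuous dependence on the datum. -/
structure IsWellPosed {X Y D : Type*} [NormedAddCommGroup X] [NormedAddCommGroup Y]
    [NormedAddCommGroup D] (b : X → Y → ℂ) (f : D → Y → ℂ) (sol : D → X → Prop) (β : ℝ) :
    Prop where
  form_bounded : ∃ C : ℝ, ∀ u v, ‖b u v‖ ≤ C * ‖u‖ * ‖v‖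
  rhs_bounded : ∃ C : ℝ, ∀ ψ v, ‖f ψ v‖ ≤ C * ‖ψ‖ * ‖v‖
  beta_pos : 0 < β
  inf_sup : ∀ u, ∃ v, v ≠ 0 ∧ β * ‖u‖ * ‖v‖ ≤ ‖b u v‖
  nondegenerate : ∀ v, (∀ u, b u v = 0) → v = 0
  existsUnique : ∀ ψ, ∃! u, sol ψ u
  stable : ∃ C : ℝ, ∀ ψ u, sol ψ u → ‖u‖ ≤ C * ‖ψ‖

end UltraWeak

end

open MeasureTheory Filter Topology
open scoped ENNReal NNReal ContDiff ComplexConjugate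

noncomputable section

namespace UltraWeak

/-! ### Weighted Cauchy-Schwarz inequality for lower integrals -/

/-! Two largely separate arguments carry the theorem: a trace theory for Γ and an energy estimate.

Trace theory. The normal trace of m must send ψ to the pairing ∫_Ω ⟨m, ∇w⟩ + (div m) w for any w
with trace ψ. It exists and is unique once every ψ in H^{1/2}(Γ) has an extension w with ‖w‖ ≤ C‖ψ‖
(`exists_hasTrace`) and the pairing depends on the trace of w alone (`HasTrace.domPair_eq`). Neither
fact is proved by flattening Γ. Both rest on two properties of the surface measure μ: at small
scales a ball of radius t centred on Γ has mass at least c t², and balls of one fixed radius have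
uniformly bounded mass (`LipschitzDomain.exists_isSurfaceLike`).

For the second fact, the bound |∫_Ω ∂ᵢφ| ≤ L ∫ |φ| dμ for test functions replaces the Gauss theorem
(`IsSurfaceLike.exists_enorm_integral_pderiv_le`). It shows that a function of vanishing trace, cut
to Ω and extended by zero, still lies in H¹(ℝ³); integration by parts over ℝ³ then makes the pairing
vanish.

For the first fact, ψ is extended by the averages (1 + ∫ g(x - y) dμ)⁻¹ ∫ g(x - y) ψ(y) dμ with g(z)
of size (‖z‖ + ε)⁻⁶ near the origin. As Γ is two-dimensional, the normalizing factor is at most of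
order (d + ε)⁴ at distance d from Γ. The gradient can be written through differences ψ(y) - ψ(z),
and integrating the resulting kernel over x produces the weight ‖y - z‖⁻³ of the Slobodeckij
seminorm. The bounds are uniform in ε and the boundary values converge to ψ as ε → 0, so a weak
limit inside the closed graph of the trace is the extension.

Well-posedness. The mixed form is represented by an operator T(s) on the Hilbert space, with adjoint
T(conj s) (`mixedInner_mixedOp_comm`). The equation T(s) z = y says that, up to terms in y, the
scalar component is an H¹ function v with j = A∇v and div j = s² p v. Testing with v and multiplying
by conj s gives real part Re s (⟨∇v, A∇v⟩ + |s|² ⟨v, p v⟩), hence ‖z‖ ≤ C |s|³ / Re s ‖T(s) z‖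
(`norm_le_mixedOp`). The same bound at conj s makes T(s) bijective, and T(s) z is the test function
in the inf-sup condition. For the ultra-weak form the test function of u solves L(conj s) v = u;
there the datum enters only through ⟨v, u⟩, which improves the constant to |s| / Re s. The
ultra-weak solution is the scalar component of the mixed one, as testing with m = A∇v shows. -/

theorem sq_lintegral_le {α : Type*} [MeasurableSpace α] (ν : Measure α) {f : α → ℝ≥0∞}
    (hf : AEMeasurable f ν) : (∫⁻ x, f x ∂ν) ^ 2 ≤ ν Set.univ * ∫⁻ x, f x ^ 2 ∂ν := by
  have h := ENNReal.lintegral_mul_le_Lp_mul_Lq ν Real.HolderConjugate.two_two hf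
    (aemeasurable_const (b := (1 : ℝ≥0∞)))
  simp only [Pi.mul_apply, mul_one, ENNReal.one_rpow, lintegral_const, one_mul] at h
  calc (∫⁻ x, f x ∂ν) ^ 2 ≤ ((∫⁻ x, f x ^ (2 : ℝ) ∂ν) ^ (1 / 2 : ℝ) *
        (ν Set.univ) ^ (1 / 2 : ℝ)) ^ 2 := by gcongr
    _ = ν Set.univ * ∫⁻ x, f x ^ 2 ∂ν := by
        rw [mul_pow, ← ENNReal.rpow_natCast, ← ENNReal.rpow_natCast, ← ENNReal.rpow_mul,
          ← ENNReal.rpow_mul]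
        norm_num
        rw [mul_comm]

/-- Cauchy-Schwarz against the constant 1 for the measure with density k. The kernel appears to the
first power in both factors, so no square integrability of k is needed. -/
theorem sq_lintegral_mul_le {α : Type*} [MeasurableSpace α] (ν : Measure α) {k f : α → ℝ≥0∞}
    (hk : Measurable k) (hf : Measurable f) :
    (∫⁻ x, k x * f x ∂ν) ^ 2 ≤ (∫⁻ x, k x ∂ν) * ∫⁻ x, k x * f x ^ 2 ∂ν := by
  have h := sq_lintegral_le (ν.withDensity k) hf.aemeasurable
  rw [lintegral_withDensity_eq_lintegral_mul _ hk hf,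
    lintegral_withDensity_eq_lintegral_mul _ hk (hf.pow_const 2),
    withDensity_apply _ MeasurableSet.univ, Measure.restrict_univ] at h
  exact h

/-! ### Regularity of the surface measure -/

/-- The graph parametrization attached to a chart. -/
def graphMap (e : E3 ≃ₗᵢ[ℝ] WithLp 2 (EuclideanSpace ℝ (Fin 2) × ℝ))
    (g : EuclideanSpace ℝ (Fin 2) → ℝ) (z : EuclideanSpace ℝ (Fin 2)) : E3 :=
  e.symm (WithLp.toLp 2 (z, g z))

theorem norm_prod_le_add {E F : Type*} [NormedAddCommGroup E] [NormedAddCommGroup F]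
    (z : WithLp 2 (E × F)) : ‖z‖ ≤ ‖z.fst‖ + ‖z.snd‖ := by
  rw [WithLp.prod_norm_eq_of_L2]
  refine Real.sqrt_le_iff.2 ⟨by positivity, ?_⟩
  nlinarith [norm_nonneg z.fst, norm_nonneg z.snd]

theorem dist_graphMap_le {e : E3 ≃ₗᵢ[ℝ] WithLp 2 (EuclideanSpace ℝ (Fin 2) × ℝ)}
    {g : EuclideanSpace ℝ (Fin 2) → ℝ} {M : ℝ≥0} (hg : LipschitzWith M g)
    (z z' : EuclideanSpace ℝ (Fin 2)) :
    dist (graphMap e g z) (graphMap e g z') ≤ (1 + M) * dist z z' := by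
  rw [graphMap, graphMap, e.symm.dist_map, dist_eq_norm]
  refine (norm_prod_le_add _).trans ?_
  have h := hg.dist_le_mul z z'
  rw [Real.dist_eq] at h
  rw [dist_eq_norm] at h ⊢
  change ‖z - z'‖ + |g z - g z'| ≤ _
  linarith

theorem lipschitzWith_graphMap {e : E3 ≃ₗᵢ[ℝ] WithLp 2 (EuclideanSpace ℝ (Fin 2) × ℝ)}
    {g : EuclideanSpace ℝ (Fin 2) → ℝ} {M : ℝ≥0} (hg : LipschitzWith M g) :
    LipschitzWith (1 + M) (graphMap e g) :=
  LipschitzWith.of_dist_le_mul fun z z' => by simpa using dist_graphMap_le hg z z'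

theorem lipschitzWith_chart_fst (e : E3 ≃ₗᵢ[ℝ] WithLp 2 (EuclideanSpace ℝ (Fin 2) × ℝ)) :
    LipschitzWith 1 (fun z : E3 => (e z).fst) := by
  refine LipschitzWith.of_dist_le_mul fun z z' => ?_
  rw [NNReal.coe_one, one_mul, ← e.dist_map, dist_eq_norm, dist_eq_norm]
  exact WithLp.norm_fst_le _ (e z - e z')

/-! ### The boundary inside a Lipschitz chart -/

section Chart

variable {S : Set E3} {x : E3} {r : ℝ}
  {e : E3 ≃ₗᵢ[ℝ] WithLp 2 (EuclideanSpace ℝ (Fin 2) × ℝ)}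
  {g : EuclideanSpace ℝ (Fin 2) → ℝ} {M : ℝ≥0}

/-- Being a frontier point is local, and in the ball the set is a hypograph of a continuous
function, whose frontier lies where the height equals the function. -/
theorem graphMap_of_mem_frontier (hg : LipschitzWith M g)
    (h : ∀ y ∈ Metric.ball x r, y ∈ S ↔ (e y).snd < g (e y).fst) {y : E3}
    (hyb : y ∈ Metric.ball x r) (hyf : y ∈ frontier S) : graphMap e g (e y).fst = y := by
  have hc : Continuous fun z : E3 => (e z).fst :=
    (WithLp.prod_continuous_ofLp 2 _ _).fst.comp e.continuous
  have hc2 : Continuous fun z : E3 => (e z).snd :=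
    (WithLp.prod_continuous_ofLp 2 _ _).snd.comp e.continuous
  have hset : S ∩ Metric.ball x r = {z | (e z).snd < g (e z).fst} ∩ Metric.ball x r := by
    ext z
    exact ⟨fun hz => ⟨(h z hz.2).1 hz.1, hz.2⟩, fun hz => ⟨(h z hz.2).2 hz.1, hz.2⟩⟩
  have h3 := frontier_inter_open_inter (s := S) (t := Metric.ball x r) Metric.isOpen_ball
  have h4 := frontier_inter_open_inter (s := {z : E3 | (e z).snd < g (e z).fst})
    (t := Metric.ball x r) Metric.isOpen_ball
  rw [hset] at h3
  have h5 : y ∈ frontier {z : E3 | (e z).snd < g (e z).fst} ∩ Metric.ball x r := by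
    rw [← h4, h3]; exact ⟨hyf, hyb⟩
  have h6 : (e y).snd = g (e y).fst :=
    frontier_lt_subset_eq hc2 (hg.continuous.comp hc) h5.1
  rw [graphMap, ← h6]
  exact e.symm_apply_apply y

/-- A graph point is the limit of points moved straight down, which belong to S, and does not itself
belong to S; for an open set this is membership in the frontier. -/
theorem graphMap_mem_frontier (hS : IsOpen S)
    (h : ∀ y ∈ Metric.ball x r, y ∈ S ↔ (e y).snd < g (e y).fst)
    {z : EuclideanSpace ℝ (Fin 2)} (hz : graphMap e g z ∈ Metric.ball x r) :
    graphMap e g z ∈ frontier S := by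
  rw [hS.frontier_eq]
  refine ⟨?_, fun hS' => ?_⟩
  · let γ : ℝ → E3 := fun t => e.symm (WithLp.toLp 2 (z, g z - t))
    have hγ : Continuous γ := e.symm.continuous.comp
      ((WithLp.prod_continuous_toLp 2 _ _).comp (by fun_prop))
    have hγ0 : γ 0 = graphMap e g z := by simp [γ, graphMap]
    have ht : Tendsto γ (𝓝[>] 0) (𝓝 (graphMap e g z)) := by
      rw [← hγ0]; exact hγ.continuousAt.mono_left nhdsWithin_le_nhds
    refine mem_closure_of_tendsto ht ?_
    filter_upwards [ht (Metric.isOpen_ball.mem_nhds hz), self_mem_nhdsWithin] with t h1 h2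
    refine (h _ h1).2 ?_
    simp only [γ, e.apply_symm_apply]
    exact sub_lt_self _ h2
  · have := (h _ hz).1 hS'
    simp [graphMap] at this

end Chart

/-- Regularity of a measure concentrated on `Γ`: balls centred on `Γ` have at least quadratic mass
at scales up to `r`, and balls of radius `r` have uniformly bounded mass. -/
structure IsSurfaceLike (μ : Measure E3) (Γ : Set E3) (r c C : ℝ) : Prop where
  r_pos : 0 < r
  r_le : r ≤ 1
  c_pos : 0 < c
  C_nonneg : 0 ≤ C
  ae_mem : ∀ᵐ y ∂μ, y ∈ Γ
  lower : ∀ y ∈ Γ, ∀ t, 0 < t → t ≤ r → ENNReal.ofReal (c * t ^ 2) ≤ μ (Metric.ball y t)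
  upper : ∀ x, μ (Metric.ball x r) ≤ ENNReal.ofReal C

theorem euclideanHausdorffMeasure_image_le {X Y : Type*} [MetricSpace X] [MeasurableSpace X]
    [BorelSpace X] [MetricSpace Y] [MeasurableSpace Y] [BorelSpace Y] {K : ℝ≥0} {f : X → Y}
    (hf : LipschitzWith K f) (d : ℕ) (s : Set X) :
    (μHE[d] : Measure Y) (f '' s) ≤ (K : ℝ≥0∞) ^ d * (μHE[d] : Measure X) s := by
  simp only [Measure.euclideanHausdorffMeasure_def, Measure.smul_apply, ENNReal.smul_def,
    smul_eq_mul]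
  have := hf.hausdorffMeasure_image_le (d := d) (by positivity) s
  rw [ENNReal.rpow_natCast] at this
  calc _ ≤ _ * ((K : ℝ≥0∞) ^ d * μH[d] s) := by gcongr
    _ = _ := by ring

/-- Lipschitz maps control Hausdorff measure. From below: the chart projection is 1-Lipschitz and
maps the part of Γ in a ball of radius t onto a set containing a plane disc of radius t / (1 + M).
From above: the (1 + M)-Lipschitz graph map of a plane disc covers the part of Γ in a small ball. -/
theorem LipschitzDomain.exists_isSurfaceLike (Ω : LipschitzDomain) :
    ∃ r c C : ℝ, IsSurfaceLike Ω.surf (frontier Ω.carrier) r c C := by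
  obtain ⟨r, hr, M, h⟩ := Ω.lipschitz
  let V : ℝ≥0∞ := volume (Metric.ball (0 : EuclideanSpace ℝ (Fin 2)) 1)
  have hV0 : V ≠ 0 := (Metric.measure_ball_pos _ _ one_pos).ne'
  have hVt : V ≠ ⊤ := measure_ball_lt_top.ne
  have hV : 0 < V.toReal := ENNReal.toReal_pos hV0 hVt
  have hvol : ∀ (z : EuclideanSpace ℝ (Fin 2)) (t : ℝ), 0 < t →
      volume (Metric.ball z t) = ENNReal.ofReal (t ^ 2 * V.toReal) := by
    intro z t ht
    rw [Measure.addHaar_ball _ _ ht.le, ENNReal.ofReal_mul (by positivity),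
      ENNReal.ofReal_toReal hVt]
    simp [V]
  have hM : (0 : ℝ) < 1 + M := by positivity
  -- The centre in the upper bound need not lie on Γ, so the chart is taken at a boundary point of
  -- the ball; with radius at most r / 4 the whole ball stays inside that chart. The bound by 1
  -- simplifies later constants.
  refine ⟨min 1 (r / 4), V.toReal / (1 + M) ^ 2, (1 + M) ^ 2 * ((2 * r) ^ 2 * V.toReal),
    by positivity, min_le_left _ _, by positivity, by positivity,
    ae_restrict_mem isClosed_frontier.measurableSet, ?_, ?_⟩
  · intro y hy t ht htr
    obtain ⟨e, g, hg, hyb⟩ := h y hy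
    have htr' : t ≤ r := htr.trans ((min_le_right _ _).trans (by linarith))
    have hyg := graphMap_of_mem_frontier hg hyb (Metric.mem_ball_self hr) hy
    have hsub : Metric.ball (e y).fst (t / (1 + M)) ⊆
        (fun z : E3 => (e z).fst) '' (Metric.ball y t ∩ frontier Ω.carrier) := by
      intro z hz
      have hd : dist (graphMap e g z) y < t := by
        have h1 := dist_graphMap_le (e := e) hg z (e y).fst
        rw [hyg] at h1
        rw [Metric.mem_ball, lt_div_iff₀ hM] at hz
        linarith
      refine ⟨graphMap e g z, ⟨hd, graphMap_mem_frontier Ω.isOpen hyb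
        (Metric.mem_ball.2 (hd.trans_le htr'))⟩, ?_⟩
      simp [graphMap]
    have h2 := (measure_mono (μ := μHE[2]) hsub).trans
      (euclideanHausdorffMeasure_image_le (lipschitzWith_chart_fst e) 2 _)
    rw [EuclideanSpace.euclideanHausdorffMeasure_eq_volume, hvol _ _ (by positivity)] at h2
    rw [LipschitzDomain.surf, Measure.restrict_apply Metric.isOpen_ball.measurableSet]
    simp only [ENNReal.coe_one, one_pow, one_mul] at h2
    refine le_trans (le_of_eq ?_) h2
    congr 1
    field_simp
  · intro x
    rcases (Metric.ball x (min 1 (r / 4)) ∩ frontier Ω.carrier).eq_empty_or_nonempty with h0 | h0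
    · rw [LipschitzDomain.surf, Measure.restrict_apply Metric.isOpen_ball.measurableSet, h0]
      simp
    obtain ⟨y, hyx, hy⟩ := h0
    obtain ⟨e, g, hg, hyb⟩ := h y hy
    have hsub : Metric.ball x (min 1 (r / 4)) ∩ frontier Ω.carrier ⊆
        graphMap e g '' Metric.ball (e y).fst (2 * r) := by
      rintro z ⟨hzx, hz⟩
      have hzy : dist z y < r := by
        have h1 := dist_triangle_right z y x
        have h2 : min 1 (r / 4) ≤ r / 4 := min_le_right _ _
        rw [Metric.mem_ball] at hzx hyx
        linarith
      refine ⟨(e z).fst, ?_, graphMap_of_mem_frontier hg hyb hzy hz⟩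
      have h3 := (lipschitzWith_chart_fst e).dist_le_mul z y
      rw [NNReal.coe_one, one_mul] at h3
      rw [Metric.mem_ball]
      linarith
    rw [LipschitzDomain.surf, Measure.restrict_apply Metric.isOpen_ball.measurableSet]
    refine (measure_mono hsub).trans
      ((euclideanHausdorffMeasure_image_le (lipschitzWith_graphMap hg) 2 _).trans ?_)
    rw [EuclideanSpace.euclideanHausdorffMeasure_eq_volume, hvol _ _ (by positivity),
      ENNReal.ofReal_mul (p := (1 + (M : ℝ)) ^ 2) (by positivity),
      ENNReal.ofReal_pow (by positivity), ENNReal.ofReal_add (by positivity) (by positivity)]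
    simp

/-! ### Square integrability through lower integrals -/

theorem eLpNorm_two_sq {α F : Type*} [MeasurableSpace α] [NormedAddCommGroup F] (μ : Measure α)
    (f : α → F) : eLpNorm f 2 μ ^ 2 = ∫⁻ x, ‖f x‖ₑ ^ 2 ∂μ := by
  rw [eLpNorm_eq_lintegral_rpow_enorm_toReal (by norm_num) (by norm_num), ← ENNReal.rpow_natCast,
    ← ENNReal.rpow_mul]
  simp

theorem eLpNorm_two_le_of_sq_le {α F : Type*} [MeasurableSpace α] [NormedAddCommGroup F]
    {μ : Measure α} {f : α → F} {a : ℝ≥0∞} (h : ∫⁻ x, ‖f x‖ₑ ^ 2 ∂μ ≤ a ^ 2) :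
    eLpNorm f 2 μ ≤ a := by
  rw [← eLpNorm_two_sq] at h
  exact (ENNReal.pow_le_pow_left_iff (by norm_num)).1 h

theorem tendsto_of_sq_tendsto_zero {a : ℕ → ℝ≥0∞} (h : Tendsto (fun n => a n ^ 2) atTop (𝓝 0)) :
    Tendsto a atTop (𝓝 0) := by
  have h2 := ((ENNReal.continuous_rpow_const (y := (1 / 2 : ℝ))).tendsto 0).comp h
  rw [ENNReal.zero_rpow_of_pos (by norm_num)] at h2
  refine h2.congr fun n => ?_
  simp only [Function.comp_apply]
  rw [← ENNReal.rpow_natCast, ← ENNReal.rpow_mul]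
  norm_num

/-- Multiplication by a bounded sequence that tends to zero pointwise. -/
theorem tendsto_eLpNorm_mul_zero {μ : Measure E3} {f : E3 → ℂ} (hf : MemLp f 2 μ)
    {a : ℕ → E3 → ℂ} (ha : ∀ n, Continuous (a n)) {C : ℝ} (hC : ∀ n x, ‖a n x‖ ≤ C)
    (h0 : ∀ x, Tendsto (fun n => a n x) atTop (𝓝 0)) :
    Tendsto (fun n => eLpNorm (fun x => a n x * f x) 2 μ) atTop (𝓝 0) := by
  refine tendsto_of_sq_tendsto_zero ?_
  simp only [eLpNorm_two_sq]
  have hlim : ∫⁻ _, (0 : ℝ≥0∞) ∂μ = 0 := by simp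
  rw [← hlim]
  refine tendsto_lintegral_of_dominated_convergence' (fun x => ENNReal.ofReal C ^ 2 * ‖f x‖ₑ ^ 2)
    (fun n => ?_) (fun n => ?_) ?_ ?_
  · exact (((ha n).aestronglyMeasurable.mul hf.1).enorm.pow_const 2)
  · refine Eventually.of_forall fun x => ?_
    simp only [enorm_mul, mul_pow]
    gcongr
    rw [← ofReal_norm]
    exact ENNReal.ofReal_le_ofReal (hC n x)
  · rw [lintegral_const_mul' _ _ (by simp), ← eLpNorm_two_sq]
    exact ENNReal.mul_ne_top (by simp) (by simp [hf.2.ne])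
  · refine Eventually.of_forall fun x => ?_
    have h1 : Tendsto (fun n => ‖a n x * f x‖ₑ ^ 2) atTop (𝓝 (‖(0 : ℂ) * f x‖ₑ ^ 2)) := by
      have h2 := ((h0 x).mul_const (f x)).enorm
      exact (ENNReal.continuous_pow 2).continuousAt.tendsto.comp h2
    simpa using h1

/-! ### Smooth cutoff functions -/

theorem IsTestFunction.differentiableAt {φ : E3 → ℂ} (h : IsTestFunction φ) (x : E3) :
    DifferentiableAt ℝ φ x := h.smooth.differentiable (by simp) x

theorem pderiv_mul {φ χ : E3 → ℂ} {x : E3} (hφ : DifferentiableAt ℝ φ x)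
    (hχ : DifferentiableAt ℝ χ x) (i : Fin 3) :
    pderiv i (fun y => φ y * χ y) x = φ x * pderiv i χ x + pderiv i φ x * χ x := by
  simp only [pderiv]
  rw [fderiv_fun_mul hφ hχ]
  simp [mul_comm]

theorem IsTestFunction.mul_contDiff {φ χ : E3 → ℂ} (h : IsTestFunction φ)
    (hχ : ContDiff ℝ ∞ χ) : IsTestFunction (fun x => φ x * χ x) :=
  ⟨h.smooth.mul hχ, h.compact.mul_right⟩

theorem IsTestFunction.exists_bound {φ : E3 → ℂ} (h : IsTestFunction φ) :
    ∃ C : ℝ, 0 ≤ C ∧ (∀ x, ‖φ x‖ ≤ C) ∧ ∀ i x, ‖pderiv i φ x‖ ≤ C := by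
  obtain ⟨C, hC⟩ := h.smooth.continuous.bounded_above_of_compact_support h.compact
  have h2 := fun i => (h.continuous_pderiv i).bounded_above_of_compact_support
    (h.compact.fderiv_apply ℝ (EuclideanSpace.single i (1 : ℝ)))
  choose D hD using h2
  refine ⟨|C| + ∑ i, |D i|, by positivity, fun x => ?_, fun i x => ?_⟩
  · have : 0 ≤ ∑ i, |D i| := by positivity
    linarith [hC x, le_abs_self C]
  · have : |D i| ≤ ∑ i, |D i| :=
      Finset.single_le_sum (f := fun i => |D i|) (fun _ _ => abs_nonneg _) (Finset.mem_univ i)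
    linarith [hD i x, le_abs_self (D i), abs_nonneg C]

/-- A smooth function equal to one on the unit ball. -/
def unitBump : E3 → ℂ := fun x => ((⟨1, 2, one_pos, one_lt_two⟩ : ContDiffBump (0 : E3)) x : ℂ)

theorem isTestFunction_unitBump : IsTestFunction unitBump where
  smooth := Complex.ofRealCLM.contDiff.comp (ContDiffBump.contDiff _)
  compact := (ContDiffBump.hasCompactSupport _).comp_left (g := fun t : ℝ => (t : ℂ)) (by simp)

theorem norm_unitBump_le (x : E3) : ‖unitBump x‖ ≤ 1 := by
  rw [unitBump, Complex.norm_real, Real.norm_of_nonneg (ContDiffBump.nonneg _)]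
  exact ContDiffBump.le_one _

theorem unitBump_eq_one {x : E3} (h : ‖x‖ ≤ 1) : unitBump x = 1 := by
  rw [unitBump, ContDiffBump.one_of_mem_closedBall _ (by simpa using h)]
  simp

/-- Smooth cutoff functions, equal to one on the ball of radius `n + 1`. -/
def cutoff (n : ℕ) : E3 → ℂ := fun x => unitBump ((n + 1 : ℝ)⁻¹ • x)

theorem isTestFunction_cutoff (n : ℕ) : IsTestFunction (cutoff n) where
  smooth := isTestFunction_unitBump.smooth.comp (contDiff_const_smul _)
  compact := isTestFunction_unitBump.compact.comp_smul (by positivity)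

theorem norm_cutoff_le (n : ℕ) (x : E3) : ‖cutoff n x‖ ≤ 1 := norm_unitBump_le _

theorem pderiv_cutoff (n : ℕ) (i : Fin 3) (x : E3) :
    pderiv i (cutoff n) x = ((n + 1 : ℝ)⁻¹ : ℝ) * pderiv i unitBump ((n + 1 : ℝ)⁻¹ • x) := by
  simp only [pderiv]
  have h1 : HasFDerivAt (cutoff n) ((fderiv ℝ unitBump ((n + 1 : ℝ)⁻¹ • x)).comp
      ((n + 1 : ℝ)⁻¹ • ContinuousLinearMap.id ℝ E3)) x :=
    (isTestFunction_unitBump.differentiableAt _).hasFDerivAt.comp x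
      ((n + 1 : ℝ)⁻¹ • ContinuousLinearMap.id ℝ E3).hasFDerivAt
  rw [h1.fderiv]
  simp

theorem tendsto_cutoff (x : E3) : Tendsto (fun n => cutoff n x - 1) atTop (𝓝 0) := by
  refine tendsto_const_nhds.congr' ?_
  filter_upwards [eventually_ge_atTop (Nat.ceil ‖x‖)] with n hn
  have h1 : ‖x‖ ≤ n := (Nat.le_ceil _).trans (by exact_mod_cast hn)
  rw [cutoff, unitBump_eq_one, sub_self]
  rw [norm_smul, norm_inv, Real.norm_of_nonneg (by positivity), inv_mul_le_iff₀ (by positivity)]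
  linarith

theorem exists_bound_pderiv_cutoff :
    ∃ C : ℝ, 0 ≤ C ∧ ∀ n i x, ‖pderiv i (cutoff n) x‖ ≤ C * (n + 1 : ℝ)⁻¹ := by
  obtain ⟨C, hC0, -, hC⟩ := isTestFunction_unitBump.exists_bound
  refine ⟨C, hC0, fun n i x => ?_⟩
  rw [pderiv_cutoff, norm_mul, Complex.norm_real, Real.norm_of_nonneg (by positivity), mul_comm]
  gcongr
  exact hC _ _

theorem tendsto_pderiv_cutoff (i : Fin 3) (x : E3) :
    Tendsto (fun n => pderiv i (cutoff n) x) atTop (𝓝 0) := by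
  obtain ⟨C, hC0, hC⟩ := exists_bound_pderiv_cutoff
  refine squeeze_zero_norm (fun n => hC n i x) ?_
  have h := (tendsto_one_div_add_atTop_nhds_zero_nat (𝕜 := ℝ)).const_mul C
  simpa using h

/-! ### Integral operators with a smooth convolution kernel -/

/-- `x ↦ ∫ f(y) g(x - y) dμ(y)` -/
def conv (μ : Measure E3) (f g : E3 → ℂ) (x : E3) : ℂ := ∫ y, f y * g (x - y) ∂μ

theorem conv_eq_convolution (μ : Measure E3) (f g : E3 → ℂ) :
    conv μ f g = convolution f g (ContinuousLinearMap.mul ℝ ℂ) μ := rfl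

section Conv

variable {μ : Measure E3} {f g : E3 → ℂ}

theorem contDiff_conv (hf : LocallyIntegrable f μ) (hg : IsTestFunction g) :
    ContDiff ℝ ∞ (conv μ f g) := by
  rw [conv_eq_convolution]
  exact hg.compact.contDiff_convolution_right (n := ⊤) _ hf hg.smooth

theorem integrable_conv (hf : LocallyIntegrable f μ) (hg : Continuous g)
    (hgc : HasCompactSupport g) (x : E3) : Integrable (fun y => f y * g (x - y)) μ :=
  hgc.convolutionExists_right (ContinuousLinearMap.mul ℝ ℂ) hf hg x

theorem pderiv_conv (hf : LocallyIntegrable f μ) (hg : IsTestFunction g) (x : E3) (i : Fin 3) :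
    pderiv i (conv μ f g) x = conv μ f (pderiv i g) x := by
  -- The differentiation theorem is used with a kernel that does not depend on the parameter;
  -- composing with the inclusion of the second factor recovers the derivative in x.
  have h1 : ContDiff ℝ 1 (Function.HasUncurry.uncurry fun (_ : E3) => g) :=
    (hg.smooth.of_le (by exact_mod_cast le_top)).comp contDiff_snd
  have h := hasFDerivAt_convolution_right_with_param (ContinuousLinearMap.mul ℝ ℂ)
    (g := fun (_ : E3) => g) (s := Set.univ) (k := tsupport g) isOpen_univ hg.compact.isCompact
    (fun _ x _ hx => image_eq_zero_of_notMem_tsupport hx) hf h1.contDiffOn (0, x) (Set.mem_univ _)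
  have h2 : HasFDerivAt (fun y : E3 => ((0 : E3), y)) (ContinuousLinearMap.inr ℝ E3 E3) x :=
    (ContinuousLinearMap.inr ℝ E3 E3).hasFDerivAt
  have h3 := h.comp x h2
  have h4 := congrArg (fun T : E3 →L[ℝ] ℂ => T (EuclideanSpace.single i 1)) h3.fderiv
  change pderiv i (conv μ f g) x = _ at h4
  rw [h4]
  simp only [ContinuousLinearMap.comp_apply, convolution_def]
  have hd : ∀ z : E3, fderiv ℝ (Function.HasUncurry.uncurry fun (_ : E3) => g) (0, z) =
      (fderiv ℝ g z).comp (ContinuousLinearMap.snd ℝ E3 E3) := fun z =>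
    ((hg.differentiableAt z).hasFDerivAt.comp (0, z)
      (ContinuousLinearMap.snd ℝ E3 E3).hasFDerivAt).fderiv
  have hcg : HasCompactSupport (fun z : E3 =>
      (fderiv ℝ g z).comp (ContinuousLinearMap.snd ℝ E3 E3)) :=
    (hg.compact.fderiv ℝ).comp_left
      (g := fun T : E3 →L[ℝ] ℂ => T.comp (ContinuousLinearMap.snd ℝ E3 E3)) (by simp)
  have hgc : Continuous (fun z : E3 =>
      (fderiv ℝ g z).comp (ContinuousLinearMap.snd ℝ E3 E3)) :=
    (hg.smooth.continuous_fderiv (by simp)).clm_comp continuous_const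
  have hconv := hcg.convolutionExists_right
    ((ContinuousLinearMap.mul ℝ ℂ).precompR (E3 × E3)) hf hgc x
  simp only [hd]
  rw [ContinuousLinearMap.integral_apply hconv]
  simp [conv, pderiv, ContinuousLinearMap.precompR_apply]

end Conv

/-! ### Mollification -/

/-- The bump function underlying `mollifier`. -/
def mollBump (n : ℕ) : ContDiffBump (0 : E3) :=
  ⟨(n + 1 : ℝ)⁻¹ / 2, (n + 1 : ℝ)⁻¹, by positivity, half_lt_self (by positivity)⟩

/-- Smooth nonnegative functions of integral one, supported in the ball of radius `1 / (n + 1)`. -/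
def mollifier (n : ℕ) : E3 → ℂ := fun x => ((mollBump n).normed volume x : ℂ)

theorem isTestFunction_mollifier (n : ℕ) : IsTestFunction (mollifier n) where
  smooth := Complex.ofRealCLM.contDiff.comp (ContDiffBump.contDiff_normed (n := ⊤) _)
  compact := (ContDiffBump.hasCompactSupport_normed _).comp_left
    (g := fun t : ℝ => (t : ℂ)) (by simp)

theorem lintegral_mollifier (n : ℕ) : ∫⁻ x, ‖mollifier n x‖ₑ = 1 := by
  have h1 : ∀ x, ‖mollifier n x‖ₑ = ENNReal.ofReal ((mollBump n).normed volume x) := fun x => by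
    rw [← ofReal_norm, mollifier, Complex.norm_real,
      Real.norm_of_nonneg ((mollBump n).nonneg_normed x)]
  simp only [h1]
  rw [← ofReal_integral_eq_lintegral_ofReal (mollBump n).integrable_normed
    (Eventually.of_forall fun x => (mollBump n).nonneg_normed x), (mollBump n).integral_normed,
    ENNReal.ofReal_one]

theorem integral_mollifier (n : ℕ) : ∫ x, mollifier n x = 1 := by
  simp only [mollifier]
  rw [integral_complex_ofReal, (mollBump n).integral_normed, Complex.ofReal_one]

theorem mollifier_eq_zero {n : ℕ} {x : E3} (h : (n + 1 : ℝ)⁻¹ ≤ ‖x‖) : mollifier n x = 0 := by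
  have h1 : x ∉ Function.support ((mollBump n).normed volume) := by
    rw [(mollBump n).support_normed_eq]
    simpa [mollBump] using h
  rw [mollifier, Function.notMem_support.1 h1, Complex.ofReal_zero]

/-- Translations act continuously on Lᵖ only for finite p. -/
instance : Fact ((2 : ℝ≥0∞) ≠ ⊤) := ⟨by norm_num⟩

theorem eventually_translation_close (f : L2) {δ : ℝ≥0∞} (hδ : 0 < δ) :
    ∀ᶠ t : E3 in 𝓝 0, ∫⁻ x, ‖f (x - t) - f x‖ₑ ^ 2 ≤ δ ^ 2 := by
  have hc : Continuous fun t : E3 => (DomAddAct.mk (-t) +ᵥ f : L2) := by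
    have : Continuous fun t : E3 => DomAddAct.mk (-t) :=
      DomAddAct.continuous_mk.comp continuous_neg
    exact this.vadd continuous_const
  have h0 : (DomAddAct.mk (-(0 : E3)) +ᵥ f : L2) = f := by
    ext
    filter_upwards [DomAddAct.vadd_Lp_ae_eq (DomAddAct.mk (-(0 : E3))) f] with x hx
    rw [hx, Equiv.symm_apply_apply, vadd_eq_add, neg_zero, zero_add]
  have h1 := hc.tendsto 0
  rw [h0] at h1
  filter_upwards [h1 (Metric.eball_mem_nhds f hδ)] with t ht
  have h2 : edist (DomAddAct.mk (-t) +ᵥ f : L2) f ≤ δ := le_of_lt ht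
  rw [Lp.edist_def] at h2
  rw [← eLpNorm_two_sq]
  gcongr
  refine le_of_eq_of_le (eLpNorm_congr_ae ?_) h2
  filter_upwards [DomAddAct.vadd_Lp_ae_eq (DomAddAct.mk (-t)) f] with x hx
  rw [Pi.sub_apply, hx, Equiv.symm_apply_apply, vadd_eq_add, sub_eq_neg_add x t]

theorem locallyIntegrable_L2 (f : L2) : LocallyIntegrable f volume :=
  (Lp.memLp f).locallyIntegrable (by norm_num)

/-- The mollifier has integral one, so the error is an average of translation differences;
Cauchy-Schwarz for this average and Tonelli reduce it to the L² modulus of continuity. -/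
theorem lintegral_conv_mollifier_sub_le (f : L2) (n : ℕ) :
    ∫⁻ x, ‖conv volume f (mollifier n) x - f x‖ₑ ^ 2 ≤
      ∫⁻ t, ‖mollifier n t‖ₑ * ∫⁻ x, ‖f (x - t) - f x‖ₑ ^ 2 := by
  have hη := isTestFunction_mollifier n
  have hfm : Measurable (f : E3 → ℂ) := (Lp.stronglyMeasurable f).measurable
  have hηm : Measurable (mollifier n) := hη.smooth.continuous.measurable
  have h1 : ∀ x, ‖conv volume f (mollifier n) x - f x‖ₑ ≤
      ∫⁻ t, ‖mollifier n t‖ₑ * ‖f (x - t) - f x‖ₑ := by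
    intro x
    have hi := integrable_conv (locallyIntegrable_L2 f) hη.smooth.continuous hη.compact x
    have hi2 : Integrable (fun t => f (x - t) * mollifier n t) volume := by
      have := (integrable_comp_sub_left (fun y => f y * mollifier n (x - y)) x).2 hi
      simpa using this
    have hi3 : Integrable (fun t => f x * mollifier n t) volume :=
      (hη.smooth.continuous.integrable_of_hasCompactSupport hη.compact).const_mul _
    have h2 : conv volume f (mollifier n) x = ∫ t, f (x - t) * mollifier n t := by
      rw [conv, ← integral_sub_left_eq_self _ _ x]
      simp
    have h3 : f x = ∫ t, f x * mollifier n t := by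
      rw [integral_const_mul, integral_mollifier, mul_one]
    have h4 : conv volume f (mollifier n) x - f x =
        ∫ t, (f (x - t) * mollifier n t - f x * mollifier n t) := by
      rw [integral_sub hi2 hi3, ← h2, ← h3]
    rw [h4]
    refine (enorm_integral_le_lintegral_enorm _).trans (le_of_eq (lintegral_congr fun t => ?_))
    rw [← sub_mul, enorm_mul, mul_comm]
  calc ∫⁻ x, ‖conv volume f (mollifier n) x - f x‖ₑ ^ 2
      ≤ ∫⁻ x, ∫⁻ t, ‖mollifier n t‖ₑ * ‖f (x - t) - f x‖ₑ ^ 2 := by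
        refine lintegral_mono fun x => ?_
        refine (pow_le_pow_left' (h1 x) 2).trans ?_
        refine (sq_lintegral_mul_le volume hηm.enorm (by fun_prop)).trans ?_
        rw [lintegral_mollifier, one_mul]
    _ = ∫⁻ t, ∫⁻ x, ‖mollifier n t‖ₑ * ‖f (x - t) - f x‖ₑ ^ 2 := by
        rw [lintegral_lintegral_swap]
        exact Measurable.aemeasurable (by fun_prop)
    _ = _ := by
        refine lintegral_congr fun t => ?_
        rw [lintegral_const_mul' _ _ (by simp)]

theorem tendsto_conv_mollifier (f : L2) :
    Tendsto (fun n => eLpNorm (fun x => conv volume f (mollifier n) x - f x) 2 volume)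
      atTop (𝓝 0) := by
  rw [ENNReal.tendsto_nhds_zero]
  intro δ hδ
  obtain ⟨ρ, hρ, hball⟩ := Metric.eventually_nhds_iff.1 (eventually_translation_close f hδ)
  have h0 : Tendsto (fun n : ℕ => (n + 1 : ℝ)⁻¹) atTop (𝓝 0) := by
    simpa using tendsto_one_div_add_atTop_nhds_zero_nat (𝕜 := ℝ)
  filter_upwards [h0.eventually (gt_mem_nhds hρ)] with n hn
  refine eLpNorm_two_le_of_sq_le ((lintegral_conv_mollifier_sub_le f n).trans ?_)
  calc _ ≤ ∫⁻ t, ‖mollifier n t‖ₑ * δ ^ 2 := by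
        refine lintegral_mono fun t => ?_
        by_cases ht : ‖t‖ < (n + 1 : ℝ)⁻¹
        · gcongr
          exact hball (by simpa using ht.trans hn)
        · simp [mollifier_eq_zero (not_lt.1 ht)]
    _ = δ ^ 2 := by
        rw [lintegral_mul_const _ (isTestFunction_mollifier n).smooth.continuous.measurable.enorm,
          lintegral_mollifier, one_mul]

/-! ### Density of test functions in `H¹(ℝ³)` -/

theorem IsTestFunction.integral_mul_pderiv {φ χ : E3 → ℂ} (hφ : IsTestFunction φ)
    (hχ : IsTestFunction χ) (i : Fin 3) :
    ∫ x, φ x * pderiv i χ x = -∫ x, pderiv i φ x * χ x := by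
  refine integral_mul_fderiv_eq_neg_fderiv_mul_of_integrable ?_ ?_ ?_
    (fun x _ => hφ.differentiableAt x) (fun x _ => hχ.differentiableAt x)
  · exact (hφ.memLp_pderiv i).integrable_mul hχ.memLp
  · exact hφ.memLp.integrable_mul (hχ.memLp_pderiv i)
  · exact hφ.memLp.integrable_mul hχ.memLp

/-- The element of `H¹(ℝ³)` with given representatives of the function and its weak gradient. -/
def mkH1 {u : E3 → ℂ} {g : Fin 3 → E3 → ℂ} (hu : MemLp u 2 volume) (hg : ∀ i, MemLp (g i) 2 volume)
    (h : ∀ φ, IsTestFunction φ → ∀ i, ∫ x, u x * pderiv i φ x = -∫ x, g i x * φ x) : H1 :=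
  ⟨WithLp.toLp 2 (hu.toLp u, WithLp.toLp 2 fun i => (hg i).toLp (g i)), by
    intro φ hφ i
    have h1 : ∫ x, hu.toLp u x * pderiv i φ x = ∫ x, u x * pderiv i φ x := by
      refine integral_congr_ae ?_
      filter_upwards [hu.coeFn_toLp] with x hx
      rw [hx]
    have h2 : ∫ x, (hg i).toLp (g i) x * φ x = ∫ x, g i x * φ x := by
      refine integral_congr_ae ?_
      filter_upwards [(hg i).coeFn_toLp] with x hx
      rw [hx]
    change ∫ x, hu.toLp u x * pderiv i φ x = -∫ x, (hg i).toLp (g i) x * φ x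
    rw [h1, h2, h φ hφ i]⟩

/-- A test function as an element of `H¹(ℝ³)`. -/
def IsTestFunction.toH1 {φ : E3 → ℂ} (hφ : IsTestFunction φ) : H1 :=
  mkH1 hφ.memLp hφ.memLp_pderiv fun _ hχ i => hφ.integral_mul_pderiv hχ i

theorem H1.norm_sq_eq (v : H1) : ‖v‖ ^ 2 = ‖v.val‖ ^ 2 + ∑ i, ‖v.grad i‖ ^ 2 := by
  rw [← PiLp.norm_sq_eq_of_L2]
  exact WithLp.prod_norm_sq_eq_of_L2 _

theorem H1.norm_le_sum (v : H1) : ‖v‖ ≤ ‖v.val‖ + ∑ i, ‖v.grad i‖ := by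
  have h1 := v.norm_sq_eq
  have h2 : ∑ i, ‖v.grad i‖ ^ 2 ≤ (∑ i, ‖v.grad i‖) ^ 2 :=
    Finset.sum_sq_le_sq_sum_of_nonneg fun i _ => norm_nonneg _
  have h3 : 0 ≤ ∑ i, ‖v.grad i‖ := by positivity
  refine abs_le_of_sq_le_sq' ?_ (by positivity) |>.2
  nlinarith [norm_nonneg v.val]

theorem H1.norm_val_le (v : H1) : ‖v.val‖ ≤ ‖v‖ := by
  have h1 := v.norm_sq_eq
  have h3 : 0 ≤ ∑ i, ‖v.grad i‖ ^ 2 := by positivity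
  exact abs_le_of_sq_le_sq' (by linarith) (by positivity) |>.2

theorem H1.norm_grad_le (v : H1) : ‖v.grad‖ ≤ ‖v‖ := by
  have h1 : ‖v‖ ^ 2 = ‖v.val‖ ^ 2 + ‖v.grad‖ ^ 2 := WithLp.prod_norm_sq_eq_of_L2 _
  exact abs_le_of_sq_le_sq' (by nlinarith [norm_nonneg v.val]) (by positivity) |>.2

theorem tendsto_toLp_iff {μ : Measure E3} {f : ℕ → E3 → ℂ} (hf : ∀ n, MemLp (f n) 2 μ)
    (g : Lp ℂ 2 μ) : Tendsto (fun n => (hf n).toLp (f n)) atTop (𝓝 g) ↔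
      Tendsto (fun n => eLpNorm (fun x => f n x - g x) 2 μ) atTop (𝓝 0) := by
  rw [Lp.tendsto_Lp_iff_tendsto_eLpNorm']
  refine iff_of_eq (congrArg (fun s => Tendsto s atTop (𝓝 0)) (funext fun n => ?_))
  refine eLpNorm_congr_ae ?_
  filter_upwards [(hf n).coeFn_toLp] with x hx
  simp [hx]

theorem tendsto_H1_iff {v : ℕ → H1} {w : H1} : Tendsto v atTop (𝓝 w) ↔
    Tendsto (fun n => (v n).val) atTop (𝓝 w.val) ∧
      ∀ i, Tendsto (fun n => (v n).grad i) atTop (𝓝 (w.grad i)) := by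
  constructor
  · intro h
    have h1 := (continuous_subtype_val.tendsto w).comp h
    refine ⟨((WithLp.prod_continuous_ofLp 2 _ _).fst.tendsto w.1).comp h1, fun i => ?_⟩
    have h2 := ((WithLp.prod_continuous_ofLp 2 _ _).snd.tendsto w.1).comp h1
    exact ((PiLp.continuous_apply 2 _ i).tendsto _).comp h2
  · rintro ⟨h1, h2⟩
    rw [tendsto_iff_norm_sub_tendsto_zero]
    refine squeeze_zero (fun _ => norm_nonneg _) (fun n => (v n - w).norm_le_sum) ?_
    have h3 := tendsto_iff_norm_sub_tendsto_zero.1 h1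
    have h4 := tendsto_finsetSum Finset.univ
      fun i _ => tendsto_iff_norm_sub_tendsto_zero.1 (h2 i)
    have h5 := h3.add h4
    rw [Finset.sum_const_zero, add_zero] at h5
    exact h5

theorem IsTestFunction.memLp_mul {χ : E3 → ℂ} (hχ : IsTestFunction χ) (f : L2) :
    MemLp (fun x => χ x * f x) 2 volume :=
  (Lp.memLp f).mul (hχ.smooth.continuous.memLp_top_of_hasCompactSupport hχ.compact _)

theorem IsTestFunction.memLp_pderiv_mul {χ : E3 → ℂ} (hχ : IsTestFunction χ) (i : Fin 3)
    (f : L2) : MemLp (fun x => pderiv i χ x * f x) 2 volume :=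
  (Lp.memLp f).mul ((hχ.continuous_pderiv i).memLp_top_of_hasCompactSupport
    (hχ.compact.fderiv_apply ℝ _) _)

/-- The product of a test function and an element of `H¹(ℝ³)`. -/
def IsTestFunction.mulH1 {χ : E3 → ℂ} (hχ : IsTestFunction χ) (v : H1) : H1 :=
  mkH1 (u := fun x => χ x * v.val x)
    (g := fun i x => χ x * v.grad i x + pderiv i χ x * v.val x)
    (hχ.memLp_mul v.val) (fun i => (hχ.memLp_mul (v.grad i)).add (hχ.memLp_pderiv_mul i v.val)) (by
    intro φ hφ i
    have hχφ := hχ.mul_contDiff hφ.smooth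
    have h := v.2 _ hχφ i
    have hp : ∀ x, pderiv i (fun y => χ y * φ y) x = χ x * pderiv i φ x + pderiv i χ x * φ x :=
      fun x => pderiv_mul (hχ.differentiableAt x) (hφ.differentiableAt x) i
    simp only [hp] at h
    have hb1 : MemLp χ ⊤ volume := hχ.smooth.continuous.memLp_top_of_hasCompactSupport hχ.compact _
    have hb2 : MemLp (pderiv i χ) ⊤ volume := (hχ.continuous_pderiv i).memLp_top_of_hasCompactSupport
        (hχ.compact.fderiv_apply ℝ _) _
    have i1 : Integrable (fun x => v.val x * (χ x * pderiv i φ x)) volume :=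
      integrable_L2_mul v.val ((hφ.memLp_pderiv i).mul hb1)
    have i2 : Integrable (fun x => v.val x * (pderiv i χ x * φ x)) volume :=
      integrable_L2_mul v.val (hφ.memLp.mul hb2)
    have i3 : Integrable (fun x => v.grad i x * (χ x * φ x)) volume :=
      integrable_L2_mul (v.grad i) (hφ.memLp.mul hb1)
    have e1 : ∫ x, v.val x * (χ x * pderiv i φ x + pderiv i χ x * φ x) =
        (∫ x, v.val x * (χ x * pderiv i φ x)) + ∫ x, v.val x * (pderiv i χ x * φ x) := by
      rw [← integral_add i1 i2]
      exact integral_congr_ae (Eventually.of_forall fun x => mul_add _ _ _)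
    have e2 : ∫ x, (χ x * v.grad i x + pderiv i χ x * v.val x) * φ x =
        (∫ x, v.grad i x * (χ x * φ x)) + ∫ x, v.val x * (pderiv i χ x * φ x) := by
      rw [← integral_add i3 i2]
      exact integral_congr_ae (Eventually.of_forall fun x => by ring)
    have e3 : ∫ x, χ x * v.val x * pderiv i φ x = ∫ x, v.val x * (χ x * pderiv i φ x) :=
      integral_congr_ae (Eventually.of_forall fun x => by ring)
    have h' : (∫ x, v.val x * (χ x * pderiv i φ x + pderiv i χ x * φ x)) =
      -∫ x, v.grad i x * (χ x * φ x) := h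
    rw [e3, e2, neg_add, ← h', e1]
    ring)

/-- By the product rule the gradient has the extra term ∂ᵢ(cutoff) v, which is dominated by a
multiple of |v| and tends to zero pointwise. -/
theorem tendsto_cutoff_mulH1 (v : H1) :
    Tendsto (fun n => (isTestFunction_cutoff n).mulH1 v) atTop (𝓝 v) := by
  have hb : ∀ n x, ‖cutoff n x - 1‖ ≤ 2 := fun n x =>
    (norm_sub_le _ _).trans (by rw [norm_one]; linarith [norm_cutoff_le n x])
  have hc : ∀ n, Continuous fun x => cutoff n x - 1 := fun n =>
    (isTestFunction_cutoff n).smooth.continuous.sub continuous_const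
  have hm := fun n => (isTestFunction_cutoff n).memLp_mul
  refine tendsto_H1_iff.2 ⟨(tendsto_toLp_iff (fun n => hm n v.val) _).2 ?_,
    fun i => (tendsto_toLp_iff (fun n => (hm n (v.grad i)).add
      ((isTestFunction_cutoff n).memLp_pderiv_mul i v.val)) _).2 ?_⟩
  · refine (tendsto_eLpNorm_mul_zero (Lp.memLp v.val) hc hb tendsto_cutoff).congr fun n => ?_
    congr 1; ext x; ring
  · obtain ⟨C, hC0, hC⟩ := exists_bound_pderiv_cutoff
    have h1 := tendsto_eLpNorm_mul_zero (Lp.memLp (v.grad i)) hc hb tendsto_cutoff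
    have h2 := tendsto_eLpNorm_mul_zero (Lp.memLp v.val)
      (fun n => (isTestFunction_cutoff n).continuous_pderiv i) (C := C)
      (fun n x => (hC n i x).trans (mul_le_of_le_one_right hC0 (inv_le_one_of_one_le₀ (by simp))))
      (tendsto_pderiv_cutoff i)
    have h3 := h1.add h2
    rw [add_zero] at h3
    refine tendsto_of_tendsto_of_tendsto_of_le_of_le tendsto_const_nhds h3 (fun _ => zero_le) ?_
    intro n
    have h4 : (fun x => cutoff n x * v.grad i x + pderiv i (cutoff n) x * v.val x -
        v.grad i x) = (fun x => (cutoff n x - 1) * v.grad i x) +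
          fun x => pderiv i (cutoff n) x * v.val x := by
      ext x
      rw [Pi.add_apply]
      ring
    refine le_of_eq_of_le (congrArg (fun f => eLpNorm f 2 volume) h4) (eLpNorm_add_le
      ((hc n).aestronglyMeasurable.mul (Lp.aestronglyMeasurable _))
      (((isTestFunction_cutoff n).continuous_pderiv i).aestronglyMeasurable.mul
        (Lp.aestronglyMeasurable _)) (by norm_num))

/-! ### Mollification of weakly differentiable functions -/

theorem conv_congr {μ : Measure E3} {f f' : E3 → ℂ} (h : f =ᵐ[μ] f') (g : E3 → ℂ) :
    conv μ f g = conv μ f' g := by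
  ext x
  refine integral_congr_ae ?_
  filter_upwards [h] with y hy
  rw [hy]

theorem isTestFunction_conv {f g : E3 → ℂ} {μ : Measure E3} (hf : LocallyIntegrable f μ)
    (hfc : HasCompactSupport f) (hg : IsTestFunction g) : IsTestFunction (conv μ f g) where
  smooth := contDiff_conv hf hg
  compact := hfc.convolution (ContinuousLinearMap.mul ℝ ℂ) hg.compact

/-- Weak derivatives commute with mollification. -/
theorem pderiv_conv_H1 (v : H1) {g : E3 → ℂ} (hg : IsTestFunction g) (i : Fin 3) (x : E3) :
    pderiv i (conv volume v.val g) x = conv volume (v.grad i) g x := by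
  rw [pderiv_conv (locallyIntegrable_L2 _) hg]
  have hφ : IsTestFunction fun y => g (x - y) :=
    ⟨hg.smooth.comp (contDiff_const.sub contDiff_id),
      hg.compact.comp_homeomorph (Homeomorph.subLeft x)⟩
  have hp : ∀ y, pderiv i (fun y => g (x - y)) y = -pderiv i g (x - y) := by
    intro y
    have h1 : HasFDerivAt (fun y => g (x - y))
        ((fderiv ℝ g (x - y)).comp (-ContinuousLinearMap.id ℝ E3)) y :=
      (hg.differentiableAt _).hasFDerivAt.comp y ((hasFDerivAt_id y).const_sub x)
    simp [pderiv, h1.fderiv]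
  have h := v.2 _ hφ i
  simp only [hp, mul_neg, integral_neg, neg_inj] at h
  exact h

theorem mulH1_mem_closure {χ : E3 → ℂ} (hχ : IsTestFunction χ) (v : H1) :
    hχ.mulH1 v ∈ closure {w : H1 | ∃ (φ : E3 → ℂ) (hφ : IsTestFunction φ), w = hφ.toH1} := by
  have hval : (hχ.mulH1 v).val =ᵐ[volume] fun x => χ x * v.val x :=
    MemLp.coeFn_toLp (hχ.memLp_mul v.val)
  have hli : LocallyIntegrable (fun x => χ x * v.val x) volume :=
    (locallyIntegrable_L2 (hχ.mulH1 v).val).congr hval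
  have hT : ∀ n, IsTestFunction (conv volume (hχ.mulH1 v).val (mollifier n)) := fun n => by
    -- Compact support is visible only on the representative χ v, not on the chosen representative
    -- of its class, so the convolution is rewritten first.
    rw [conv_congr hval]
    exact isTestFunction_conv hli hχ.compact.mul_right (isTestFunction_mollifier n)
  refine mem_closure_of_tendsto (f := fun n => (hT n).toH1) (b := atTop) ?_
    (Eventually.of_forall fun n => ⟨_, hT n, rfl⟩)
  refine tendsto_H1_iff.2 ⟨(tendsto_toLp_iff (fun n => (hT n).memLp) _).2 (tendsto_conv_mollifier _),
    fun i => (tendsto_toLp_iff (fun n => (hT n).memLp_pderiv i) _).2 ?_⟩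
  simp only [pderiv_conv_H1 _ (isTestFunction_mollifier _)]
  exact tendsto_conv_mollifier _

theorem mem_closure_testFunctions (v : H1) :
    v ∈ closure {w : H1 | ∃ (φ : E3 → ℂ) (hφ : IsTestFunction φ), w = hφ.toH1} := by
  rw [← closure_closure]
  exact mem_closure_of_tendsto (tendsto_cutoff_mulH1 v)
    (Eventually.of_forall fun n => mulH1_mem_closure _ v)

/-! ### The bilinear pairing and multiplication operators on `L²(ℝ³)` -/

/-- The pairing is bilinear while the inner product is conjugate linear on the left; the conjugation
on f accounts for the difference. This makes continuity and Cauchy-Schwarz available for the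
pairing. -/
theorem integral_mul_eq_inner (f g : L2) : ∫ x, f x * g x = inner ℂ (star f) g := by
  rw [L2.inner_def]
  refine integral_congr_ae ?_
  filter_upwards [Lp.coeFn_star f] with x hx
  rw [hx]
  simp [mul_comm]

theorem integral_mul_star_eq_inner (f g : L2) : ∫ x, f x * (star g) x = inner ℂ g f := by
  rw [L2.inner_def]
  refine integral_congr_ae ?_
  filter_upwards [Lp.coeFn_star g] with x hx
  rw [hx]
  simp

theorem integral_mul_toLp_eq_inner (f : L2) {g : E3 → ℂ} (hg : MemLp g 2 volume) :
    ∫ x, f x * g x = inner ℂ (star (hg.toLp g)) f := by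
  rw [← integral_mul_eq_inner]
  refine integral_congr_ae ?_
  filter_upwards [hg.coeFn_toLp] with x hx
  rw [hx, mul_comm]

theorem norm_star_L2 (f : L2) : ‖star f‖ = ‖f‖ := by
  have h : ∀ᵐ x, ‖(star f) x‖ = ‖f x‖ := by
    filter_upwards [Lp.coeFn_star f] with x hx
    rw [hx, Pi.star_apply, norm_star]
  exact le_antisymm (Lp.norm_le_norm_of_ae_le (h.mono fun _ hx => hx.le))
    (Lp.norm_le_norm_of_ae_le (h.mono fun _ hx => hx.ge))

/-- `a` is measurable and essentially bounded by `C`. -/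
structure IsMultiplier (a : E3 → ℂ) (C : ℝ) : Prop where
  aesm : AEStronglyMeasurable a volume
  bound : ∀ᵐ x, ‖a x‖ ≤ C

theorem IsMultiplier.memLp {a : E3 → ℂ} {C : ℝ} (h : IsMultiplier a C) (f : L2) :
    MemLp (fun x => a x * f x) 2 volume :=
  (Lp.memLp f).mul (memLp_top_of_bound h.aesm C h.bound)

/-- Multiplication by an essentially bounded function on `L²(ℝ³)`. -/
def mulOp {a : E3 → ℂ} {C : ℝ} (h : IsMultiplier a C) : L2 →L[ℂ] L2 :=
  LinearMap.mkContinuous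
    { toFun := fun f => (h.memLp f).toLp _
      map_add' := fun f g => by
        ext
        filter_upwards [(h.memLp (f + g)).coeFn_toLp, (h.memLp f).coeFn_toLp,
          (h.memLp g).coeFn_toLp, Lp.coeFn_add f g, Lp.coeFn_add ((h.memLp f).toLp _)
          ((h.memLp g).toLp _)] with x h1 h2 h3 h4 h5
        rw [h1, h5, Pi.add_apply, h2, h3, h4, Pi.add_apply, mul_add]
      map_smul' := fun c f => by
        ext
        filter_upwards [(h.memLp (c • f)).coeFn_toLp, (h.memLp f).coeFn_toLp,
          Lp.coeFn_smul c f, Lp.coeFn_smul c ((h.memLp f).toLp _)] with x h1 h2 h3 h4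
        rw [RingHom.id_apply, h1, h4, Pi.smul_apply, h2, h3, Pi.smul_apply, smul_eq_mul,
          smul_eq_mul, mul_left_comm] } C fun f => by
    refine Lp.norm_le_mul_norm_of_ae_le_mul ?_
    filter_upwards [(h.memLp f).coeFn_toLp, h.bound] with x h1 h2
    have h3 : (h.memLp f).toLp _ x = a x * f x := h1
    rw [LinearMap.coe_mk, AddHom.coe_mk, h3, norm_mul]
    gcongr

theorem coeFn_mulOp {a : E3 → ℂ} {C : ℝ} (h : IsMultiplier a C) (f : L2) :
    mulOp h f =ᵐ[volume] fun x => a x * f x := (h.memLp f).coeFn_toLp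

theorem norm_mulOp_le {a : E3 → ℂ} {C : ℝ} (h : IsMultiplier a C) (f : L2) :
    ‖mulOp h f‖ ≤ C * ‖f‖ := by
  refine Lp.norm_le_mul_norm_of_ae_le_mul ?_
  filter_upwards [coeFn_mulOp h f, h.bound] with x h1 h2
  rw [h1, norm_mul]
  gcongr

theorem isMultiplier_indicator {S : Set E3} (hS : MeasurableSet S) :
    IsMultiplier (S.indicator fun _ => (1 : ℂ)) 1 where
  aesm := (stronglyMeasurable_const.indicator hS).aestronglyMeasurable
  bound := Eventually.of_forall fun x => by
    by_cases hx : x ∈ S <;> simp [hx]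

/-- Multiplication by the indicator function of a measurable set. -/
abbrev indOp {S : Set E3} (hS : MeasurableSet S) : L2 →L[ℂ] L2 := mulOp (isMultiplier_indicator hS)

theorem norm_indOp_le {S : Set E3} (hS : MeasurableSet S) (f : L2) : ‖indOp hS f‖ ≤ ‖f‖ := by
  simpa using norm_mulOp_le (isMultiplier_indicator hS) f

theorem setIntegral_mul_eq_inner {S : Set E3} (hS : MeasurableSet S) (f g : L2) :
    ∫ x in S, f x * g x = inner ℂ (star f) (indOp hS g) := by
  rw [← integral_mul_eq_inner, ← integral_indicator hS]
  refine integral_congr_ae ?_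
  filter_upwards [coeFn_mulOp (isMultiplier_indicator hS) g] with x hx
  rw [hx]
  by_cases h : x ∈ S <;> simp [h]

/-! ### Completeness -/

/-- Each test function and index imposes an equation between continuous functionals of the pair, so
the subspace is an intersection of closed sets. -/
theorem isClosed_H1Sub : IsClosed (H1Sub : Set (WithLp 2 (L2 × L2vec))) := by
  have h : (H1Sub : Set (WithLp 2 (L2 × L2vec))) =
      ⋂ (φ : E3 → ℂ) (hφ : IsTestFunction φ) (i : Fin 3),
        {z | inner ℂ (star ((hφ.memLp_pderiv i).toLp _)) z.fst =
          -inner ℂ (star (hφ.memLp.toLp φ)) (z.snd i)} := by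
    ext z
    simp only [Set.mem_iInter]
    refine forall_congr' fun φ => forall_congr' fun hφ => forall_congr' fun i => ?_
    rw [Set.mem_ofPred_eq, ← integral_mul_toLp_eq_inner, ← integral_mul_toLp_eq_inner]
  rw [h]
  refine isClosed_iInter fun φ => isClosed_iInter fun hφ => isClosed_iInter fun i =>
    isClosed_eq ?_ ?_
  · exact continuous_const.inner (WithLp.prod_continuous_ofLp 2 _ _).fst
  · exact (continuous_const.inner ((PiLp.continuous_apply 2 _ i).comp
      (WithLp.prod_continuous_ofLp 2 _ _).snd)).neg

theorem isWeakDiv_iff {m : L2vec} {d : L2} : IsWeakDiv m d ↔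
    ∀ (φ : E3 → ℂ) (hφ : IsTestFunction φ),
      ∑ i, inner ℂ (star ((hφ.memLp_pderiv i).toLp _)) (m i) =
        -inner ℂ (star (hφ.memLp.toLp φ)) d := by
  refine forall_congr' fun φ => forall_congr' fun hφ => ?_
  rw [integral_sum_mul m hφ]
  simp only [← integral_mul_toLp_eq_inner]

theorem isClosed_HdivSub : IsClosed (HdivSub : Set (WithLp 2 (L2vec × L2))) := by
  have h : (HdivSub : Set (WithLp 2 (L2vec × L2))) =
      ⋂ (φ : E3 → ℂ) (hφ : IsTestFunction φ),
        {z | ∑ i, inner ℂ (star ((hφ.memLp_pderiv i).toLp _)) (z.fst i) =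
          -inner ℂ (star (hφ.memLp.toLp φ)) z.snd} := by
    ext z
    simp only [Set.mem_iInter]
    exact isWeakDiv_iff
  rw [h]
  refine isClosed_iInter fun φ => isClosed_iInter fun hφ => isClosed_eq ?_ ?_
  · exact continuous_finsetSum _ fun i _ => continuous_const.inner
      ((PiLp.continuous_apply 2 _ i).comp (WithLp.prod_continuous_ofLp 2 _ _).fst)
  · exact (continuous_const.inner (WithLp.prod_continuous_ofLp 2 _ _).snd).neg

instance : CompleteSpace H1 := isClosed_H1Sub.completeSpace_coe

instance : CompleteSpace Hdiv := isClosed_HdivSub.completeSpace_coe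

theorem Hdiv.norm_sq_eq (m : Hdiv) : ‖m‖ ^ 2 = ‖m.field‖ ^ 2 + ‖m.div‖ ^ 2 :=
  WithLp.prod_norm_sq_eq_of_L2 _

theorem Hdiv.norm_field_le (m : Hdiv) : ‖m.field‖ ≤ ‖m‖ := by
  have h1 := m.norm_sq_eq
  exact abs_le_of_sq_le_sq' (by nlinarith [norm_nonneg m.div]) (by positivity) |>.2

theorem Hdiv.norm_div_le (m : Hdiv) : ‖m.div‖ ≤ ‖m‖ := by
  have h1 := m.norm_sq_eq
  exact abs_le_of_sq_le_sq' (by nlinarith [norm_nonneg m.field]) (by positivity) |>.2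

/-! ### Integration by parts between `H¹(ℝ³)` and `𝐇(ℝ³, div)` -/

theorem continuous_H1_val : Continuous H1.val :=
  (WithLp.prod_continuous_ofLp 2 _ _).fst.comp continuous_subtype_val

theorem continuous_H1_grad (i : Fin 3) : Continuous fun v : H1 => v.grad i :=
  (PiLp.continuous_apply 2 _ i).comp
    ((WithLp.prod_continuous_ofLp 2 _ _).snd.comp continuous_subtype_val)

/-- Both sides are continuous in v, and for a test function the identity is the definition of the
weak divergence; density finishes. -/
theorem Hdiv.integration_by_parts (m : Hdiv) (v : H1) :
    ∑ i, inner ℂ (star (m.field i)) (v.grad i) = -inner ℂ (star m.div) v.val := by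
  have hc : IsClosed {v : H1 | ∑ i, inner ℂ (star (m.field i)) (v.grad i) =
      -inner ℂ (star m.div) v.val} :=
    isClosed_eq (continuous_finsetSum _ fun i _ => continuous_const.inner (continuous_H1_grad i))
      (continuous_const.inner continuous_H1_val).neg
  refine closure_minimal ?_ hc (mem_closure_testFunctions v)
  rintro w ⟨φ, hφ, rfl⟩
  have h := isWeakDiv_iff.1 m.2 φ hφ
  have hsw : ∀ f g : L2, inner ℂ (star f) g = inner ℂ (star g) f := fun f g => by
    rw [← integral_mul_eq_inner, ← integral_mul_eq_inner]
    simp only [mul_comm]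
  rw [Set.mem_ofPred_eq, hsw m.div]
  refine Eq.trans (Finset.sum_congr rfl fun i _ => hsw _ _) h

/-! ### The flux functional on a domain -/

/-- `∫_S ⟨m, ∇w⟩ + (div m) w` -/
def domPair {S : Set E3} (hS : MeasurableSet S) (m : Hdiv) (w : H1) : ℂ :=
  ∑ i, inner ℂ (star (m.field i)) (indOp hS (w.grad i)) + inner ℂ (star m.div) (indOp hS w.val)

theorem domPair_eq_integral {S : Set E3} (hS : MeasurableSet S) (m : Hdiv) (w : H1) :
    domPair hS m w =
      ∫ x in S, ((∑ i : Fin 3, m.field i x * w.grad i x) + m.div x * w.val x) := by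
  have hi : ∀ f g : L2, Integrable (fun x => f x * g x) (volume.restrict S) := fun f g =>
    (integrable_L2_mul f (Lp.memLp g)).restrict
  rw [integral_add (integrable_finsetSum _ fun i _ => hi _ _) (hi _ _),
    integral_finsetSum _ fun i _ => hi _ _]
  simp only [domPair, ← setIntegral_mul_eq_inner]

theorem domPair_add_right {S : Set E3} (hS : MeasurableSet S) (m : Hdiv) (v w : H1) :
    domPair hS m (v + w) = domPair hS m v + domPair hS m w := by
  have h1 : ∀ i, (v + w).grad i = v.grad i + w.grad i := fun _ => rfl
  have h2 : (v + w).val = v.val + w.val := rfl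
  simp only [domPair, h1, h2, map_add, inner_add_right, Finset.sum_add_distrib]
  ring

theorem domPair_smul_right {S : Set E3} (hS : MeasurableSet S) (m : Hdiv) (c : ℂ) (w : H1) :
    domPair hS m (c • w) = c * domPair hS m w := by
  have h1 : ∀ i, (c • w).grad i = c • w.grad i := fun _ => rfl
  have h2 : (c • w).val = c • w.val := rfl
  simp only [domPair, h1, h2, map_smul, inner_smul_right, ← Finset.mul_sum]
  ring

theorem domPair_sub_right {S : Set E3} (hS : MeasurableSet S) (m : Hdiv) (v w : H1) :
    domPair hS m (v - w) = domPair hS m v - domPair hS m w := by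
  rw [sub_eq_add_neg, ← neg_one_smul ℂ w, domPair_add_right, domPair_smul_right]
  ring

/-- The factor 4 counts the three components of the field and the divergence term. -/
theorem norm_domPair_le {S : Set E3} (hS : MeasurableSet S) (m : Hdiv) (w : H1) :
    ‖domPair hS m w‖ ≤ 4 * ‖m‖ * ‖w‖ := by
  have h1 : ∀ i, ‖inner ℂ (star (m.field i)) (indOp hS (w.grad i))‖ ≤ ‖m‖ * ‖w‖ := fun i => by
    refine (norm_inner_le_norm _ _).trans ?_
    rw [norm_star_L2]
    gcongr
    · exact (PiLp.norm_apply_le m.field i).trans m.norm_field_le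
    · exact (norm_indOp_le hS _).trans ((PiLp.norm_apply_le w.grad i).trans w.norm_grad_le)
  have h2 : ‖inner ℂ (star m.div) (indOp hS w.val)‖ ≤ ‖m‖ * ‖w‖ := by
    refine (norm_inner_le_norm _ _).trans ?_
    rw [norm_star_L2]
    gcongr
    · exact m.norm_div_le
    · exact (norm_indOp_le hS _).trans w.norm_val_le
  calc ‖domPair hS m w‖ ≤ ∑ i : Fin 3, ‖m‖ * ‖w‖ + ‖m‖ * ‖w‖ :=
        (norm_add_le _ _).trans (add_le_add ((norm_sum_le _ _).trans
          (Finset.sum_le_sum fun i _ => h1 i)) h2)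
    _ = 4 * ‖m‖ * ‖w‖ := by simp; ring

/-! ### The boundary bounds integrals of derivatives over the domain -/

section Divergence

/-- Otherwise t would be separated by the disjoint open sets interior s and (closure s)ᶜ. -/
theorem _root_.IsPreconnected.inter_frontier_nonempty {X : Type*} [TopologicalSpace X] {s t : Set X}
    (ht : IsPreconnected t) (h1 : (t ∩ s).Nonempty) (h2 : (t ∩ sᶜ).Nonempty) :
    (t ∩ frontier s).Nonempty := by
  by_contra h
  have h3 : ∀ x ∈ t, x ∉ frontier s := fun x hx hf => h ⟨x, hx, hf⟩
  obtain ⟨x, hx, hxs⟩ := h1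
  obtain ⟨y, hy, hys⟩ := h2
  have h4 : ∀ z ∈ t, z ∈ s → z ∈ interior s := fun z hz hzs => by
    by_contra h5
    exact h3 z hz ⟨subset_closure hzs, h5⟩
  have h5 : ∀ z ∈ t, z ∉ s → z ∈ (closure s)ᶜ := fun z hz hzs hc =>
    h3 z hz ⟨hc, fun hi => hzs (interior_subset hi)⟩
  obtain ⟨z, -, hzi, hzc⟩ := ht (interior s) (closure s)ᶜ isOpen_interior
    isClosed_closure.isOpen_compl (fun z hz => by
      by_cases hzs : z ∈ s
      · exact Or.inl (h4 z hz hzs)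
      · exact Or.inr (h5 z hz hzs)) ⟨x, hx, h4 x hx hxs⟩ ⟨y, hy, h5 y hy hys⟩
  exact hzc (interior_subset_closure hzi)

variable {μ : Measure E3} {S : Set E3} {r c C : ℝ}

/-- If the two ends of a segment of length τ are on different sides of Γ, the segment contains a
boundary point y, and the ball of radius τ about y lies in the ball of radius 2τ about x. This
dominates the indicator of the crossing set by an integral over Γ. -/
theorem IsSurfaceLike.one_le_of_crossing (h : IsSurfaceLike μ (frontier S) r c C) {τ : ℝ}
    (hτ : 0 < τ) (hτr : τ ≤ r) {e : E3} (he : ‖e‖ = 1) {x : E3}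
    (hx : ¬(x - τ • e ∈ S ↔ x ∈ S)) :
    1 ≤ (ENNReal.ofReal (c * τ ^ 2))⁻¹ * μ (Metric.ball x (2 * τ)) := by
  have hseg : IsPreconnected (segment ℝ x (x - τ • e)) :=
    (convex_segment x (x - τ • e)).isPreconnected
  have hne : (segment ℝ x (x - τ • e) ∩ frontier S).Nonempty := by
    by_cases h1 : x ∈ S
    · have h2 : x - τ • e ∉ S := fun h3 => hx ⟨fun _ => h1, fun _ => h3⟩
      exact hseg.inter_frontier_nonempty ⟨x, left_mem_segment _ _ _, h1⟩
        ⟨_, right_mem_segment _ _ _, h2⟩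
    · have h2 : x - τ • e ∈ S := by
        by_contra h3
        exact hx ⟨fun h4 => absurd h4 h3, fun h4 => absurd h4 h1⟩
      exact hseg.inter_frontier_nonempty ⟨_, right_mem_segment _ _ _, h2⟩
        ⟨x, left_mem_segment _ _ _, h1⟩
  obtain ⟨y, hyseg, hyf⟩ := hne
  have hd : dist y x ≤ τ := by
    have h1 : y ∈ Metric.closedBall x τ := (convex_closedBall x τ).segment_subset
      (Metric.mem_closedBall_self hτ.le)
      (by simp [norm_smul, he, abs_of_pos hτ]) hyseg
    exact h1
  have hsub : Metric.ball y τ ⊆ Metric.ball x (2 * τ) := Metric.ball_subset_ball' (by linarith)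
  have hlow := (h.lower y hyf τ hτ hτr).trans (measure_mono hsub)
  have hpos : 0 < c * τ ^ 2 := by have := h.c_pos; positivity
  calc (1 : ℝ≥0∞) = (ENNReal.ofReal (c * τ ^ 2))⁻¹ * ENNReal.ofReal (c * τ ^ 2) :=
        (ENNReal.inv_mul_cancel (by simpa using hpos) ENNReal.ofReal_ne_top).symm
    _ ≤ _ := by gcongr

/-- The indicator function of the ball of radius `ρ` about the origin. -/
def ballInd (ρ : ℝ) : E3 → ℝ≥0∞ := (Metric.ball (0 : E3) ρ).indicator fun _ => 1

theorem measurable_ballInd (ρ : ℝ) : Measurable (ballInd ρ) :=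
  measurable_const.indicator Metric.isOpen_ball.measurableSet

theorem ballInd_of_lt {ρ : ℝ} {x : E3} (h : ‖x‖ < ρ) : ballInd ρ x = 1 :=
  Set.indicator_of_mem (by simpa using h) _

theorem ballInd_of_le {ρ : ℝ} {x : E3} (h : ρ ≤ ‖x‖) : ballInd ρ x = 0 :=
  Set.indicator_of_notMem (by simpa using h) _

theorem lintegral_ballInd_sub_left (μ : Measure E3) (ρ : ℝ) (x : E3) :
    ∫⁻ y, ballInd ρ (x - y) ∂μ = μ (Metric.ball x ρ) := by
  rw [← lintegral_indicator_one Metric.isOpen_ball.measurableSet]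
  refine lintegral_congr fun y => ?_
  by_cases h : ‖x - y‖ < ρ
  · rw [ballInd_of_lt h, Set.indicator_of_mem, Pi.one_apply]
    rwa [Metric.mem_ball, dist_comm, dist_eq_norm]
  · rw [ballInd_of_le (not_lt.1 h), Set.indicator_of_notMem]
    rwa [Metric.mem_ball, dist_comm, dist_eq_norm]

theorem lintegral_ballInd_sub_right (ρ : ℝ) (y : E3) :
    ∫⁻ x, ballInd ρ (x - y) = volume (Metric.ball (0 : E3) ρ) := by
  rw [lintegral_sub_right_eq_self (ballInd ρ) y]
  exact lintegral_indicator_one Metric.isOpen_ball.measurableSet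

theorem IsTestFunction.exists_lipschitz {φ : E3 → ℂ} (hφ : IsTestFunction φ) :
    ∃ K : ℝ, 0 ≤ K ∧ ∀ x y, ‖φ x - φ y‖ ≤ K * ‖x - y‖ := by
  obtain ⟨K, hK⟩ := ContDiff.lipschitzWith_of_hasCompactSupport hφ.compact hφ.smooth
    (by simp)
  exact ⟨K, K.2, fun x y => by simpa [dist_eq_norm] using hK.dist_le_mul x y⟩

theorem indicator_one_eq_or (S : Set E3) (x : E3) :
    S.indicator (fun _ => (1 : ℂ)) x = 1 ∨ S.indicator (fun _ => (1 : ℂ)) x = 0 := by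
  by_cases hx : x ∈ S <;> simp [hx]

theorem setIntegral_translate_sub (hS : MeasurableSet S) {φ : E3 → ℂ} (hφi : Integrable φ volume)
    (t : E3) :
    ∫ x in S, (φ (x + t) - φ x) =
      ∫ x, (S.indicator (fun _ => (1 : ℂ)) (x - t) - S.indicator (fun _ => (1 : ℂ)) x) * φ x := by
  have hind := indicator_one_eq_or S
  rw [integral_sub (hφi.comp_add_right _).restrict hφi.restrict]
  have e1 : ∫ x in S, φ (x + t) =
      ∫ x, S.indicator (fun _ => (1 : ℂ)) (x - t) * φ x := by
    rw [← integral_indicator hS, ← integral_sub_right_eq_self _ (t)]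
    refine integral_congr_ae (Eventually.of_forall fun x => ?_)
    by_cases hx : x - t ∈ S <;> simp [hx]
  have e2 : ∫ x in S, φ x = ∫ x, S.indicator (fun _ => (1 : ℂ)) x * φ x := by
    rw [← integral_indicator hS]
    refine integral_congr_ae (Eventually.of_forall fun x => ?_)
    by_cases hx : x ∈ S <;> simp [hx]
  rw [e1, e2, ← integral_sub]
  · simp only [sub_mul]
  · have h2 : MemLp (fun x => S.indicator (fun _ => (1 : ℂ)) (x - t)) ⊤ volume := by
      refine memLp_top_of_bound ?_ 1 (Eventually.of_forall fun x => ?_)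
      · exact ((measurable_const.indicator hS).comp
          (measurable_id.sub_const _)).aestronglyMeasurable
      · rcases hind (x - t) with h | h <;> simp [h]
    exact hφi.bdd_mul h2.1 (c := 1) (Eventually.of_forall fun x => by
      rcases hind (x - t) with h | h <;> simp [h])
  · exact hφi.bdd_mul (isMultiplier_indicator hS).aesm (isMultiplier_indicator hS).bound

/-- Difference quotients over a set are controlled by the boundary. -/
theorem IsSurfaceLike.enorm_integral_translate_sub_le [SFinite μ]
    (h : IsSurfaceLike μ (frontier S) r c C) (hS : MeasurableSet S) {φ : E3 → ℂ}
    (hφ : IsTestFunction φ) {K : ℝ} (hK : ∀ x y, ‖φ x - φ y‖ ≤ K * ‖x - y‖) (hK0 : 0 ≤ K)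
    {τ : ℝ} (hτ : 0 < τ) (hτr : τ ≤ r) {e : E3} (he : ‖e‖ = 1) :
    ‖∫ x in S, (φ (x + τ • e) - φ x)‖ₑ ≤ (ENNReal.ofReal (c * τ ^ 2))⁻¹ *
      (volume (Metric.ball (0 : E3) (2 * τ)) *
        ((∫⁻ y, ‖φ y‖ₑ ∂μ) + ENNReal.ofReal (K * (2 * τ)) *
          μ (Metric.cthickening 2 (tsupport φ)))) := by
  have hφi : Integrable φ volume := hφ.smooth.continuous.integrable_of_hasCompactSupport hφ.compact
  have hφm : Measurable φ := hφ.smooth.continuous.measurable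
  have h1 := setIntegral_translate_sub hS hφi (τ • e)
  rw [h1]
  set a := (ENNReal.ofReal (c * τ ^ 2))⁻¹ with ha
  have hat : a ≠ ⊤ := by
    have := h.c_pos
    rw [ha, ENNReal.inv_ne_top]
    simp only [ne_eq, ENNReal.ofReal_eq_zero, not_le]
    positivity
  have hball : Measurable fun z : E3 × E3 => ballInd (2 * τ) (z.1 - z.2) :=
    (measurable_ballInd _).comp (measurable_fst.sub measurable_snd)
  have hKm : Measurable fun y => (Metric.cthickening 2 (tsupport φ)).indicator
      (fun _ => ENNReal.ofReal (K * (2 * τ))) y :=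
    measurable_const.indicator Metric.isClosed_cthickening.measurableSet
  have hτ1 : τ ≤ 1 := hτr.trans h.r_le
  -- After the translation has been moved from φ to S, the integrand vanishes unless x and x - τe
  -- are separated by Γ.
  calc _ ≤ ∫⁻ x, a * μ (Metric.ball x (2 * τ)) * ‖φ x‖ₑ := by
        refine (enorm_integral_le_lintegral_enorm _).trans (lintegral_mono fun x => ?_)
        rw [enorm_mul]
        gcongr
        by_cases hx : x - τ • e ∈ S ↔ x ∈ S
        · have : S.indicator (fun _ => (1 : ℂ)) (x - τ • e) = S.indicator (fun _ => (1 : ℂ)) x := by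
            by_cases hx2 : x ∈ S
            · simp [hx2, hx.2 hx2]
            · simp [hx2, mt hx.1 hx2]
          simp [this]
        · refine le_trans ?_ (h.one_le_of_crossing hτ hτr he hx)
          rcases indicator_one_eq_or S (x - τ • e) with h2 | h2 <;>
            rcases indicator_one_eq_or S x with h3 | h3 <;> simp [h2, h3]
    _ = ∫⁻ x, ∫⁻ y, a * ballInd (2 * τ) (x - y) *
          ‖φ x‖ₑ ∂μ := by
        refine lintegral_congr fun x => ?_
        have h2 : Measurable fun y : E3 => ballInd (2 * τ) (x - y) :=
          (measurable_ballInd _).comp (measurable_const.sub measurable_id)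
        rw [lintegral_mul_const _ (h2.const_mul a), lintegral_const_mul _ h2,
          lintegral_ballInd_sub_left]
    _ = ∫⁻ y, (∫⁻ x, a * ballInd (2 * τ) (x - y) * ‖φ x‖ₑ) ∂μ := by
        rw [lintegral_lintegral_swap]
        exact ((hball.const_mul a).mul (hφm.comp measurable_fst).enorm).aemeasurable
    -- On the support of the kernel x and y are closer than 2τ ≤ 2, so φ(x) may be replaced by φ(y)
    -- with a Lipschitz error supported in the 2-thickening of the support of φ, a compact set of
    -- finite measure.
    _ ≤ ∫⁻ y, (∫⁻ x, a * ballInd (2 * τ) (x - y) *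
          (‖φ y‖ₑ + (Metric.cthickening 2 (tsupport φ)).indicator
            (fun _ => ENNReal.ofReal (K * (2 * τ))) y)) ∂μ := by
        refine lintegral_mono fun y => lintegral_mono fun x => ?_
        by_cases hxy : ‖x - y‖ < 2 * τ
        · gcongr
          by_cases hy : y ∈ Metric.cthickening 2 (tsupport φ)
          · rw [Set.indicator_of_mem hy, ← ofReal_norm, ← ofReal_norm,
              ← ENNReal.ofReal_add (norm_nonneg _) (by positivity)]
            refine ENNReal.ofReal_le_ofReal ?_
            have h2 := hK x y
            have h3 := norm_le_insert' (φ x) (φ y)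
            have h4 : K * ‖x - y‖ ≤ K * (2 * τ) := by gcongr
            linarith
          · have : φ x = 0 := by
              refine image_eq_zero_of_notMem_tsupport fun hx => hy ?_
              refine Metric.mem_cthickening_of_dist_le y x 2 _ hx ?_
              rw [dist_comm, dist_eq_norm]
              linarith
            simp [this]
        · simp [ballInd_of_le (not_lt.1 hxy)]
    _ = ∫⁻ y, a * volume (Metric.ball (0 : E3) (2 * τ)) * (‖φ y‖ₑ +
          (Metric.cthickening 2 (tsupport φ)).indicator
            (fun _ => ENNReal.ofReal (K * (2 * τ))) y) ∂μ := by
        refine lintegral_congr fun y => ?_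
        have h2 : Measurable fun x : E3 => ballInd (2 * τ) (x - y) :=
          (measurable_ballInd _).comp (measurable_id.sub measurable_const)
        rw [lintegral_mul_const _ (h2.const_mul a), lintegral_const_mul _ h2,
          lintegral_ballInd_sub_right]
    _ = _ := by
        have h2 : Measurable fun y => ‖φ y‖ₑ + (Metric.cthickening 2 (tsupport φ)).indicator
            (fun _ => ENNReal.ofReal (K * (2 * τ))) y := hφm.enorm.add hKm
        rw [lintegral_const_mul _ h2, lintegral_add_left hφm.enorm,
          lintegral_indicator_const Metric.isClosed_cthickening.measurableSet, mul_assoc]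

/-- The difference quotients of a test function converge under the integral. -/
theorem tendsto_integral_difference_quotient (S : Set E3) {φ : E3 → ℂ}
    (hφ : IsTestFunction φ) (i : Fin 3) :
    Tendsto (fun n : ℕ => ∫ x in S, ((n : ℝ) + 1) •
        (φ (x + ((n : ℝ) + 1)⁻¹ • EuclideanSpace.single i 1) - φ x)) atTop
      (𝓝 (∫ x in S, pderiv i φ x)) := by
  obtain ⟨K, hK0, hK⟩ := hφ.exists_lipschitz
  have hcomp : IsCompact (Metric.cthickening 1 (tsupport φ)) := hφ.compact.isCompact.cthickening
  refine tendsto_integral_of_dominated_convergence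
    ((Metric.cthickening 1 (tsupport φ)).indicator fun _ => K) (fun n => ?_) ?_ (fun n => ?_) ?_
  · refine Continuous.aestronglyMeasurable ?_
    have := hφ.smooth.continuous
    fun_prop
  · refine Integrable.restrict ?_
    rw [integrable_indicator_iff hcomp.measurableSet]
    exact integrableOn_const hcomp.measure_lt_top.ne
  · refine Eventually.of_forall fun x => ?_
    have hn : (0 : ℝ) < n + 1 := by positivity
    have he : ‖((n : ℝ) + 1)⁻¹ • (EuclideanSpace.single i 1 : E3)‖ = ((n : ℝ) + 1)⁻¹ := by
      rw [norm_smul, norm_inv, Real.norm_of_nonneg hn.le]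
      simp
    by_cases hx : x ∈ Metric.cthickening 1 (tsupport φ)
    · rw [Set.indicator_of_mem hx, norm_smul, Real.norm_of_nonneg hn.le]
      have h1 := hK (x + ((n : ℝ) + 1)⁻¹ • EuclideanSpace.single i 1) x
      rw [add_sub_cancel_left, he] at h1
      calc _ ≤ ((n : ℝ) + 1) * (K * ((n : ℝ) + 1)⁻¹) := by gcongr
        _ = K := by field_simp
    · have h1 : φ x = 0 := image_eq_zero_of_notMem_tsupport fun h =>
        hx (Metric.self_subset_cthickening _ h)
      have h2 : φ (x + ((n : ℝ) + 1)⁻¹ • EuclideanSpace.single i 1) = 0 := by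
        refine image_eq_zero_of_notMem_tsupport fun h => hx ?_
        refine Metric.mem_cthickening_of_dist_le x _ 1 _ h ?_
        rw [dist_comm, dist_eq_norm, add_sub_cancel_left, he]
        exact inv_le_one_of_one_le₀ (by simp)
      simp [h1, h2, Set.indicator_of_notMem hx]
  · refine Eventually.of_forall fun x => ?_
    refine (hφ.differentiableAt x).hasFDerivAt.lim _ (c := fun n : ℕ => (n : ℝ) + 1) ?_
    refine (tendsto_natCast_atTop_atTop (R := ℝ)).atTop_add (tendsto_const_nhds (x := (1 : ℝ)))
      |>.congr fun n => ?_
    rw [Real.norm_of_nonneg (by positivity)]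

/-- This stands in for the Gauss theorem: no normal field is needed, only that the derivative of φ
over S is controlled by the values of φ on Γ. It is the limit of the bound for difference quotients,
in which the Lipschitz error is of order τ. -/
theorem IsSurfaceLike.exists_enorm_integral_pderiv_le [SFinite μ] [IsLocallyFiniteMeasure μ]
    (h : IsSurfaceLike μ (frontier S) r c C) (hS : MeasurableSet S) :
    ∃ L : ℝ≥0∞, L ≠ ⊤ ∧ ∀ (φ : E3 → ℂ), IsTestFunction φ → ∀ i : Fin 3,
      ‖∫ x in S, pderiv i φ x‖ₑ ≤ L * ∫⁻ y, ‖φ y‖ₑ ∂μ := by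
  have hc := h.c_pos
  let V : ℝ≥0∞ := volume (Metric.ball (0 : E3) 1)
  have hVt : V ≠ ⊤ := measure_ball_lt_top.ne
  -- With step τ, the factors are 1/τ from the quotient, 1/(c τ²) from the crossing bound and 8 τ³ V
  -- from the volume of the ball of radius 2τ.
  refine ⟨ENNReal.ofReal (8 / c) * V, ENNReal.mul_ne_top ENNReal.ofReal_ne_top hVt, ?_⟩
  intro φ hφ i
  obtain ⟨K, hK0, hK⟩ := hφ.exists_lipschitz
  have hm : μ (Metric.cthickening 2 (tsupport φ)) ≠ ⊤ :=
    hφ.compact.isCompact.cthickening.measure_lt_top.ne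
  have hinv : Tendsto (fun n : ℕ => ((n : ℝ) + 1)⁻¹) atTop (𝓝 0) := by
    simpa using tendsto_one_div_add_atTop_nhds_zero_nat (𝕜 := ℝ)
  have hlim : Tendsto (fun n : ℕ => ENNReal.ofReal (8 / c) * V * ((∫⁻ y, ‖φ y‖ₑ ∂μ) +
      ENNReal.ofReal (K * (2 * ((n : ℝ) + 1)⁻¹)) * μ (Metric.cthickening 2 (tsupport φ)))) atTop
      (𝓝 (ENNReal.ofReal (8 / c) * V * ∫⁻ y, ‖φ y‖ₑ ∂μ)) := by
    have h1 : Tendsto (fun n : ℕ => ENNReal.ofReal (K * (2 * ((n : ℝ) + 1)⁻¹)) *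
        μ (Metric.cthickening 2 (tsupport φ))) atTop (𝓝 0) := by
      have h2 := ENNReal.tendsto_ofReal ((hinv.const_mul 2).const_mul K)
      have h3 := ENNReal.Tendsto.mul_const h2 (Or.inr hm)
      simpa using h3
    have h4 := (tendsto_const_nhds (x := ∫⁻ y, ‖φ y‖ₑ ∂μ)).add h1
    rw [add_zero] at h4
    exact ENNReal.Tendsto.const_mul h4
      (Or.inr (ENNReal.mul_ne_top ENNReal.ofReal_ne_top hVt))
  refine le_of_tendsto_of_tendsto (tendsto_integral_difference_quotient S hφ i).enorm hlim ?_
  filter_upwards [hinv.eventually (gt_mem_nhds h.r_pos)] with n hn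
  have hn0 : (0 : ℝ) < (n : ℝ) + 1 := by positivity
  have h1 := h.enorm_integral_translate_sub_le hS hφ hK hK0 (inv_pos.2 hn0) hn.le
    (e := EuclideanSpace.single i 1) (by simp)
  rw [integral_smul, enorm_smul]
  refine (mul_le_mul_right h1 _).trans (le_of_eq ?_)
  rw [Measure.addHaar_ball _ _ (by positivity), ← mul_assoc, ← mul_assoc, ← mul_assoc]
  congr 2
  rw [← ENNReal.ofReal_inv_of_pos (by positivity), ← ofReal_norm, Real.norm_of_nonneg hn0.le,
    ← ENNReal.ofReal_mul (by positivity), ← ENNReal.ofReal_mul (by positivity)]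
  congr 1
  simp only [finrank_euclideanSpace, Fintype.card_fin]
  field_simp
  norm_num

end Divergence

/-! ### The Dirichlet trace as a closed linear relation -/

theorem H1.ext {v w : H1} (h : v.val = w.val) (hg : ∀ i, v.grad i = w.grad i) : v = w := by
  have h2 : v.grad = w.grad := PiLp.ext hg
  apply Subtype.ext
  apply (WithLp.equiv 2 _).injective
  exact Prod.ext h h2

theorem IsTestFunction.add {φ χ : E3 → ℂ} (hφ : IsTestFunction φ) (hχ : IsTestFunction χ) :
    IsTestFunction (fun x => φ x + χ x) := ⟨hφ.smooth.add hχ.smooth, hφ.compact.add hχ.compact⟩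

theorem IsTestFunction.const_mul {φ : E3 → ℂ} (hφ : IsTestFunction φ) (c : ℂ) :
    IsTestFunction (fun x => c * φ x) := ⟨contDiff_const.mul hφ.smooth, hφ.compact.mul_left⟩

theorem isTestFunction_zero : IsTestFunction (fun _ => 0) :=
  ⟨contDiff_const, HasCompactSupport.zero⟩

theorem IsTestFunction.toH1_add {φ χ : E3 → ℂ} (hφ : IsTestFunction φ) (hχ : IsTestFunction χ) :
    (hφ.add hχ).toH1 = hφ.toH1 + hχ.toH1 := by
  refine H1.ext (MemLp.toLp_add hφ.memLp hχ.memLp) fun i => ?_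
  refine Eq.trans (MemLp.toLp_congr ((hφ.add hχ).memLp_pderiv i) ((hφ.memLp_pderiv i).add (hχ.memLp_pderiv i))
    (Eventually.of_forall fun x => ?_)) (MemLp.toLp_add (hφ.memLp_pderiv i) (hχ.memLp_pderiv i))
  simp only [pderiv, Pi.add_apply]
  rw [fderiv_fun_add (hφ.differentiableAt x) (hχ.differentiableAt x)]
  rfl

theorem IsTestFunction.toH1_const_mul {φ : E3 → ℂ} (hφ : IsTestFunction φ) (c : ℂ) :
    (hφ.const_mul c).toH1 = c • hφ.toH1 := by
  refine H1.ext (MemLp.toLp_const_smul c hφ.memLp) fun i => ?_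
  refine Eq.trans (MemLp.toLp_congr ((hφ.const_mul c).memLp_pderiv i) ((hφ.memLp_pderiv i).const_smul c)
    (Eventually.of_forall fun x => ?_)) (MemLp.toLp_const_smul c (hφ.memLp_pderiv i))
  simp only [pderiv, Pi.smul_apply]
  rw [fderiv_const_mul (hφ.differentiableAt x)]
  rfl

theorem IsTestFunction.memLp_surf {φ : E3 → ℂ} (hφ : IsTestFunction φ) (Ω : LipschitzDomain) :
    MemLp φ 2 Ω.surf :=
  haveI := Ω.isLocallyFinite_surf
  hφ.smooth.continuous.memLp_of_hasCompactSupport hφ.compact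

/-- Test functions together with their restrictions to the boundary. -/
def traceGraph (Ω : LipschitzDomain) : Submodule ℂ (WithLp 2 (H1 × Lp ℂ 2 Ω.surf)) where
  carrier := {z | ∃ (φ : E3 → ℂ) (hφ : IsTestFunction φ),
    z = WithLp.toLp 2 (hφ.toH1, (hφ.memLp_surf Ω).toLp φ)}
  add_mem' := by
    rintro _ _ ⟨φ, hφ, rfl⟩ ⟨χ, hχ, rfl⟩
    refine ⟨_, hφ.add hχ, ?_⟩
    rw [hφ.toH1_add hχ]
    rfl
  zero_mem' := by
    refine ⟨_, isTestFunction_zero.const_mul 0, ?_⟩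
    rw [isTestFunction_zero.toH1_const_mul, zero_smul]
    have : MemLp.toLp (fun x : E3 => (0 : ℂ) * 0) ((isTestFunction_zero.const_mul 0).memLp_surf Ω)
        = 0 := by
      rw [Lp.eq_zero_iff_ae_eq_zero]
      filter_upwards [((isTestFunction_zero.const_mul 0).memLp_surf Ω).coeFn_toLp] with x hx
      rw [hx, mul_zero, Pi.zero_apply]
    rw [this]
    rfl
  smul_mem' := by
    rintro c _ ⟨φ, hφ, rfl⟩
    refine ⟨_, hφ.const_mul c, ?_⟩
    rw [hφ.toH1_const_mul c]
    rfl

theorem tendsto_withLp_prod_iff {E F : Type*} [NormedAddCommGroup E] [NormedAddCommGroup F]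
    {x : ℕ → E} {y : ℕ → F} {a : E} {b : F} :
    Tendsto (fun n => (WithLp.toLp 2 (x n, y n) : WithLp 2 (E × F))) atTop
      (𝓝 (WithLp.toLp 2 (a, b))) ↔ Tendsto x atTop (𝓝 a) ∧ Tendsto y atTop (𝓝 b) := by
  constructor
  · intro h
    exact ⟨((WithLp.prod_continuous_ofLp 2 E F).fst.tendsto _).comp h,
      ((WithLp.prod_continuous_ofLp 2 E F).snd.tendsto _).comp h⟩
  · rintro ⟨h1, h2⟩
    exact ((WithLp.prod_continuous_toLp 2 E F).tendsto _).comp (h1.prodMk_nhds h2)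

/-- Membership in the closure of a subspace turns the trace into a closed linear relation. Its
linearity and its weak closedness are then automatic, and neither continuity nor single-valuedness
of the trace map has to be known. -/
theorem hasTrace_iff {Ω : LipschitzDomain} {w : H1} {ψ : Lp ℂ 2 Ω.surf} : HasTrace Ω w ψ ↔
    WithLp.toLp 2 (w, ψ) ∈ (traceGraph Ω).topologicalClosure := by
  rw [← SetLike.mem_coe, Submodule.topologicalClosure_coe, mem_closure_iff_seq_limit]
  constructor
  · rintro ⟨φ, hφ, h1, h2, h3⟩
    refine ⟨fun n => WithLp.toLp 2 ((hφ n).toH1, ((hφ n).memLp_surf Ω).toLp (φ n)),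
      fun n => ⟨φ n, hφ n, rfl⟩, tendsto_withLp_prod_iff.2 ⟨?_, (tendsto_toLp_iff _ _).2 h3⟩⟩
    exact tendsto_H1_iff.2 ⟨(tendsto_toLp_iff (fun n => (hφ n).memLp) _).2 h1,
      fun i => (tendsto_toLp_iff (fun n => (hφ n).memLp_pderiv i) _).2 (h2 i)⟩
  · rintro ⟨z, hz, hlim⟩
    choose φ hφ hzφ using hz
    have hz' : z = fun n => WithLp.toLp 2 ((hφ n).toH1, ((hφ n).memLp_surf Ω).toLp (φ n)) :=
      funext hzφ
    rw [hz'] at hlim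
    obtain ⟨h1, h2⟩ := tendsto_withLp_prod_iff.1 hlim
    obtain ⟨h3, h4⟩ := tendsto_H1_iff.1 h1
    exact ⟨φ, hφ, (tendsto_toLp_iff (fun n => (hφ n).memLp) _).1 h3,
      fun i => (tendsto_toLp_iff (fun n => (hφ n).memLp_pderiv i) _).1 (h4 i),
      (tendsto_toLp_iff _ _).1 h2⟩

theorem HasTrace.add {Ω : LipschitzDomain} {v w : H1} {ψ χ : Lp ℂ 2 Ω.surf} (h : HasTrace Ω v ψ)
    (h' : HasTrace Ω w χ) : HasTrace Ω (v + w) (ψ + χ) :=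
  hasTrace_iff.2 (Submodule.add_mem _ (hasTrace_iff.1 h) (hasTrace_iff.1 h'))

theorem HasTrace.smul {Ω : LipschitzDomain} {v : H1} {ψ : Lp ℂ 2 Ω.surf} (c : ℂ)
    (h : HasTrace Ω v ψ) : HasTrace Ω (c • v) (c • ψ) :=
  hasTrace_iff.2 (Submodule.smul_mem _ c (hasTrace_iff.1 h))

theorem HasTrace.sub {Ω : LipschitzDomain} {v w : H1} {ψ χ : Lp ℂ 2 Ω.surf} (h : HasTrace Ω v ψ)
    (h' : HasTrace Ω w χ) : HasTrace Ω (v - w) (ψ - χ) :=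
  hasTrace_iff.2 (Submodule.sub_mem _ (hasTrace_iff.1 h) (hasTrace_iff.1 h'))

/-! ### Functions with vanishing trace -/

theorem lintegral_enorm_mul_le {μ : Measure E3} {f g : E3 → ℂ} (hf : AEStronglyMeasurable f μ)
    (hg : AEStronglyMeasurable g μ) :
    ∫⁻ x, ‖f x * g x‖ₑ ∂μ ≤ eLpNorm f 2 μ * eLpNorm g 2 μ := by
  have h := ENNReal.lintegral_mul_le_Lp_mul_Lq μ Real.HolderConjugate.two_two hf.enorm hg.enorm
  rw [eLpNorm_eq_lintegral_rpow_enorm_toReal (by norm_num) (by norm_num),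
    eLpNorm_eq_lintegral_rpow_enorm_toReal (by norm_num) (by norm_num)]
  simpa [enorm_mul] using h

/-- For approximating test functions φₙ the sum of the two pairings is ∫_Ω ∂ᵢ(ξ φₙ). It is bounded
by a multiple of ∫ |ξ φₙ| dμ, which tends to zero because φₙ → 0 in L²(Γ). -/
theorem HasTrace.inner_indOp_eq {Ω : LipschitzDomain} {w : H1} (h : HasTrace Ω w 0)
    {ξ : E3 → ℂ} (hξ : IsTestFunction ξ) (i : Fin 3) :
    inner ℂ (star ((hξ.memLp_pderiv i).toLp _)) (indOp Ω.isOpen.measurableSet w.val) =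
      -inner ℂ (star (hξ.memLp.toLp ξ)) (indOp Ω.isOpen.measurableSet (w.grad i)) := by
  have hS := Ω.isOpen.measurableSet
  obtain ⟨φ, hφ, h1, h2, h3⟩ := h
  have hw : Tendsto (fun n => (hφ n).toH1) atTop (𝓝 w) :=
    tendsto_H1_iff.2 ⟨(tendsto_toLp_iff (fun n => (hφ n).memLp) _).2 h1,
      fun i => (tendsto_toLp_iff (fun n => (hφ n).memLp_pderiv i) _).2 (h2 i)⟩
  obtain ⟨hv, hg⟩ := tendsto_H1_iff.1 hw
  let T : ℕ → ℂ := fun n =>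
    inner ℂ (star ((hξ.memLp_pderiv i).toLp _)) (indOp hS (hφ n).toH1.val) +
      inner ℂ (star (hξ.memLp.toLp ξ)) (indOp hS ((hφ n).toH1.grad i))
  have hT : Tendsto T atTop (𝓝 (inner ℂ (star ((hξ.memLp_pderiv i).toLp _)) (indOp hS w.val) +
      inner ℂ (star (hξ.memLp.toLp ξ)) (indOp hS (w.grad i)))) :=
    (tendsto_const_nhds.inner (((indOp hS).continuous.tendsto _).comp hv)).add
      (tendsto_const_nhds.inner (((indOp hS).continuous.tendsto _).comp (hg i)))
  have hTi : ∀ n, T n = ∫ x in Ω.carrier, pderiv i (fun y => ξ y * φ n y) x := by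
    intro n
    have e1 : ∀ {f g : E3 → ℂ} (hf : MemLp f 2 volume) (hg : MemLp g 2 volume),
        inner ℂ (star (hf.toLp f)) (indOp hS (hg.toLp g)) = ∫ x in Ω.carrier, f x * g x := by
      intro f g hf hg
      rw [← setIntegral_mul_eq_inner]
      refine integral_congr_ae (ae_restrict_of_ae ?_)
      filter_upwards [hf.coeFn_toLp, hg.coeFn_toLp] with x hx hx2
      rw [hx, hx2]
    have e2 : ∀ x, pderiv i (fun y => ξ y * φ n y) x =
        pderiv i ξ x * φ n x + ξ x * pderiv i (φ n) x := fun x => by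
      rw [pderiv_mul (hξ.differentiableAt x) ((hφ n).differentiableAt x), add_comm]
    simp only [e2]
    rw [integral_add]
    · exact congrArg₂ (· + ·) (e1 _ (hφ n).memLp) (e1 _ ((hφ n).memLp_pderiv i))
    · exact ((hξ.memLp_pderiv i).integrable_mul (hφ n).memLp).restrict
    · exact (hξ.memLp.integrable_mul ((hφ n).memLp_pderiv i)).restrict
  have hT0 : Tendsto T atTop (𝓝 0) := by
    have := Ω.isLocallyFinite_surf
    obtain ⟨r, c, C, hreg⟩ := Ω.exists_isSurfaceLike
    obtain ⟨L, hL, hbound⟩ := hreg.exists_enorm_integral_pderiv_le hS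
    have h4 : Tendsto (fun n => L * (eLpNorm ξ 2 Ω.surf * eLpNorm (φ n) 2 Ω.surf)) atTop
        (𝓝 0) := by
      have h5 : Tendsto (fun n => eLpNorm (φ n) 2 Ω.surf) atTop (𝓝 0) := by
        refine h3.congr fun n => eLpNorm_congr_ae ?_
        filter_upwards [Lp.coeFn_zero ℂ 2 Ω.surf] with x hx
        rw [hx, Pi.zero_apply, sub_zero]
      have h6 := ENNReal.Tendsto.const_mul
        (ENNReal.Tendsto.const_mul h5 (Or.inr (hξ.memLp_surf Ω).2.ne)) (Or.inr hL)
      simpa using h6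
    rw [tendsto_zero_iff_enorm_tendsto_zero]
    refine tendsto_of_tendsto_of_tendsto_of_le_of_le tendsto_const_nhds h4 (fun _ => zero_le)
      fun n => ?_
    simp only [hTi]
    refine (hbound _ (hξ.mul_contDiff (hφ n).smooth) i).trans ?_
    gcongr
    exact lintegral_enorm_mul_le hξ.smooth.continuous.aestronglyMeasurable
      (hφ n).smooth.continuous.aestronglyMeasurable
  exact eq_neg_of_add_eq_zero_left (tendsto_nhds_unique hT hT0)

/-- The restriction to the domain, extended by zero, of a function with vanishing trace. -/
theorem HasTrace.isWeakGrad_indOp {Ω : LipschitzDomain} {w : H1} (h : HasTrace Ω w 0) :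
    IsWeakGrad (indOp Ω.isOpen.measurableSet w.val)
      (WithLp.toLp 2 fun i => indOp Ω.isOpen.measurableSet (w.grad i)) := by
  intro ξ hξ i
  rw [integral_mul_toLp_eq_inner _ (hξ.memLp_pderiv i), integral_mul_toLp_eq_inner _ hξ.memLp]
  exact h.inner_indOp_eq hξ i

/-- The zero extension of w from Ω belongs to H¹(ℝ³), so the pairing over Ω is a pairing over ℝ³,
where integration by parts leaves no boundary term. -/
theorem HasTrace.domPair_eq_zero {Ω : LipschitzDomain} {w : H1} (h : HasTrace Ω w 0) (m : Hdiv) :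
    domPair Ω.isOpen.measurableSet m w = 0 := by
  have h1 := m.integration_by_parts ⟨WithLp.toLp 2 (_, _), h.isWeakGrad_indOp⟩
  exact (congrArg (· + _) h1).trans (neg_add_cancel _)

theorem HasTrace.domPair_eq {Ω : LipschitzDomain} {v w : H1} {ψ : Lp ℂ 2 Ω.surf}
    (hv : HasTrace Ω v ψ) (hw : HasTrace Ω w ψ) (m : Hdiv) :
    domPair Ω.isOpen.measurableSet m v = domPair Ω.isOpen.measurableSet m w := by
  have h := hv.sub hw
  rw [sub_self] at h
  have h2 := h.domPair_eq_zero m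
  rwa [domPair_sub_right, sub_eq_zero] at h2

/-! ### Weak compactness -/

/-- A bounded linear map between Hilbert spaces attains limits of images of bounded sequences. -/
theorem exists_eq_of_bounded_of_tendsto {G F : Type*} [NormedAddCommGroup G]
    [InnerProductSpace ℂ G] [CompleteSpace G] [NormedAddCommGroup F] [InnerProductSpace ℂ F]
    [CompleteSpace F] (P : G →L[ℂ] F) {x : ℕ → G} {R : ℝ} (hx : ∀ n, ‖x n‖ ≤ R) {y : F}
    (hy : Tendsto (fun n => P (x n)) atTop (𝓝 y)) : ∃ w, ‖w‖ ≤ R ∧ P w = y := by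
  let f : ℕ → WeakDual ℂ G := fun n => StrongDual.toWeakDual (InnerProductSpace.toDual ℂ G (x n))
  have hcomp := WeakDual.isCompact_closedBall (𝕜 := ℂ) (E := G) 0 R
  have hf : ∀ n, f n ∈ WeakDual.toStrongDual ⁻¹' Metric.closedBall (0 : StrongDual ℂ G) R := by
    intro n
    simp only [Set.mem_preimage, Metric.mem_closedBall, dist_zero_right]
    refine le_of_eq_of_le ?_ (hx n)
    exact (InnerProductSpace.toDual ℂ G).norm_map (x n)
  -- Banach-Alaoglu, transported by the Riesz isometry: the sequence has a weak cluster point in the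
  -- ball of radius R.
  obtain ⟨ℓ, hℓ, hcl⟩ := hcomp.exists_mapClusterPt (f := atTop) (u := f)
    (le_principal_iff.2 (mem_map.2 (Eventually.of_forall hf)))
  let w : G := (InnerProductSpace.toDual ℂ G).symm (WeakDual.toStrongDual ℓ)
  refine ⟨w, ?_, ?_⟩
  · rw [LinearIsometryEquiv.norm_map]
    simpa using hℓ
  · refine ext_inner_right ℂ fun χ => ?_
    -- Tested on P* χ, the sequence of values converges to ⟨y, χ⟩, and a cluster value of a
    -- convergent sequence is its limit.
    have h1 : MapClusterPt (ℓ (P.adjoint χ)) atTop fun n => f n (P.adjoint χ) :=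
      hcl.continuousAt_comp (WeakDual.eval_continuous (P.adjoint χ)).continuousAt
    have h2 : Tendsto (fun n => f n (P.adjoint χ)) atTop (𝓝 (inner ℂ y χ)) := by
      have h3 : ∀ n, f n (P.adjoint χ) = inner ℂ (P (x n)) χ := fun n =>
        (InnerProductSpace.toDual_apply_apply).trans (ContinuousLinearMap.adjoint_inner_right P _ _)
      simp only [h3]
      exact hy.inner tendsto_const_nhds
    have h4 : ℓ (P.adjoint χ) = inner ℂ y χ := by
      by_contra hne
      exact (disjoint_nhds_nhds.2 hne).mono_right h2 |>.eq_bot |> h1.neBot.ne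
    rw [← h4, ← ContinuousLinearMap.adjoint_inner_right]
    exact InnerProductSpace.toDual_symm_apply

/-! ### Radial integrals -/

/-- The exponent 2 is below the dimension 3. -/
theorem lintegral_inv_sq_lt_top (r : ℝ) :
    ∫⁻ z : E3, ENNReal.ofReal ((‖z‖ ^ 2)⁻¹) * ballInd r z < ⊤ := by
  have h1 : IntegrableOn (fun z : E3 => (‖z‖ ^ 2)⁻¹) (Metric.ball 0 r) volume := by
    refine integrableOn_ball_of_norm_le_rpow (C := 1) (α := 2) (by simp) (by simp; norm_num)
      (Eventually.of_forall fun x => ?_) (by fun_prop)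
    rw [one_mul, Real.norm_of_nonneg (by positivity), Real.rpow_neg (norm_nonneg x)]
    norm_num
  have h2 := h1.lintegral_lt_top
  refine lt_of_eq_of_lt ?_ h2
  rw [← lintegral_indicator Metric.isOpen_ball.measurableSet]
  refine lintegral_congr fun z => ?_
  by_cases hz : ‖z‖ < r
  · rw [ballInd_of_lt hz, Set.indicator_of_mem (by simpa using hz), mul_one]
  · rw [ballInd_of_le (not_lt.1 hz), Set.indicator_of_notMem (by simpa using hz), mul_zero]

theorem lintegral_one_add_norm_lt_top :
    ∫⁻ z : E3, ENNReal.ofReal (((‖z‖ + 1) ^ 6)⁻¹) < ⊤ := by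
  have h := finite_integral_one_add_norm (E := E3) (μ := volume) (r := 6)
    (by simp; norm_num)
  refine lt_of_eq_of_lt (lintegral_congr fun z => ?_) h
  rw [Real.rpow_neg (by positivity), add_comm]
  norm_num

/-- The substitution z ↦ a z yields a⁻⁶ from the integrand and a³ from the volume. With a = ‖y - z‖
this is the source of the weight ‖y - z‖⁻³. -/
theorem lintegral_norm_add_inv_pow {a : ℝ} (ha : 0 < a) :
    ∫⁻ z : E3, ENNReal.ofReal (((‖z‖ + a) ^ 6)⁻¹) =
      ENNReal.ofReal ((a ^ 3)⁻¹) * ∫⁻ z : E3, ENNReal.ofReal (((‖z‖ + 1) ^ 6)⁻¹) := by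
  have hm : Measurable fun z : E3 => ENNReal.ofReal (((‖z‖ + a) ^ 6)⁻¹) := by fun_prop
  have h1 := Measure.map_addHaar_smul (volume : Measure E3) ha.ne'
  have h2 : ∫⁻ z : E3, ENNReal.ofReal (((‖a • z‖ + a) ^ 6)⁻¹) =
      ENNReal.ofReal ((a ^ 3)⁻¹) * ∫⁻ z : E3, ENNReal.ofReal (((‖z‖ + a) ^ 6)⁻¹) := by
    rw [← lintegral_map hm (measurable_const_smul a), h1, lintegral_smul_measure]
    simp [abs_of_pos ha]
  have h3 : ∀ z : E3, ENNReal.ofReal (((‖a • z‖ + a) ^ 6)⁻¹) =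
      ENNReal.ofReal ((a ^ 6)⁻¹) * ENNReal.ofReal (((‖z‖ + 1) ^ 6)⁻¹) := fun z => by
    rw [norm_smul, Real.norm_of_nonneg ha.le, ← ENNReal.ofReal_mul (by positivity), ← mul_inv,
      ← mul_pow]
    ring_nf
  simp only [h3] at h2
  rw [lintegral_const_mul _ (by fun_prop)] at h2
  have h4 : ENNReal.ofReal (a ^ 3) * ENNReal.ofReal ((a ^ 3)⁻¹) = 1 := by
    rw [← ENNReal.ofReal_mul (by positivity), mul_inv_cancel₀ (by positivity), ENNReal.ofReal_one]
  calc _ = ENNReal.ofReal (a ^ 3) * (ENNReal.ofReal ((a ^ 3)⁻¹) *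
        ∫⁻ z : E3, ENNReal.ofReal (((‖z‖ + a) ^ 6)⁻¹)) := by rw [← mul_assoc, h4, one_mul]
    _ = _ := by
      rw [← h2, ← mul_assoc, ← ENNReal.ofReal_mul (by positivity)]
      congr 2
      field_simp

/-! ### The averaging kernel -/

/-- A smooth bump function supported in the closed ball of radius `r / 2`. -/
def radBump {r : ℝ} (hr : 0 < r) : ContDiffBump (0 : E3) :=
  ⟨r / 4, r / 2, by positivity, by linarith⟩

/-- The kernel `θ(z) (‖z‖² + ε²)⁻³`. -/
def avgKer {r : ℝ} (hr : 0 < r) (ε : ℝ) (z : E3) : ℝ :=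
  radBump hr z * ((‖z‖ ^ 2 + ε ^ 2) ^ 3)⁻¹

/-- The size `(‖z‖ + ε)⁻ᵃ` for `‖z‖ < r`, and `0` otherwise. -/
def powKer (r ε : ℝ) (a : ℕ) (z : E3) : ℝ≥0∞ :=
  ENNReal.ofReal (((‖z‖ + ε) ^ a)⁻¹) * ballInd r z

theorem measurable_powKer (r ε : ℝ) (a : ℕ) : Measurable (powKer r ε a) := by
  have := measurable_ballInd r
  unfold powKer
  fun_prop

section Kernel

variable {r ε : ℝ} (hr : 0 < r)

theorem radBump_nonneg (z : E3) : 0 ≤ radBump hr z := (radBump hr).nonneg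

theorem avgKer_nonneg (hε : 0 < ε) (z : E3) : 0 ≤ avgKer hr ε z :=
  mul_nonneg (radBump_nonneg hr z) (by positivity)

theorem radBump_eq_zero {z : E3} (hz : r ≤ ‖z‖) : radBump hr z = 0 :=
  (radBump hr).zero_of_le_dist (by simp only [dist_zero_right, radBump]; linarith)

theorem radBump_eq_one {z : E3} (hz : ‖z‖ ≤ r / 4) : radBump hr z = 1 :=
  (radBump hr).one_of_mem_closedBall (by simpa [radBump] using hz)

theorem half_sq_le (z : E3) (ε : ℝ) : (‖z‖ + ε) ^ 2 / 2 ≤ ‖z‖ ^ 2 + ε ^ 2 := by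
  nlinarith [sq_nonneg (‖z‖ - ε)]

/-- The quadratic denominator makes the kernel smooth at the origin, at the cost of the factor 8 =
2³ against (‖z‖ + ε)⁻⁶. -/
theorem avgKer_le (hε : 0 < ε) (z : E3) : avgKer hr ε z ≤ 8 * ((‖z‖ + ε) ^ 6)⁻¹ := by
  have h1 : radBump hr z ≤ 1 := (radBump hr).le_one
  have h2 : (‖z‖ + ε) ^ 6 / 8 ≤ (‖z‖ ^ 2 + ε ^ 2) ^ 3 := by
    calc (‖z‖ + ε) ^ 6 / 8 = ((‖z‖ + ε) ^ 2 / 2) ^ 3 := by ring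
      _ ≤ _ := by gcongr; exact half_sq_le z ε
  calc avgKer hr ε z ≤ 1 * ((‖z‖ + ε) ^ 6 / 8)⁻¹ := by unfold avgKer; gcongr
    _ = _ := by rw [one_mul, inv_div]; ring

theorem le_avgKer (hε : 0 < ε) {z : E3} (hz : ‖z‖ ≤ r / 4) : ((‖z‖ + ε) ^ 6)⁻¹ ≤ avgKer hr ε z := by
  rw [avgKer, radBump_eq_one hr hz, one_mul]
  gcongr
  calc (‖z‖ ^ 2 + ε ^ 2) ^ 3 ≤ ((‖z‖ + ε) ^ 2) ^ 3 := by
        gcongr; nlinarith [mul_nonneg (norm_nonneg z) hε.le]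
    _ = _ := by ring

theorem avgKer_eq_zero {z : E3} (hz : r ≤ ‖z‖) : avgKer hr ε z = 0 := by
  rw [avgKer, radBump_eq_zero hr hz, zero_mul]

/-- The averaging kernel as a complex valued function. -/
def avgKerC (ε : ℝ) (z : E3) : ℂ := (avgKer hr ε z : ℂ)

theorem contDiff_avgKer (hε : 0 < ε) : ContDiff ℝ ∞ (avgKer hr ε) := by
  refine (ContDiffBump.contDiff _).mul (ContDiff.inv ?_ fun z => by positivity)
  exact ((contDiff_norm_sq ℝ).add contDiff_const).pow 3

theorem hasCompactSupport_avgKer : HasCompactSupport (avgKer hr ε) :=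
  HasCompactSupport.mul_right (ContDiffBump.hasCompactSupport _)

theorem isTestFunction_avgKerC (hε : 0 < ε) : IsTestFunction (avgKerC hr ε) where
  smooth := Complex.ofRealCLM.contDiff.comp (contDiff_avgKer hr hε)
  compact := (hasCompactSupport_avgKer hr).comp_left
    (g := fun t : ℝ => (t : ℂ)) (by simp)

theorem enorm_avgKerC_le (hε : 0 < ε) (z : E3) : ‖avgKerC hr ε z‖ₑ ≤ 8 * powKer r ε 6 z := by
  rw [← ofReal_norm, avgKerC, Complex.norm_real, Real.norm_of_nonneg (avgKer_nonneg hr hε z),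
    powKer]
  by_cases hz : ‖z‖ < r
  · rw [ballInd_of_lt hz, mul_one]
    calc _ ≤ ENNReal.ofReal (8 * ((‖z‖ + ε) ^ 6)⁻¹) :=
          ENNReal.ofReal_le_ofReal (avgKer_le hr hε z)
      _ = _ := by rw [ENNReal.ofReal_mul (by norm_num)]; norm_num
  · rw [avgKer_eq_zero hr (not_lt.1 hz)]
    simp

/-- A uniform bound for the gradient of the cutoff in the averaging kernel. -/
theorem exists_enorm_pderiv_avgKerC_le (hr1 : r ≤ 1) : ∃ B : ℝ, 0 ≤ B ∧ ∀ ε : ℝ, 0 < ε → ε ≤ 1 →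
    ∀ (i : Fin 3) (z : E3), ‖pderiv i (avgKerC hr ε) z‖ₑ ≤
      powKer r ε 6 z * ENNReal.ofReal (B * (‖z‖ + ε)⁻¹) := by
  have hθ : ContDiff ℝ ∞ (radBump hr) := ContDiffBump.contDiff _
  have hθc : HasCompactSupport (radBump hr) := ContDiffBump.hasCompactSupport _
  obtain ⟨B₀, hB₀⟩ := (hθ.continuous_fderiv (by simp)).bounded_above_of_compact_support
    (hθc.fderiv ℝ)
  have hB0 : 0 ≤ B₀ := (norm_nonneg _).trans (hB₀ 0)
  -- The derivative of the power contributes 6 · 16 = 96. The derivative of the cutoff contributes 8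
  -- B₀, doubled by 1 ≤ 2 / (‖z‖ + ε), which holds since ‖z‖ < r ≤ 1 and ε ≤ 1.
  refine ⟨16 * B₀ + 96, by positivity, fun ε hε hε1 i z => ?_⟩
  have hq : (0 : ℝ) < ‖z‖ ^ 2 + ε ^ 2 := by positivity
  have hd : HasFDerivAt (fun z : E3 => (‖z‖ ^ 2 + ε ^ 2) ^ 3)
      ((3 * (‖z‖ ^ 2 + ε ^ 2) ^ 2) • ((2 : ℝ) • innerSL ℝ z)) z := by
    have h1 : HasFDerivAt (fun z : E3 => ‖z‖ ^ 2 + ε ^ 2) ((2 : ℝ) • innerSL ℝ z) z := by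
      have := (hasStrictFDerivAt_norm_sq z).hasFDerivAt.add_const (ε ^ 2)
      simpa [two_smul] using this
    simpa using h1.pow 3
  have hd2 : HasFDerivAt (fun z : E3 => ((‖z‖ ^ 2 + ε ^ 2) ^ 3)⁻¹)
      (-(((‖z‖ ^ 2 + ε ^ 2) ^ 3) ^ 2)⁻¹ • ((3 * (‖z‖ ^ 2 + ε ^ 2) ^ 2) •
        ((2 : ℝ) • innerSL ℝ z))) z :=
    (hasDerivAt_inv (by positivity)).comp_hasFDerivAt z hd
  have hd3 := (hθ.differentiable (by simp) z).hasFDerivAt.mul hd2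
  have hd4 : HasFDerivAt (avgKerC hr ε) _ z := Complex.ofRealCLM.hasFDerivAt.comp z hd3
  have hval : pderiv i (avgKerC hr ε) z = ((radBump hr z *
      (-(((‖z‖ ^ 2 + ε ^ 2) ^ 3) ^ 2)⁻¹ * ((3 * (‖z‖ ^ 2 + ε ^ 2) ^ 2) *
        (2 * inner ℝ z (EuclideanSpace.single i 1)))) +
      ((‖z‖ ^ 2 + ε ^ 2) ^ 3)⁻¹ * fderiv ℝ (radBump hr) z (EuclideanSpace.single i 1) : ℝ) : ℂ) := by
    rw [pderiv, hd4.fderiv]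
    simp
  have hnorm : ‖pderiv i (avgKerC hr ε) z‖ ≤
      6 * ‖z‖ * ((‖z‖ ^ 2 + ε ^ 2) ^ 4)⁻¹ + B₀ * ((‖z‖ ^ 2 + ε ^ 2) ^ 3)⁻¹ := by
    rw [hval, Complex.norm_real]
    have e1 : ‖inner ℝ z (EuclideanSpace.single i (1 : ℝ))‖ ≤ ‖z‖ := by
      refine (norm_inner_le_norm _ _).trans ?_
      simp
    have e2 : ‖fderiv ℝ (radBump hr) z (EuclideanSpace.single i 1)‖ ≤ B₀ := by
      refine (ContinuousLinearMap.le_opNorm _ _).trans ?_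
      simpa using hB₀ z
    have e3 : ‖radBump hr z‖ ≤ 1 := by
      rw [Real.norm_of_nonneg (radBump_nonneg hr z)]
      exact (radBump hr).le_one
    refine (norm_add_le _ _).trans (add_le_add ?_ ?_)
    · rw [norm_mul, norm_mul, norm_mul (3 * (‖z‖ ^ 2 + ε ^ 2) ^ 2) (2 * _),
        norm_mul 2 (inner ℝ z (EuclideanSpace.single i (1 : ℝ))), norm_neg,
        Real.norm_of_nonneg (r := (((‖z‖ ^ 2 + ε ^ 2) ^ 3) ^ 2)⁻¹) (by positivity),
        Real.norm_of_nonneg (r := 3 * (‖z‖ ^ 2 + ε ^ 2) ^ 2) (by positivity),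
        Real.norm_of_nonneg (r := 2) (by positivity)]
      calc _ ≤ 1 * ((((‖z‖ ^ 2 + ε ^ 2) ^ 3) ^ 2)⁻¹ *
            (3 * (‖z‖ ^ 2 + ε ^ 2) ^ 2 * (2 * ‖z‖))) := by gcongr
        _ = 6 * ‖z‖ * ((‖z‖ ^ 2 + ε ^ 2) ^ 4)⁻¹ := by field_simp; ring
    · rw [norm_mul, Real.norm_of_nonneg (r := ((‖z‖ ^ 2 + ε ^ 2) ^ 3)⁻¹) (by positivity), mul_comm]
      gcongr
  rw [powKer]
  by_cases hz : ‖z‖ < r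
  · rw [ballInd_of_lt hz, mul_one, ← ENNReal.ofReal_mul (by positivity), ← ofReal_norm]
    refine ENNReal.ofReal_le_ofReal (hnorm.trans ?_)
    have hS : 0 < ‖z‖ + ε := by positivity
    have h3 : ((‖z‖ ^ 2 + ε ^ 2) ^ 3)⁻¹ ≤ 8 * ((‖z‖ + ε) ^ 6)⁻¹ := by
      calc _ ≤ (((‖z‖ + ε) ^ 2 / 2) ^ 3)⁻¹ := by gcongr; exact half_sq_le z ε
        _ = _ := by field_simp; norm_num
    have h4 : ((‖z‖ ^ 2 + ε ^ 2) ^ 4)⁻¹ ≤ 16 * ((‖z‖ + ε) ^ 8)⁻¹ := by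
      calc _ ≤ (((‖z‖ + ε) ^ 2 / 2) ^ 4)⁻¹ := by gcongr; exact half_sq_le z ε
        _ = _ := by field_simp; norm_num
    have h5 : ‖z‖ ≤ ‖z‖ + ε := by linarith
    have h6 : 1 ≤ 2 * (‖z‖ + ε)⁻¹ := by
      rw [← div_eq_mul_inv, one_le_div hS]; linarith
    calc _ ≤ 6 * (‖z‖ + ε) * (16 * ((‖z‖ + ε) ^ 8)⁻¹) +
          B₀ * (8 * ((‖z‖ + ε) ^ 6)⁻¹) * 1 := by rw [mul_one]; gcongr
      _ ≤ 6 * (‖z‖ + ε) * (16 * ((‖z‖ + ε) ^ 8)⁻¹) +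
          B₀ * (8 * ((‖z‖ + ε) ^ 6)⁻¹) * (2 * (‖z‖ + ε)⁻¹) := by gcongr
      _ = _ := by field_simp; ring
  · rw [ballInd_of_le (not_lt.1 hz), mul_zero, zero_mul]
    have hz2 : z ∉ tsupport (radBump hr) := by
      rw [(radBump hr).tsupport_eq]
      simp only [Metric.mem_closedBall, dist_zero_right, radBump]
      linarith [not_lt.1 hz]
    have e1 : radBump hr z = 0 := image_eq_zero_of_notMem_tsupport hz2
    have e2 : fderiv ℝ (radBump hr) z = 0 := by
      by_contra h
      exact hz2 (support_fderiv_subset ℝ h)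
    rw [hval, e1, e2]
    simp

end Kernel

/-! ### The normalizing weight -/

/-- The total mass of the averaging kernel seen from `x`. -/
def avgMass (μ : Measure E3) {r : ℝ} (hr : 0 < r) (ε : ℝ) (x : E3) : ℝ :=
  ∫ y, avgKer hr ε (x - y) ∂μ

/-- The weight `1 / (1 + mass)`. -/
def avgWt (μ : Measure E3) {r : ℝ} (hr : 0 < r) (ε : ℝ) (x : E3) : ℝ≥0∞ :=
  ENNReal.ofReal ((1 + avgMass μ hr ε x)⁻¹)

section Weight

variable {μ : Measure E3} {Γ : Set E3} {r c C ε : ℝ}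

theorem avgMass_nonneg (hr : 0 < r) (hε : 0 < ε) (x : E3) : 0 ≤ avgMass μ hr ε x :=
  integral_nonneg fun _ => avgKer_nonneg hr hε _

theorem integrable_avgKer [IsLocallyFiniteMeasure μ] (hr : 0 < r) (hε : 0 < ε) (x : E3) :
    Integrable (fun y => avgKer hr ε (x - y)) μ := by
  refine Continuous.integrable_of_hasCompactSupport ?_ ?_
  · exact (contDiff_avgKer hr hε).continuous.comp (continuous_const.sub continuous_id)
  · exact (hasCompactSupport_avgKer hr).comp_homeomorph (Homeomorph.subLeft x)

theorem ofReal_avgMass [IsLocallyFiniteMeasure μ] (hr : 0 < r) (hε : 0 < ε) (x : E3) :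
    ENNReal.ofReal (avgMass μ hr ε x) = ∫⁻ y, ENNReal.ofReal (avgKer hr ε (x - y)) ∂μ :=
  ofReal_integral_eq_lintegral_ofReal (integrable_avgKer hr hε x)
    (Eventually.of_forall fun _ => avgKer_nonneg hr hε _)

theorem conv_one_avgKerC (hr : 0 < r) (x : E3) :
    conv μ (fun _ => 1) (avgKerC hr ε) x = (avgMass μ hr ε x : ℂ) := by
  simp only [conv, one_mul, avgKerC, avgMass]
  exact integral_ofReal

theorem avgWt_le_one (hr : 0 < r) (hε : 0 < ε) (x : E3) : avgWt μ hr ε x ≤ 1 := by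
  rw [avgWt, ← ENNReal.ofReal_one]
  exact ENNReal.ofReal_le_ofReal
    (inv_le_one_of_one_le₀ (by linarith [avgMass_nonneg (μ := μ) hr hε x]))

/-- The weight is at most of the order of the fourth power of the distance to `Γ`. -/
theorem IsSurfaceLike.avgWt_le [IsLocallyFiniteMeasure μ] (h : IsSurfaceLike μ Γ r c C) (hε : 0 < ε) (x : E3) {y : E3}
    (hy : y ∈ Γ) : avgWt μ h.r_pos ε x ≤
      ENNReal.ofReal ((729 / c + (8 / r) ^ 4) * (‖x - y‖ + ε) ^ 4) := by
  have hr := h.r_pos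
  have hc := h.c_pos
  have hm := avgMass_nonneg (μ := μ) hr hε x
  refine ENNReal.ofReal_le_ofReal ?_
  set t := ‖x - y‖ + ε with ht
  have ht0 : 0 < t := by positivity
  by_cases h8 : 2 * t ≤ r / 4
  -- Near Γ, every z in the ball of radius t about y is within 2t of x, so the kernel is at least
  -- (3t)⁻⁶ there; this ball has mass at least c t², and 729 = 3⁶.
  · have h1 : c / 729 * (t ^ 4)⁻¹ ≤ avgMass μ hr ε x := by
      rw [← ENNReal.ofReal_le_ofReal_iff hm, ofReal_avgMass hr hε]
      calc ENNReal.ofReal (c / 729 * (t ^ 4)⁻¹)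
          = ENNReal.ofReal (((3 * t) ^ 6)⁻¹) * ENNReal.ofReal (c * t ^ 2) := by
            rw [← ENNReal.ofReal_mul (by positivity)]
            congr 1
            field_simp
            norm_num
        _ ≤ ENNReal.ofReal (((3 * t) ^ 6)⁻¹) * μ (Metric.ball y t) := by
            gcongr
            exact h.lower y hy t ht0 (by linarith)
        _ = ∫⁻ _ in Metric.ball y t, ENNReal.ofReal (((3 * t) ^ 6)⁻¹) ∂μ := by
            rw [setLIntegral_const]
        _ ≤ ∫⁻ z in Metric.ball y t, ENNReal.ofReal (avgKer hr ε (x - z)) ∂μ := by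
            refine setLIntegral_mono' Metric.isOpen_ball.measurableSet fun z hz => ?_
            refine ENNReal.ofReal_le_ofReal ?_
            have hz1 : ‖x - z‖ ≤ 2 * t := by
              have h2 : ‖x - z‖ ≤ ‖x - y‖ + ‖y - z‖ := norm_sub_le_norm_sub_add_norm_sub x y z
              rw [Metric.mem_ball, dist_comm, dist_eq_norm] at hz
              linarith
            refine le_trans ?_ (le_avgKer hr hε (hz1.trans h8))
            gcongr
            have : ε ≤ t := by rw [ht]; linarith [norm_nonneg (x - y)]
            linarith
        _ ≤ _ := setLIntegral_le_lintegral _ _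
    calc (1 + avgMass μ hr ε x)⁻¹ ≤ (c / 729 * (t ^ 4)⁻¹)⁻¹ := by gcongr; linarith
      _ = 729 / c * t ^ 4 := by rw [mul_inv, inv_inv, inv_div]
      _ ≤ _ := by gcongr; linarith [show 0 ≤ (8 / r) ^ 4 by positivity]
  -- Away from Γ the mass may vanish; the weight is at most 1, and t exceeds a fixed fraction of r.
  · have h1 : 1 ≤ 8 / r * t := by
      rw [div_mul_eq_mul_div, one_le_div hr]; linarith
    calc (1 + avgMass μ hr ε x)⁻¹ ≤ 1 := inv_le_one_of_one_le₀ (by linarith)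
      _ ≤ (8 / r * t) ^ 4 := one_le_pow₀ h1
      _ = (8 / r) ^ 4 * t ^ 4 := by ring
      _ ≤ _ := by gcongr; linarith [show 0 ≤ 729 / c by positivity]

/-- Up to distance r / 4 the power kernel is below the averaging kernel, whose weighted mass is at
most 1; beyond that it is at most (4 / r)⁶ on a ball of mass at most C. This bounded total mass is
what Jensen's inequality needs. -/
theorem IsSurfaceLike.avgWt_mul_lintegral_le [IsLocallyFiniteMeasure μ] (h : IsSurfaceLike μ Γ r c C) (hε : 0 < ε) (x : E3) :
    avgWt μ h.r_pos ε x * ∫⁻ y, powKer r ε 6 (x - y) ∂μ ≤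
      ENNReal.ofReal (1 + (4 / r) ^ 6 * C) := by
  have hr := h.r_pos
  have hC := h.C_nonneg
  have hm := avgMass_nonneg (μ := μ) hr hε x
  have h1 : ∀ z, powKer r ε 6 z ≤
      ENNReal.ofReal (avgKer hr ε z) + ENNReal.ofReal ((4 / r) ^ 6) * ballInd r z := by
    intro z
    by_cases hz : ‖z‖ < r
    · rw [powKer, ballInd_of_lt hz, mul_one, mul_one]
      by_cases hz2 : ‖z‖ ≤ r / 4
      · exact (ENNReal.ofReal_le_ofReal (le_avgKer hr hε hz2)).trans le_self_add
      · refine le_trans (ENNReal.ofReal_le_ofReal ?_) le_add_self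
        calc ((‖z‖ + ε) ^ 6)⁻¹ ≤ ((r / 4) ^ 6)⁻¹ := by gcongr; linarith
          _ = (4 / r) ^ 6 := by rw [← inv_pow, inv_div]
    · rw [powKer, ballInd_of_le (not_lt.1 hz), mul_zero]
      exact zero_le
  have hmk : Measurable fun y => ENNReal.ofReal (avgKer hr ε (x - y)) :=
    ((contDiff_avgKer hr hε).continuous.comp
      (continuous_const.sub continuous_id)).measurable.ennreal_ofReal
  calc _ ≤ avgWt μ hr ε x * ∫⁻ y, (ENNReal.ofReal (avgKer hr ε (x - y)) +
        ENNReal.ofReal ((4 / r) ^ 6) * ballInd r (x - y)) ∂μ := by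
        gcongr; exact h1 _
    _ = avgWt μ hr ε x * (ENNReal.ofReal (avgMass μ hr ε x) +
        ENNReal.ofReal ((4 / r) ^ 6) * μ (Metric.ball x r)) := by
        rw [lintegral_add_left hmk, ofReal_avgMass hr hε,
          lintegral_const_mul' _ _ ENNReal.ofReal_ne_top, lintegral_ballInd_sub_left]
    _ ≤ avgWt μ hr ε x * (ENNReal.ofReal (avgMass μ hr ε x) +
        ENNReal.ofReal ((4 / r) ^ 6) * ENNReal.ofReal C) := by
        gcongr; exact h.upper x
    _ = ENNReal.ofReal ((1 + avgMass μ hr ε x)⁻¹ * (avgMass μ hr ε x + (4 / r) ^ 6 * C)) := by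
        rw [avgWt, ← ENNReal.ofReal_mul (by positivity), ← ENNReal.ofReal_add hm (by positivity),
          ← ENNReal.ofReal_mul (by positivity)]
    _ ≤ _ := by
        refine ENNReal.ofReal_le_ofReal ?_
        rw [inv_mul_le_iff₀ (by positivity)]
        have : 0 ≤ (4 / r) ^ 6 * C := by positivity
        nlinarith [mul_nonneg hm this]

/-- Jensen's inequality for the weighted averages. -/
theorem IsSurfaceLike.sq_avg_le [IsLocallyFiniteMeasure μ] (h : IsSurfaceLike μ Γ r c C) (hε : 0 < ε) (x : E3)
    {H : E3 → ℝ≥0∞} (hH : Measurable H) :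
    (avgWt μ h.r_pos ε x * ∫⁻ y, powKer r ε 6 (x - y) * H y ∂μ) ^ 2 ≤
      ENNReal.ofReal (1 + (4 / r) ^ 6 * C) *
        ∫⁻ y, avgWt μ h.r_pos ε x * powKer r ε 6 (x - y) * H y ^ 2 ∂μ := by
  have hk : Measurable fun y => powKer r ε 6 (x - y) :=
    (measurable_powKer r ε 6).comp (measurable_const.sub measurable_id)
  have hwt : avgWt μ h.r_pos ε x ≠ ⊤ := ENNReal.ofReal_ne_top
  rw [mul_pow]
  calc _ ≤ avgWt μ h.r_pos ε x ^ 2 * ((∫⁻ y, powKer r ε 6 (x - y) ∂μ) *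
        ∫⁻ y, powKer r ε 6 (x - y) * H y ^ 2 ∂μ) := by
        gcongr; exact sq_lintegral_mul_le μ hk hH
    _ = (avgWt μ h.r_pos ε x * ∫⁻ y, powKer r ε 6 (x - y) ∂μ) *
        (avgWt μ h.r_pos ε x * ∫⁻ y, powKer r ε 6 (x - y) * H y ^ 2 ∂μ) := by ring
    _ ≤ ENNReal.ofReal (1 + (4 / r) ^ 6 * C) *
        (avgWt μ h.r_pos ε x * ∫⁻ y, powKer r ε 6 (x - y) * H y ^ 2 ∂μ) := by
        gcongr; exact h.avgWt_mul_lintegral_le hε x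
    _ = _ := by
        rw [← lintegral_const_mul' _ _ hwt]
        simp only [mul_assoc]

end Weight

/-! ### The extension by averages -/

/-- The function `x ↦ (1 + ∫ g(x - y) dμ(y))⁻¹ ∫ g(x - y) ψ(y) dμ(y)`. -/
def avgExt (μ : Measure E3) {r : ℝ} (hr : 0 < r) (ε : ℝ) (ψ : E3 → ℂ) (x : E3) : ℂ :=
  conv μ ψ (avgKerC hr ε) x * (1 + conv μ (fun _ => 1) (avgKerC hr ε) x)⁻¹

section Extension

variable {μ : Measure E3} {Γ : Set E3} {r c C ε : ℝ}

theorem one_add_conv_ne_zero (hr : 0 < r) (hε : 0 < ε) (x : E3) :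
    1 + conv μ (fun _ => 1) (avgKerC hr ε) x ≠ 0 := by
  rw [conv_one_avgKerC, ← Complex.ofReal_one, ← Complex.ofReal_add]
  exact Complex.ofReal_ne_zero.2 (by linarith [avgMass_nonneg (μ := μ) hr hε x])

theorem enorm_inv_one_add_conv (hr : 0 < r) (hε : 0 < ε) (x : E3) :
    ‖(1 + conv μ (fun _ => 1) (avgKerC hr ε) x)⁻¹‖ₑ = avgWt μ hr ε x := by
  rw [conv_one_avgKerC, ← Complex.ofReal_one, ← Complex.ofReal_add, ← Complex.ofReal_inv,
    ← ofReal_norm, Complex.norm_real, avgWt, Real.norm_of_nonneg]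
  have := avgMass_nonneg (μ := μ) hr hε x
  positivity

theorem contDiff_avgExt [IsLocallyFiniteMeasure μ] (hr : 0 < r) (hε : 0 < ε) {ψ : E3 → ℂ} (hψ : LocallyIntegrable ψ μ) :
    ContDiff ℝ ∞ (avgExt μ hr ε ψ) := by
  have hg := isTestFunction_avgKerC hr hε
  exact (contDiff_conv hψ hg).mul ((contDiff_const.add
    (contDiff_conv (locallyIntegrable_const 1) hg)).inv (one_add_conv_ne_zero hr hε))

theorem enorm_conv_le {f g : E3 → ℂ} {k H : E3 → ℝ≥0∞} (x : E3)
    (hk : ∀ y, ‖f y * g (x - y)‖ₑ ≤ k (x - y) * H y) :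
    ‖conv μ f g x‖ₑ ≤ ∫⁻ y, k (x - y) * H y ∂μ :=
  (enorm_integral_le_lintegral_enorm _).trans (lintegral_mono hk)

theorem enorm_avgExt_le (hr : 0 < r) (hε : 0 < ε) (ψ : E3 → ℂ) (x : E3) :
    ‖avgExt μ hr ε ψ x‖ₑ ≤ avgWt μ hr ε x * ∫⁻ y, powKer r ε 6 (x - y) * (8 * ‖ψ y‖ₑ) ∂μ := by
  rw [avgExt, enorm_mul, enorm_inv_one_add_conv hr hε, mul_comm]
  gcongr
  refine enorm_conv_le x fun y => ?_
  rw [enorm_mul]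
  calc _ ≤ ‖ψ y‖ₑ * (8 * powKer r ε 6 (x - y)) := by gcongr; exact enorm_avgKerC_le hr hε _
    _ = _ := by ring

/-- Write N and m for the integrals of ψ and of 1 against the kernel. The quotient rule gives ((1 +
m) ∂N - N ∂m) / (1 + m)². Here m ∂N - N ∂m is the double integral of g(x - z) (ψ(y) - ψ(z)) ∂g(x -
y), which sees only differences of ψ; the leftover ∂N keeps the full factor (1 + m)⁻² and is of
lower order. -/
theorem pderiv_avgExt [IsLocallyFiniteMeasure μ] (hr : 0 < r) (hε : 0 < ε) {ψ : E3 → ℂ} (hψ : LocallyIntegrable ψ μ)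
    (i : Fin 3) (x : E3) : pderiv i (avgExt μ hr ε ψ) x =
      (1 + conv μ (fun _ => 1) (avgKerC hr ε) x)⁻¹ ^ 2 * conv μ ψ (pderiv i (avgKerC hr ε)) x +
      (1 + conv μ (fun _ => 1) (avgKerC hr ε) x)⁻¹ ^ 2 * ∫ z, avgKerC hr ε (x - z) *
        ∫ y, (ψ y - ψ z) * pderiv i (avgKerC hr ε) (x - y) ∂μ ∂μ := by
  have hg := isTestFunction_avgKerC hr hε
  have h1l : LocallyIntegrable (fun _ : E3 => (1 : ℂ)) μ := locallyIntegrable_const 1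
  have hgc := hg.continuous_pderiv i
  have hgs : HasCompactSupport (pderiv i (avgKerC hr ε)) := hg.compact.fderiv_apply ℝ _
  have e1 : ∀ z, ∫ y, (ψ y - ψ z) * pderiv i (avgKerC hr ε) (x - y) ∂μ =
      conv μ ψ (pderiv i (avgKerC hr ε)) x -
        ψ z * conv μ (fun _ => 1) (pderiv i (avgKerC hr ε)) x := by
    intro z
    have i1 := integrable_conv hψ hgc hgs x
    have i2 := integrable_conv h1l hgc hgs x
    simp only [conv]
    rw [← integral_const_mul, ← integral_sub i1 (i2.const_mul (ψ z))]
    refine integral_congr_ae (Eventually.of_forall fun y => ?_)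
    ring
  have e2 : ∫ z, avgKerC hr ε (x - z) * ∫ y, (ψ y - ψ z) * pderiv i (avgKerC hr ε) (x - y) ∂μ ∂μ =
      conv μ (fun _ => 1) (avgKerC hr ε) x * conv μ ψ (pderiv i (avgKerC hr ε)) x -
        conv μ ψ (avgKerC hr ε) x * conv μ (fun _ => 1) (pderiv i (avgKerC hr ε)) x := by
    have i1 := integrable_conv hψ hg.smooth.continuous hg.compact x
    have i2 := integrable_conv h1l hg.smooth.continuous hg.compact x
    simp only [e1]
    generalize conv μ ψ (pderiv i (avgKerC hr ε)) x = a
    generalize conv μ (fun _ => 1) (pderiv i (avgKerC hr ε)) x = b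
    simp only [conv]
    rw [← integral_mul_const, ← integral_mul_const, ← integral_sub (i2.mul_const a) (i1.mul_const b)]
    refine integral_congr_ae (Eventually.of_forall fun y => ?_)
    simp only
    ring
  have hne := one_add_conv_ne_zero (μ := μ) hr hε x
  have dN : DifferentiableAt ℝ (conv μ ψ (avgKerC hr ε)) x :=
    (contDiff_conv hψ hg).differentiable (by simp) x
  have dD : DifferentiableAt ℝ (conv μ (fun _ => 1) (avgKerC hr ε)) x :=
    (contDiff_conv h1l hg).differentiable (by simp) x
  have hinv : HasFDerivAt (fun x => (1 + conv μ (fun _ => 1) (avgKerC hr ε) x)⁻¹)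
      ((-((1 + conv μ (fun _ => 1) (avgKerC hr ε) x) ^ 2)⁻¹) •
        fderiv ℝ (conv μ (fun _ => 1) (avgKerC hr ε)) x) x :=
    (hasDerivAt_inv hne).comp_hasFDerivAt x (dD.hasFDerivAt.const_add 1)
  have e3 : pderiv i (avgExt μ hr ε ψ) x =
      conv μ ψ (avgKerC hr ε) x * (-((1 + conv μ (fun _ => 1) (avgKerC hr ε) x) ^ 2)⁻¹ *
        pderiv i (conv μ (fun _ => 1) (avgKerC hr ε)) x) +
      pderiv i (conv μ ψ (avgKerC hr ε)) x * (1 + conv μ (fun _ => 1) (avgKerC hr ε) x)⁻¹ := by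
    have h2 := pderiv_mul dN hinv.differentiableAt i
    refine h2.trans ?_
    congr 2
    rw [pderiv, hinv.fderiv]
    rfl
  rw [e3, e2, pderiv_conv hψ hg, pderiv_conv h1l hg]
  field_simp
  ring

end Extension

/-! ### Integrated estimates for the extension by averages -/

/-- The square of the Sobolev-Slobodeckij seminorm. -/
def slobSq (μ : Measure E3) (ψ : E3 → ℂ) : ℝ≥0∞ :=
  ∫⁻ z, ∫⁻ y, (edist z y ^ 3)⁻¹ * ‖ψ y - ψ z‖ₑ ^ 2 ∂μ ∂μ

theorem enorm_add_sq_le (a b : ℂ) : ‖a + b‖ₑ ^ 2 ≤ 2 * ‖a‖ₑ ^ 2 + 2 * ‖b‖ₑ ^ 2 := by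
  have h : ‖a + b‖ ^ 2 ≤ 2 * ‖a‖ ^ 2 + 2 * ‖b‖ ^ 2 := by
    nlinarith [norm_add_le a b, sq_nonneg (‖a‖ - ‖b‖), norm_nonneg (a + b)]
  have h2 := ENNReal.ofReal_le_ofReal h
  rw [ENNReal.ofReal_add (by positivity) (by positivity), ENNReal.ofReal_mul (by norm_num),
    ENNReal.ofReal_mul (by norm_num), ENNReal.ofReal_pow (norm_nonneg _),
    ENNReal.ofReal_pow (norm_nonneg _), ENNReal.ofReal_pow (norm_nonneg _), ofReal_norm,
    ofReal_norm, ofReal_norm] at h2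
  simpa using h2

/-- The left side is κ² b⁻⁶ a⁻⁸. Using the bound by the smaller of a and b for both factors κ leaves
at most A² max(a, b)⁻⁶, and max(a, b) ≥ (a + b) / 2 accounts for 64 = 2⁶. Decay in the sum a + b is
what makes the integral over x scale like ‖y - z‖⁻³. -/
theorem mul_le_of_le_fourth {A κ a b : ℝ} (hκ : 0 ≤ κ) (ha : 0 < a) (hb : 0 < b)
    (h1 : κ ≤ A * a ^ 4) (h2 : κ ≤ A * b ^ 4) :
    κ * (b ^ 6)⁻¹ * (κ * (a ^ 6)⁻¹ * (a⁻¹) ^ 2) ≤ 64 * A ^ 2 * ((a + b) ^ 6)⁻¹ := by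
  have hA : 0 ≤ A := by
    by_contra hA
    have : A * a ^ 4 < 0 := mul_neg_of_neg_of_pos (not_le.1 hA) (by positivity)
    linarith
  have e : κ * (b ^ 6)⁻¹ * (κ * (a ^ 6)⁻¹ * (a⁻¹) ^ 2) = κ * κ * ((b ^ 6)⁻¹ * (a ^ 8)⁻¹) := by
    field_simp
  rw [e]
  rcases le_total a b with hab | hab
  · calc κ * κ * ((b ^ 6)⁻¹ * (a ^ 8)⁻¹)
        ≤ (A * a ^ 4) * (A * a ^ 4) * ((b ^ 6)⁻¹ * (a ^ 8)⁻¹) := by gcongr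
      _ = A ^ 2 * (b ^ 6)⁻¹ := by field_simp
      _ ≤ A ^ 2 * (((a + b) / 2) ^ 6)⁻¹ := by gcongr; linarith
      _ = _ := by field_simp; norm_num
  · calc κ * κ * ((b ^ 6)⁻¹ * (a ^ 8)⁻¹)
        ≤ (A * b ^ 4) * (A * b ^ 4) * ((b ^ 6)⁻¹ * (a ^ 8)⁻¹) := by gcongr
      _ = A ^ 2 * (b ^ 2 * (a ^ 8)⁻¹) := by field_simp
      _ ≤ A ^ 2 * (a ^ 2 * (a ^ 8)⁻¹) := by gcongr
      _ = A ^ 2 * (a ^ 6)⁻¹ := by field_simp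
      _ ≤ A ^ 2 * (((a + b) / 2) ^ 6)⁻¹ := by gcongr; linarith
      _ = _ := by field_simp; norm_num

theorem powKer_le (r ε : ℝ) (a : ℕ) (z : E3) :
    powKer r ε a z ≤ ENNReal.ofReal (((‖z‖ + ε) ^ a)⁻¹) := by
  rw [powKer]
  by_cases hz : ‖z‖ < r
  · rw [ballInd_of_lt hz, mul_one]
  · rw [ballInd_of_le (not_lt.1 hz), mul_zero]
    exact zero_le

section Estimates

variable {μ : Measure E3} [IsLocallyFiniteMeasure μ] {Γ : Set E3} {r c C ε : ℝ}

theorem IsSurfaceLike.inv_mass_le (h : IsSurfaceLike μ Γ r c C) (hε : 0 < ε) (x : E3) {y : E3}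
    (hy : y ∈ Γ) : (1 + avgMass μ h.r_pos ε x)⁻¹ ≤
      (729 / c + (8 / r) ^ 4) * (‖x - y‖ + ε) ^ 4 := by
  have hr := h.r_pos
  have hc := h.c_pos
  exact (ENNReal.ofReal_le_ofReal_iff (by positivity)).1 (h.avgWt_le hε x hy)

theorem lintegral_powKer_two_le (r : ℝ) (hε : 0 < ε) :
    ∫⁻ z, powKer r ε 2 z ≤ ∫⁻ z : E3, ENNReal.ofReal ((‖z‖ ^ 2)⁻¹) * ballInd r z := by
  refine lintegral_mono_ae ?_
  have h0 : ∀ᵐ z : E3, z ≠ 0 := by simp [ae_iff]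
  filter_upwards [h0] with z hz
  have : 0 < ‖z‖ := norm_pos_iff.2 hz
  rw [powKer]
  gcongr
  linarith

/-- The `L²(ℝ³)` bound. -/
theorem IsSurfaceLike.lintegral_avgExt_le [SFinite μ] (h : IsSurfaceLike μ Γ r c C) :
    ∃ K : ℝ≥0∞, K ≠ ⊤ ∧ ∀ ε : ℝ, 0 < ε → ∀ ψ : E3 → ℂ, Measurable ψ →
      ∫⁻ x, ‖avgExt μ h.r_pos ε ψ x‖ₑ ^ 2 ≤ K * ∫⁻ y, ‖ψ y‖ₑ ^ 2 ∂μ := by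
  have hr := h.r_pos
  have hc := h.c_pos
  set A := 729 / c + (8 / r) ^ 4 with hA
  set B := 1 + (4 / r) ^ 6 * C with hB
  have hA0 : 0 ≤ A := by positivity
  let I := ∫⁻ z : E3, ENNReal.ofReal ((‖z‖ ^ 2)⁻¹) * ballInd r z
  refine ⟨ENNReal.ofReal B * 64 * ENNReal.ofReal A * I,
    ENNReal.mul_ne_top (by finiteness) (lintegral_inv_sq_lt_top r).ne, fun ε hε ψ hψ => ?_⟩
  have hk : Measurable fun z : E3 × E3 => powKer r ε 2 (z.1 - z.2) :=
    (measurable_powKer r ε 2).comp (measurable_fst.sub measurable_snd)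
  have hpt : ∀ x, ‖avgExt μ hr ε ψ x‖ₑ ^ 2 ≤ ENNReal.ofReal B * 64 * ENNReal.ofReal A *
      ∫⁻ y, powKer r ε 2 (x - y) * ‖ψ y‖ₑ ^ 2 ∂μ := by
    intro x
    have hκ := avgMass_nonneg (μ := μ) hr hε x
    calc _ ≤ _ := pow_le_pow_left' (enorm_avgExt_le hr hε ψ x) 2
      _ ≤ _ := h.sq_avg_le hε x (hψ.enorm.const_mul 8)
      _ ≤ ENNReal.ofReal B * ∫⁻ y, 64 * ENNReal.ofReal A *
            (powKer r ε 2 (x - y) * ‖ψ y‖ₑ ^ 2) ∂μ := by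
          refine mul_le_mul_right (lintegral_mono_ae ?_) _
          filter_upwards [h.ae_mem] with y hy
          have hS : 0 < ‖x - y‖ + ε := by positivity
          -- The weight absorbs four of the six powers, and the remaining ‖x - y‖⁻² is locally
          -- integrable in ℝ³. The factor 64 below is the square of the kernel constant 8.
          have h1 : avgWt μ hr ε x * powKer r ε 6 (x - y) ≤
              ENNReal.ofReal A * powKer r ε 2 (x - y) := by
            rw [powKer, powKer, avgWt, ← mul_assoc, ← mul_assoc,
              ← ENNReal.ofReal_mul (by positivity), ← ENNReal.ofReal_mul hA0]
            refine mul_le_mul_left (ENNReal.ofReal_le_ofReal ?_) _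
            calc _ ≤ A * (‖x - y‖ + ε) ^ 4 * ((‖x - y‖ + ε) ^ 6)⁻¹ := by
                  gcongr; exact h.inv_mass_le hε x hy
              _ = _ := by field_simp
          calc _ ≤ ENNReal.ofReal A * powKer r ε 2 (x - y) * (8 * ‖ψ y‖ₑ) ^ 2 := by gcongr
            _ = _ := by rw [mul_pow]; norm_num; ring
      _ = _ := by
          rw [lintegral_const_mul' _ _ (by finiteness)]
          ring
  calc _ ≤ _ := lintegral_mono hpt
    _ = ENNReal.ofReal B * 64 * ENNReal.ofReal A *
        ∫⁻ x, ∫⁻ y, powKer r ε 2 (x - y) * ‖ψ y‖ₑ ^ 2 ∂μ :=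
        lintegral_const_mul' _ _ (by finiteness)
    _ = ENNReal.ofReal B * 64 * ENNReal.ofReal A *
        ∫⁻ y, (∫⁻ x, powKer r ε 2 (x - y) * ‖ψ y‖ₑ ^ 2) ∂μ := by
        rw [lintegral_lintegral_swap]
        exact (hk.mul ((hψ.comp measurable_snd).enorm.pow_const 2)).aemeasurable
    _ ≤ ENNReal.ofReal B * 64 * ENNReal.ofReal A * ∫⁻ y, I * ‖ψ y‖ₑ ^ 2 ∂μ := by
        gcongr with y
        rw [lintegral_mul_const' _ _ (by finiteness),
          lintegral_sub_right_eq_self (powKer r ε 2) y]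
        gcongr
        exact lintegral_powKer_two_le r hε
    _ = _ := by rw [lintegral_const_mul' _ _ (lintegral_inv_sq_lt_top r).ne]; ring

/-- The squared error of the boundary values. -/
theorem IsSurfaceLike.lintegral_avgExt_sub_le (h : IsSurfaceLike μ Γ r c C) :
    ∃ K : ℝ≥0∞, K ≠ ⊤ ∧ ∀ ε : ℝ, 0 < ε → ε ≤ 1 → ∀ ψ : E3 → ℂ, Measurable ψ →
      LocallyIntegrable ψ μ →
      ∫⁻ x, ‖avgExt μ h.r_pos ε ψ x - ψ x‖ₑ ^ 2 ∂μ ≤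
        ENNReal.ofReal ε * (K * (slobSq μ ψ + ∫⁻ y, ‖ψ y‖ₑ ^ 2 ∂μ)) := by
  have hr := h.r_pos
  have hc := h.c_pos
  set A := 729 / c + (8 / r) ^ 4 with hA
  set B := 1 + (4 / r) ^ 6 * C with hB
  have hA0 : 0 ≤ A := by positivity
  refine ⟨128 * ENNReal.ofReal B * ENNReal.ofReal A + 2 * ENNReal.ofReal A, by finiteness,
    fun ε hε hε1 ψ hψ hψl => ?_⟩
  have hg := isTestFunction_avgKerC hr hε
  have hpt : ∀ x ∈ Γ, ‖avgExt μ hr ε ψ x - ψ x‖ₑ ^ 2 ≤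
      128 * ENNReal.ofReal B * ENNReal.ofReal A * ENNReal.ofReal ε *
        (∫⁻ y, (edist x y ^ 3)⁻¹ * ‖ψ y - ψ x‖ₑ ^ 2 ∂μ) +
        2 * ENNReal.ofReal A * ENNReal.ofReal ε * ‖ψ x‖ₑ ^ 2 := by
    intro x hx
    have hκ := avgMass_nonneg (μ := μ) hr hε x
    have hne := one_add_conv_ne_zero (μ := μ) hr hε x
    -- The weight bound at distance zero, since x itself lies on Γ.
    have hκε : (1 + avgMass μ hr ε x)⁻¹ ≤ A * ε ^ 4 := by
      simpa using h.inv_mass_le hε x hx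
    -- The average does not reproduce constants because of the 1 in the denominator: besides the
    -- averaged difference there remains the weight times -ψ(x).
    have e1 : avgExt μ hr ε ψ x - ψ x =
        (1 + conv μ (fun _ => 1) (avgKerC hr ε) x)⁻¹ *
          conv μ (fun y => ψ y - ψ x) (avgKerC hr ε) x +
        -((1 + conv μ (fun _ => 1) (avgKerC hr ε) x)⁻¹ * ψ x) := by
      have i1 := integrable_conv hψl hg.smooth.continuous hg.compact x
      have i2 := integrable_conv (locallyIntegrable_const (μ := μ) (1 : ℂ))
        hg.smooth.continuous hg.compact x
      have e2 : conv μ (fun y => ψ y - ψ x) (avgKerC hr ε) x =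
          conv μ ψ (avgKerC hr ε) x - ψ x * conv μ (fun _ => 1) (avgKerC hr ε) x := by
        simp only [conv]
        rw [← integral_const_mul, ← integral_sub i1 (i2.const_mul (ψ x))]
        refine integral_congr_ae (Eventually.of_forall fun y => ?_)
        ring
      rw [e2, avgExt]
      field_simp
      ring
    have e3 : ‖(1 + conv μ (fun _ => 1) (avgKerC hr ε) x)⁻¹ *
        conv μ (fun y => ψ y - ψ x) (avgKerC hr ε) x‖ₑ ≤
        avgWt μ hr ε x * ∫⁻ y, powKer r ε 6 (x - y) * (8 * ‖ψ y - ψ x‖ₑ) ∂μ := by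
      rw [enorm_mul, enorm_inv_one_add_conv hr hε]
      gcongr
      refine enorm_conv_le x fun y => ?_
      rw [enorm_mul]
      calc _ ≤ ‖ψ y - ψ x‖ₑ * (8 * powKer r ε 6 (x - y)) := by
            gcongr; exact enorm_avgKerC_le hr hε _
        _ = _ := by ring
    have e4 : ‖(1 + conv μ (fun _ => 1) (avgKerC hr ε) x)⁻¹ *
        conv μ (fun y => ψ y - ψ x) (avgKerC hr ε) x‖ₑ ^ 2 ≤
        64 * ENNReal.ofReal B * ENNReal.ofReal A * ENNReal.ofReal ε *
        (∫⁻ y, (edist x y ^ 3)⁻¹ * ‖ψ y - ψ x‖ₑ ^ 2 ∂μ) := by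
      calc _ ≤ _ := pow_le_pow_left' e3 2
        _ ≤ _ := h.sq_avg_le hε x ((hψ.sub_const (ψ x)).enorm.const_mul 8)
        _ ≤ ENNReal.ofReal B * ∫⁻ y, 64 * ENNReal.ofReal A * ENNReal.ofReal ε *
              ((edist x y ^ 3)⁻¹ * ‖ψ y - ψ x‖ₑ ^ 2) ∂μ := by
            refine mul_le_mul_right (lintegral_mono fun y => ?_) _
            have hS : 0 < ‖x - y‖ + ε := by positivity
            -- Of the four powers of ε three cancel three powers of ‖x - y‖ + ε, leaving the
            -- Slobodeckij weight; the fourth is the rate of convergence.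
            have h1 : avgWt μ hr ε x * powKer r ε 6 (x - y) ≤
                ENNReal.ofReal A * ENNReal.ofReal ε * (edist x y ^ 3)⁻¹ := by
              calc _ ≤ ENNReal.ofReal (A * ε ^ 4) *
                    ENNReal.ofReal (((‖x - y‖ + ε) ^ 6)⁻¹) := by
                    gcongr
                    · exact ENNReal.ofReal_le_ofReal hκε
                    · exact powKer_le _ _ _ _
                _ ≤ ENNReal.ofReal (A * ε * ((‖x - y‖ + ε) ^ 3)⁻¹) := by
                    rw [← ENNReal.ofReal_mul (by positivity)]
                    refine ENNReal.ofReal_le_ofReal ?_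
                    have hεS : ε ≤ ‖x - y‖ + ε := by linarith [norm_nonneg (x - y)]
                    calc A * ε ^ 4 * ((‖x - y‖ + ε) ^ 6)⁻¹
                        = A * ε * ε ^ 3 * ((‖x - y‖ + ε) ^ 6)⁻¹ := by ring
                      _ ≤ A * ε * (‖x - y‖ + ε) ^ 3 * ((‖x - y‖ + ε) ^ 6)⁻¹ := by gcongr
                      _ = _ := by field_simp
                _ ≤ _ := by
                    rw [ENNReal.ofReal_mul (by positivity), ENNReal.ofReal_mul hA0,
                      ENNReal.ofReal_inv_of_pos (by positivity),
                      ENNReal.ofReal_pow (by positivity)]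
                    gcongr
                    rw [edist_dist, dist_eq_norm]
                    exact ENNReal.ofReal_le_ofReal (by linarith)
            calc _ ≤ ENNReal.ofReal A * ENNReal.ofReal ε * (edist x y ^ 3)⁻¹ *
                  (8 * ‖ψ y - ψ x‖ₑ) ^ 2 := by gcongr
              _ = _ := by rw [mul_pow]; norm_num; ring
        _ = _ := by
            rw [lintegral_const_mul' _ _ (by finiteness)]
            ring
    have e5 : ‖-((1 + conv μ (fun _ => 1) (avgKerC hr ε) x)⁻¹ * ψ x)‖ₑ ^ 2 ≤
        ENNReal.ofReal A * ENNReal.ofReal ε * ‖ψ x‖ₑ ^ 2 := by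
      rw [enorm_neg, enorm_mul, enorm_inv_one_add_conv hr hε, mul_pow]
      gcongr
      calc avgWt μ hr ε x ^ 2 = avgWt μ hr ε x * avgWt μ hr ε x := sq _
        _ ≤ ENNReal.ofReal (A * ε ^ 4) * 1 := by
            gcongr
            · exact ENNReal.ofReal_le_ofReal hκε
            · exact avgWt_le_one hr hε x
        _ ≤ ENNReal.ofReal (A * ε) := by
            rw [mul_one]
            refine ENNReal.ofReal_le_ofReal ?_
            gcongr
            calc ε ^ 4 = ε * ε ^ 3 := by ring
              _ ≤ ε * 1 := by gcongr; exact pow_le_one₀ hε.le hε1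
              _ = ε := mul_one _
        _ = _ := ENNReal.ofReal_mul hA0
    rw [e1]
    refine (enorm_add_sq_le _ _).trans (add_le_add ?_ ?_)
    · refine (mul_le_mul_right e4 2).trans (le_of_eq ?_)
      ring
    · refine (mul_le_mul_right e5 2).trans (le_of_eq ?_)
      ring
  calc _ ≤ ∫⁻ x, (128 * ENNReal.ofReal B * ENNReal.ofReal A * ENNReal.ofReal ε *
        (∫⁻ y, (edist x y ^ 3)⁻¹ * ‖ψ y - ψ x‖ₑ ^ 2 ∂μ) +
        2 * ENNReal.ofReal A * ENNReal.ofReal ε * ‖ψ x‖ₑ ^ 2) ∂μ :=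
        lintegral_mono_ae (h.ae_mem.mono hpt)
    _ = 128 * ENNReal.ofReal B * ENNReal.ofReal A * ENNReal.ofReal ε * slobSq μ ψ +
        2 * ENNReal.ofReal A * ENNReal.ofReal ε * ∫⁻ y, ‖ψ y‖ₑ ^ 2 ∂μ := by
        rw [lintegral_add_right _ ((hψ.enorm.pow_const 2).const_mul _),
          lintegral_const_mul' _ _ (by finiteness), lintegral_const_mul' _ _ (by finiteness)]
        rfl
    _ ≤ ENNReal.ofReal ε * (128 * ENNReal.ofReal B * ENNReal.ofReal A * slobSq μ ψ +
        2 * ENNReal.ofReal A * ∫⁻ y, ‖ψ y‖ₑ ^ 2 ∂μ) := le_of_eq (by ring)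
    _ ≤ ENNReal.ofReal ε * ((128 * ENNReal.ofReal B * ENNReal.ofReal A + 2 * ENNReal.ofReal A) *
        slobSq μ ψ + (128 * ENNReal.ofReal B * ENNReal.ofReal A + 2 * ENNReal.ofReal A) *
        ∫⁻ y, ‖ψ y‖ₑ ^ 2 ∂μ) := by
        gcongr
        · exact le_self_add
        · exact le_add_self
    _ = _ := by ring

end Estimates

/-! ### The gradient of the extension by averages -/

section Gradient

variable {μ : Measure E3} [IsLocallyFiniteMeasure μ] {Γ : Set E3} {r c C ε : ℝ}

/-- Translation by y and the scaling identity for the sixth power. On the diagonal both sides vanish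
with the difference of ψ. -/
theorem lintegral_kernel_diff_le (y z : E3) (ψ : E3 → ℂ) :
    ∫⁻ x, ENNReal.ofReal (((‖x - y‖ + ‖y - z‖) ^ 6)⁻¹) * ‖ψ y - ψ z‖ₑ ^ 2 ≤
      (∫⁻ x : E3, ENNReal.ofReal (((‖x‖ + 1) ^ 6)⁻¹)) *
        ((edist z y ^ 3)⁻¹ * ‖ψ y - ψ z‖ₑ ^ 2) := by
  rcases eq_or_ne y z with rfl | hyz
  · simp
  · have hpos : 0 < ‖y - z‖ := norm_pos_iff.2 (sub_ne_zero.2 hyz)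
    rw [lintegral_mul_const' _ _ (by finiteness),
      lintegral_sub_right_eq_self (fun x => ENNReal.ofReal (((‖x‖ + ‖y - z‖) ^ 6)⁻¹)) y,
      lintegral_norm_add_inv_pow hpos, ENNReal.ofReal_inv_of_pos (by positivity),
      ENNReal.ofReal_pow hpos.le, ← dist_eq_norm, ← edist_dist, edist_comm]
    exact le_of_eq (by ring)

/-- The contribution of the zero order term to the gradient. -/
theorem IsSurfaceLike.lintegral_sq_avg_deriv_le [SFinite μ] (h : IsSurfaceLike μ Γ r c C)
    (B : ℝ) (hB : 0 ≤ B) :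
    ∃ K : ℝ≥0∞, K ≠ ⊤ ∧ ∀ ε : ℝ, 0 < ε → ∀ ψ : E3 → ℂ, Measurable ψ →
      ∫⁻ x, (avgWt μ h.r_pos ε x * (avgWt μ h.r_pos ε x * ∫⁻ y, powKer r ε 6 (x - y) *
        (ENNReal.ofReal (B * (‖x - y‖ + ε)⁻¹) * ‖ψ y‖ₑ) ∂μ)) ^ 2 ≤ K * ∫⁻ y, ‖ψ y‖ₑ ^ 2 ∂μ := by
  have hr := h.r_pos
  have hc := h.c_pos
  set A := 729 / c + (8 / r) ^ 4 with hA
  set D := 1 + (4 / r) ^ 6 * C with hD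
  have hA0 : 0 ≤ A := by positivity
  have hI : ∫⁻ z : E3, ballInd r z ≠ ⊤ := by
    have := lintegral_ballInd_sub_right r 0
    simp only [sub_zero] at this
    rw [this]
    exact measure_ball_lt_top.ne
  refine ⟨ENNReal.ofReal D * ENNReal.ofReal (A ^ 2 * B ^ 2) * ∫⁻ z : E3, ballInd r z,
    by finiteness, fun ε hε ψ hψ => ?_⟩
  have hmb := measurable_ballInd r
  have hpt : ∀ x, (avgWt μ h.r_pos ε x * (avgWt μ h.r_pos ε x * ∫⁻ y, powKer r ε 6 (x - y) *
        (ENNReal.ofReal (B * (‖x - y‖ + ε)⁻¹) * ‖ψ y‖ₑ) ∂μ)) ^ 2 ≤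
      ENNReal.ofReal D * ENNReal.ofReal (A ^ 2 * B ^ 2) *
        ∫⁻ y, ballInd r (x - y) * ‖ψ y‖ₑ ^ 2 ∂μ := by
    intro x
    have hκ := avgMass_nonneg (μ := μ) hr hε x
    have hH : Measurable fun y => ENNReal.ofReal (B * (‖x - y‖ + ε)⁻¹) * ‖ψ y‖ₑ := by fun_prop
    rw [mul_pow]
    calc _ ≤ avgWt μ h.r_pos ε x ^ 2 * _ := mul_le_mul_right (h.sq_avg_le hε x hH) _
      _ = ENNReal.ofReal D * ∫⁻ y, avgWt μ hr ε x ^ 2 * (avgWt μ hr ε x * powKer r ε 6 (x - y) *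
            (ENNReal.ofReal (B * (‖x - y‖ + ε)⁻¹) * ‖ψ y‖ₑ) ^ 2) ∂μ := by
          rw [lintegral_const_mul' _ _ (by rw [avgWt]; finiteness)]
          ring
      _ ≤ ENNReal.ofReal D * ∫⁻ y, ENNReal.ofReal (A ^ 2 * B ^ 2) *
            (ballInd r (x - y) * ‖ψ y‖ₑ ^ 2) ∂μ := by
          refine mul_le_mul_right (lintegral_mono_ae ?_) _
          filter_upwards [h.ae_mem] with y hy
          have hS : 0 < ‖x - y‖ + ε := by positivity
          -- Jensen leaves three weights. Two supply eight powers of ‖x - y‖ + ε, exactly cancelling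
          -- the kernel and the square of its extra singularity; the third is bounded by 1.
          have h1 : avgWt μ hr ε x ^ 2 * (ENNReal.ofReal (((‖x - y‖ + ε) ^ 6)⁻¹) *
              ENNReal.ofReal (B * (‖x - y‖ + ε)⁻¹) ^ 2) ≤ ENNReal.ofReal (A ^ 2 * B ^ 2) := by
            rw [avgWt, ← ENNReal.ofReal_pow (by positivity), ← ENNReal.ofReal_pow (by positivity),
              ← ENNReal.ofReal_mul (by positivity), ← ENNReal.ofReal_mul (by positivity)]
            refine ENNReal.ofReal_le_ofReal ?_
            calc _ ≤ (A * (‖x - y‖ + ε) ^ 4) ^ 2 * (((‖x - y‖ + ε) ^ 6)⁻¹ *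
                  (B * (‖x - y‖ + ε)⁻¹) ^ 2) := by
                  gcongr; exact h.inv_mass_le hε x hy
              _ = _ := by field_simp
          calc _ = avgWt μ hr ε x * (avgWt μ hr ε x ^ 2 * (ENNReal.ofReal (((‖x - y‖ + ε) ^ 6)⁻¹) *
              ENNReal.ofReal (B * (‖x - y‖ + ε)⁻¹) ^ 2)) * (ballInd r (x - y) * ‖ψ y‖ₑ ^ 2) := by
                rw [powKer]; ring
            _ ≤ 1 * ENNReal.ofReal (A ^ 2 * B ^ 2) * (ballInd r (x - y) * ‖ψ y‖ₑ ^ 2) :=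
                mul_le_mul_left (mul_le_mul' (avgWt_le_one hr hε x) h1) _
            _ = _ := by rw [one_mul]
      _ = _ := by
          rw [lintegral_const_mul' _ _ (by finiteness)]
          ring
  calc _ ≤ _ := lintegral_mono hpt
    _ = ENNReal.ofReal D * ENNReal.ofReal (A ^ 2 * B ^ 2) *
        ∫⁻ x, ∫⁻ y, ballInd r (x - y) * ‖ψ y‖ₑ ^ 2 ∂μ :=
        lintegral_const_mul' _ _ (by finiteness)
    _ = ENNReal.ofReal D * ENNReal.ofReal (A ^ 2 * B ^ 2) *
        ∫⁻ y, (∫⁻ x, ballInd r (x - y) * ‖ψ y‖ₑ ^ 2) ∂μ := by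
        rw [lintegral_lintegral_swap]
        exact ((hmb.comp (measurable_fst.sub measurable_snd)).mul
          ((hψ.comp measurable_snd).enorm.pow_const 2)).aemeasurable
    _ = ENNReal.ofReal D * ENNReal.ofReal (A ^ 2 * B ^ 2) *
        ∫⁻ y, (∫⁻ z : E3, ballInd r z) * ‖ψ y‖ₑ ^ 2 ∂μ := by
        congr 1
        refine lintegral_congr fun y => ?_
        rw [lintegral_mul_const' _ _ (by finiteness), lintegral_sub_right_eq_self (ballInd r) y]
    _ = _ := by rw [lintegral_const_mul' _ _ hI]; ring

/-- The contribution of the differences to the gradient. -/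
theorem IsSurfaceLike.lintegral_sq_avg_diff_le [SFinite μ] (h : IsSurfaceLike μ Γ r c C)
    (B : ℝ) (hB : 0 ≤ B) :
    ∃ K : ℝ≥0∞, K ≠ ⊤ ∧ ∀ ε : ℝ, 0 < ε → ∀ ψ : E3 → ℂ, Measurable ψ →
      ∫⁻ x, (avgWt μ h.r_pos ε x * ∫⁻ z, powKer r ε 6 (x - z) * (8 * (avgWt μ h.r_pos ε x *
        ∫⁻ y, powKer r ε 6 (x - y) *
          (ENNReal.ofReal (B * (‖x - y‖ + ε)⁻¹) * ‖ψ y - ψ z‖ₑ) ∂μ)) ∂μ) ^ 2 ≤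
        K * slobSq μ ψ := by
  have hr := h.r_pos
  have hc := h.c_pos
  set A := 729 / c + (8 / r) ^ 4 with hA
  set D := 1 + (4 / r) ^ 6 * C with hD
  have hA0 : 0 ≤ A := by positivity
  have hJ := lintegral_one_add_norm_lt_top.ne
  set J := ∫⁻ x : E3, ENNReal.ofReal (((‖x‖ + 1) ^ 6)⁻¹) with hJdef
  refine ⟨ENNReal.ofReal D ^ 2 * 64 * ENNReal.ofReal (64 * 64 * A ^ 2 * B ^ 2) * J,
    by finiteness, fun ε hε ψ hψ => ?_⟩
  have hmk := measurable_powKer r ε 6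
  have hpt : ∀ x, (avgWt μ h.r_pos ε x * ∫⁻ z, powKer r ε 6 (x - z) * (8 * (avgWt μ h.r_pos ε x *
        ∫⁻ y, powKer r ε 6 (x - y) *
          (ENNReal.ofReal (B * (‖x - y‖ + ε)⁻¹) * ‖ψ y - ψ z‖ₑ) ∂μ)) ∂μ) ^ 2 ≤
      ENNReal.ofReal D ^ 2 * 64 * ENNReal.ofReal (64 * 64 * A ^ 2 * B ^ 2) *
        ∫⁻ z, ∫⁻ y, ENNReal.ofReal (((‖x - y‖ + ‖y - z‖) ^ 6)⁻¹) * ‖ψ y - ψ z‖ₑ ^ 2 ∂μ ∂μ := by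
    intro x
    have hκ := avgMass_nonneg (μ := μ) hr hε x
    have hwt : avgWt μ hr ε x ≠ ⊤ := ENNReal.ofReal_ne_top
    have hH : ∀ z, Measurable fun y =>
        ENNReal.ofReal (B * (‖x - y‖ + ε)⁻¹) * ‖ψ y - ψ z‖ₑ := fun z => by fun_prop
    have hH2 : Measurable fun z => ∫⁻ y, powKer r ε 6 (x - y) *
        (ENNReal.ofReal (B * (‖x - y‖ + ε)⁻¹) * ‖ψ y - ψ z‖ₑ) ∂μ := by
      refine Measurable.lintegral_prod_right' (f := fun q : E3 × E3 => powKer r ε 6 (x - q.2) *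
        (ENNReal.ofReal (B * (‖x - q.2‖ + ε)⁻¹) * ‖ψ q.2 - ψ q.1‖ₑ)) ?_
      fun_prop
    -- Jensen is applied twice, to the average over z and then to the one over y, so that both
    -- weights survive to the first power.
    calc _ ≤ _ := h.sq_avg_le hε x ((hH2.const_mul _).const_mul 8)
      _ ≤ ENNReal.ofReal D * ∫⁻ z, avgWt μ hr ε x * powKer r ε 6 (x - z) * (64 *
            (ENNReal.ofReal D * ∫⁻ y, avgWt μ hr ε x * powKer r ε 6 (x - y) *
              (ENNReal.ofReal (B * (‖x - y‖ + ε)⁻¹) * ‖ψ y - ψ z‖ₑ) ^ 2 ∂μ)) ∂μ := by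
          refine mul_le_mul_right (lintegral_mono fun z => ?_) _
          refine mul_le_mul_right ?_ _
          rw [mul_pow]
          norm_num1
          exact mul_le_mul_right (h.sq_avg_le hε x (hH z)) _
      _ = ENNReal.ofReal D ^ 2 * 64 * ∫⁻ z, ∫⁻ y, avgWt μ hr ε x * powKer r ε 6 (x - z) *
            (avgWt μ hr ε x * powKer r ε 6 (x - y) *
              (ENNReal.ofReal (B * (‖x - y‖ + ε)⁻¹) * ‖ψ y - ψ z‖ₑ) ^ 2) ∂μ ∂μ := by
          rw [← lintegral_const_mul' _ _ (by finiteness), ← lintegral_const_mul' _ _ (by finiteness)]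
          refine lintegral_congr fun z => ?_
          rw [lintegral_const_mul' _ _ (ENNReal.mul_ne_top hwt
            (((powKer_le _ _ _ _).trans_lt ENNReal.ofReal_lt_top).ne))]
          ring
      _ ≤ ENNReal.ofReal D ^ 2 * 64 * ∫⁻ z, ∫⁻ y, ENNReal.ofReal (64 * 64 * A ^ 2 * B ^ 2) *
            (ENNReal.ofReal (((‖x - y‖ + ‖y - z‖) ^ 6)⁻¹) * ‖ψ y - ψ z‖ₑ ^ 2) ∂μ ∂μ := by
          refine mul_le_mul_right (lintegral_mono_ae ?_) _
          filter_upwards [h.ae_mem] with z hz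
          refine lintegral_mono_ae ?_
          filter_upwards [h.ae_mem] with y hy
          rcases eq_or_ne y z with rfl | hyz
          · simp
          have hpos : 0 < ‖y - z‖ := norm_pos_iff.2 (sub_ne_zero.2 hyz)
          have hSy : 0 < ‖x - y‖ + ε := by positivity
          have hSz : 0 < ‖x - z‖ + ε := by positivity
          have htri : ‖y - z‖ ≤ ‖x - y‖ + ‖x - z‖ := by
            calc ‖y - z‖ = ‖(x - z) - (x - y)‖ := by congr 1; abel
              _ ≤ _ := (norm_sub_le _ _).trans (add_comm _ _).le
          have h1 : avgWt μ hr ε x * ENNReal.ofReal (((‖x - z‖ + ε) ^ 6)⁻¹) *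
              (avgWt μ hr ε x * ENNReal.ofReal (((‖x - y‖ + ε) ^ 6)⁻¹) *
                ENNReal.ofReal (B * (‖x - y‖ + ε)⁻¹) ^ 2) ≤
              ENNReal.ofReal (64 * 64 * A ^ 2 * B ^ 2) *
                ENNReal.ofReal (((‖x - y‖ + ‖y - z‖) ^ 6)⁻¹) := by
            rw [avgWt, ← ENNReal.ofReal_pow (by positivity), ← ENNReal.ofReal_mul (by positivity),
              ← ENNReal.ofReal_mul (by positivity), ← ENNReal.ofReal_mul (by positivity),
              ← ENNReal.ofReal_mul (by positivity), ← ENNReal.ofReal_mul (by positivity)]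
            refine ENNReal.ofReal_le_ofReal ?_
            -- Both y and z lie on Γ, so the same weight is small relative to either distance. The
            -- triangle inequality then removes ε, and a second factor 64 = 2⁶ comes from halving
            -- the sum.
            have h2 := mul_le_of_le_fourth (κ := (1 + avgMass μ hr ε x)⁻¹) (by positivity) hSy hSz
              (h.inv_mass_le hε x hy) (h.inv_mass_le hε x hz)
            calc _ = B ^ 2 * ((1 + avgMass μ hr ε x)⁻¹ * ((‖x - z‖ + ε) ^ 6)⁻¹ *
                  ((1 + avgMass μ hr ε x)⁻¹ * ((‖x - y‖ + ε) ^ 6)⁻¹ *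
                    ((‖x - y‖ + ε)⁻¹) ^ 2)) := by ring
              _ ≤ B ^ 2 * (64 * A ^ 2 * ((‖x - y‖ + ε + (‖x - z‖ + ε)) ^ 6)⁻¹) := by gcongr
              _ ≤ B ^ 2 * (64 * A ^ 2 * (((‖x - y‖ + ‖y - z‖) / 2) ^ 6)⁻¹) := by
                  gcongr
                  linarith [norm_nonneg (x - z)]
              _ = _ := by rw [div_pow]; field_simp; norm_num; ring
          calc _ ≤ avgWt μ hr ε x * ENNReal.ofReal (((‖x - z‖ + ε) ^ 6)⁻¹) *
              (avgWt μ hr ε x * ENNReal.ofReal (((‖x - y‖ + ε) ^ 6)⁻¹) *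
              (ENNReal.ofReal (B * (‖x - y‖ + ε)⁻¹) * ‖ψ y - ψ z‖ₑ) ^ 2) := by
                gcongr <;> exact powKer_le _ _ _ _
            _ = _ * ‖ψ y - ψ z‖ₑ ^ 2 := by rw [mul_pow]; ring
            _ ≤ _ := mul_le_mul_left h1 _
            _ = _ := by ring
      _ = _ := by
          rw [mul_assoc _ (ENNReal.ofReal (64 * 64 * A ^ 2 * B ^ 2)),
            ← lintegral_const_mul' (ENNReal.ofReal (64 * 64 * A ^ 2 * B ^ 2)) _ (by finiteness)]
          congr 1
          refine lintegral_congr fun z => ?_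
          rw [lintegral_const_mul' _ _ (by finiteness)]
  calc _ ≤ _ := lintegral_mono hpt
    _ = ENNReal.ofReal D ^ 2 * 64 * ENNReal.ofReal (64 * 64 * A ^ 2 * B ^ 2) *
        ∫⁻ x, ∫⁻ z, ∫⁻ y, ENNReal.ofReal (((‖x - y‖ + ‖y - z‖) ^ 6)⁻¹) *
          ‖ψ y - ψ z‖ₑ ^ 2 ∂μ ∂μ := lintegral_const_mul' _ _ (by finiteness)
    _ = ENNReal.ofReal D ^ 2 * 64 * ENNReal.ofReal (64 * 64 * A ^ 2 * B ^ 2) *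
        ∫⁻ z, ∫⁻ y, (∫⁻ x, ENNReal.ofReal (((‖x - y‖ + ‖y - z‖) ^ 6)⁻¹) *
          ‖ψ y - ψ z‖ₑ ^ 2) ∂μ ∂μ := by
        congr 1
        rw [lintegral_lintegral_swap]
        · refine lintegral_congr fun z => ?_
          rw [lintegral_lintegral_swap]
          refine Measurable.aemeasurable ?_
          simp only [Function.uncurry_def]
          fun_prop
        · refine Measurable.aemeasurable ?_
          simp only [Function.uncurry_def]
          refine Measurable.lintegral_prod_right' (f := fun q : (E3 × E3) × E3 =>
            ENNReal.ofReal (((‖q.1.1 - q.2‖ + ‖q.2 - q.1.2‖) ^ 6)⁻¹) *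
              ‖ψ q.2 - ψ q.1.2‖ₑ ^ 2) ?_
          fun_prop
    _ ≤ ENNReal.ofReal D ^ 2 * 64 * ENNReal.ofReal (64 * 64 * A ^ 2 * B ^ 2) *
        ∫⁻ z, ∫⁻ y, J * ((edist z y ^ 3)⁻¹ * ‖ψ y - ψ z‖ₑ ^ 2) ∂μ ∂μ := by
        gcongr with z y
        exact lintegral_kernel_diff_le y z ψ
    _ = _ := by
        rw [slobSq, mul_assoc _ J, ← lintegral_const_mul' J _ hJ]
        congr 1
        refine lintegral_congr fun z => ?_
        rw [lintegral_const_mul' _ _ hJ]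

/-- The bound of the gradient. -/
theorem IsSurfaceLike.lintegral_pderiv_avgExt_le [SFinite μ] (h : IsSurfaceLike μ Γ r c C) :
    ∃ K : ℝ≥0∞, K ≠ ⊤ ∧ ∀ ε : ℝ, 0 < ε → ε ≤ 1 → ∀ ψ : E3 → ℂ, Measurable ψ →
      LocallyIntegrable ψ μ → ∀ i,
      ∫⁻ x, ‖pderiv i (avgExt μ h.r_pos ε ψ) x‖ₑ ^ 2 ≤
        K * (slobSq μ ψ + ∫⁻ y, ‖ψ y‖ₑ ^ 2 ∂μ) := by
  have hr := h.r_pos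
  obtain ⟨B, hB0, hB⟩ := exists_enorm_pderiv_avgKerC_le hr h.r_le
  obtain ⟨K₁, hK₁, h₁⟩ := h.lintegral_sq_avg_deriv_le B hB0
  obtain ⟨K₂, hK₂, h₂⟩ := h.lintegral_sq_avg_diff_le B hB0
  refine ⟨2 * K₁ + 2 * K₂, by finiteness, fun ε hε hε1 ψ hψ hψl i => ?_⟩
  have hmk := measurable_powKer r ε 6
  have b1 : ∀ x, ‖(1 + conv μ (fun _ => 1) (avgKerC hr ε) x)⁻¹ ^ 2 *
      conv μ ψ (pderiv i (avgKerC hr ε)) x‖ₑ ≤ avgWt μ hr ε x * (avgWt μ hr ε x *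
        ∫⁻ y, powKer r ε 6 (x - y) * (ENNReal.ofReal (B * (‖x - y‖ + ε)⁻¹) * ‖ψ y‖ₑ) ∂μ) := by
    intro x
    rw [enorm_mul, enorm_pow, enorm_inv_one_add_conv hr hε, sq, mul_assoc]
    refine mul_le_mul_right (mul_le_mul_right ?_ _) _
    refine (enorm_integral_le_lintegral_enorm _).trans (lintegral_mono fun y => ?_)
    rw [enorm_mul]
    refine (mul_le_mul_right (hB ε hε hε1 i (x - y)) _).trans (le_of_eq ?_)
    ring
  have b2 : ∀ x, ‖(1 + conv μ (fun _ => 1) (avgKerC hr ε) x)⁻¹ ^ 2 *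
      ∫ z, avgKerC hr ε (x - z) * ∫ y, (ψ y - ψ z) * pderiv i (avgKerC hr ε) (x - y) ∂μ ∂μ‖ₑ ≤
      avgWt μ hr ε x * ∫⁻ z, powKer r ε 6 (x - z) * (8 * (avgWt μ hr ε x *
        ∫⁻ y, powKer r ε 6 (x - y) *
          (ENNReal.ofReal (B * (‖x - y‖ + ε)⁻¹) * ‖ψ y - ψ z‖ₑ) ∂μ)) ∂μ := by
    intro x
    have hwt : avgWt μ hr ε x ≠ ⊤ := ENNReal.ofReal_ne_top
    rw [enorm_mul, enorm_pow, enorm_inv_one_add_conv hr hε, sq, mul_assoc]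
    refine mul_le_mul_right ?_ _
    refine (mul_le_mul_right (enorm_integral_le_lintegral_enorm _) _).trans ?_
    rw [← lintegral_const_mul' _ _ hwt]
    refine lintegral_mono fun z => ?_
    rw [enorm_mul]
    calc _ ≤ avgWt μ hr ε x * (8 * powKer r ε 6 (x - z) * ∫⁻ y, powKer r ε 6 (x - y) *
          (ENNReal.ofReal (B * (‖x - y‖ + ε)⁻¹) * ‖ψ y - ψ z‖ₑ) ∂μ) := by
          refine mul_le_mul_right (mul_le_mul' (enorm_avgKerC_le hr hε _) ?_) _
          refine (enorm_integral_le_lintegral_enorm _).trans (lintegral_mono fun y => ?_)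
          rw [enorm_mul]
          refine (mul_le_mul_right (hB ε hε hε1 i (x - y)) _).trans (le_of_eq ?_)
          ring
      _ = _ := by ring
  have hg := isTestFunction_avgKerC hr hε
  have hm : Measurable fun x => 2 * ‖(1 + conv μ (fun _ => 1) (avgKerC hr ε) x)⁻¹ ^ 2 *
      conv μ ψ (pderiv i (avgKerC hr ε)) x‖ₑ ^ 2 := by
    have h1 : Measurable (conv μ (fun _ => 1) (avgKerC hr ε)) :=
      (contDiff_conv (locallyIntegrable_const 1) hg).continuous.measurable
    have h2 : Measurable (conv μ ψ (pderiv i (avgKerC hr ε))) := by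
      rw [← funext fun x => pderiv_conv hψl hg x i]
      exact (((contDiff_conv hψl hg).continuous_fderiv (by simp)).clm_apply
        continuous_const).measurable
    fun_prop
  calc _ ≤ ∫⁻ x, (2 * ‖(1 + conv μ (fun _ => 1) (avgKerC hr ε) x)⁻¹ ^ 2 *
        conv μ ψ (pderiv i (avgKerC hr ε)) x‖ₑ ^ 2 +
        2 * ‖(1 + conv μ (fun _ => 1) (avgKerC hr ε) x)⁻¹ ^ 2 * ∫ z, avgKerC hr ε (x - z) *
          ∫ y, (ψ y - ψ z) * pderiv i (avgKerC hr ε) (x - y) ∂μ ∂μ‖ₑ ^ 2) :=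
        lintegral_mono fun x => by
          rw [pderiv_avgExt hr hε hψl]
          exact enorm_add_sq_le _ _
    _ ≤ 2 * (K₁ * ∫⁻ y, ‖ψ y‖ₑ ^ 2 ∂μ) + 2 * (K₂ * slobSq μ ψ) := by
        rw [lintegral_add_left hm, lintegral_const_mul' _ _ (by finiteness),
          lintegral_const_mul' _ _ (by finiteness)]
        gcongr
        · exact (lintegral_mono fun x => pow_le_pow_left' (b1 x) 2).trans (h₁ ε hε ψ hψ)
        · exact (lintegral_mono fun x => pow_le_pow_left' (b2 x) 2).trans (h₂ ε hε ψ hψ)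
    -- Adding the two cross terms lets the sum factor as one constant times the squared norm.
    _ ≤ (2 * K₁ * ∫⁻ y, ‖ψ y‖ₑ ^ 2 ∂μ + 2 * K₂ * slobSq μ ψ) +
        (2 * K₂ * ∫⁻ y, ‖ψ y‖ₑ ^ 2 ∂μ + 2 * K₁ * slobSq μ ψ) := by
        refine le_trans (le_of_eq ?_) le_self_add
        ring
    _ = _ := by ring

end Gradient

/-! ### The trace is onto `H^{1/2}(Γ)` -/

theorem slobSq_val {Ω : LipschitzDomain} (ψ : Hhalf Ω) :
    slobSq Ω.surf ψ.val = ‖ψ.1.snd‖ₑ ^ 2 := by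
  have hm : Measurable ψ.val := (Lp.stronglyMeasurable ψ.val).measurable
  have hd : Measurable fun z : E3 × E3 => (edist z.1 z.2 ^ 3)⁻¹ :=
    (measurable_edist.pow_const 3).inv
  have hf : Measurable fun z : E3 × E3 => ‖ψ.val z.1 - ψ.val z.2‖ₑ ^ 2 :=
    ((hm.comp measurable_fst).sub (hm.comp measurable_snd)).enorm.pow_const 2
  have h1 : ‖ψ.1.snd‖ₑ ^ 2 = ∫⁻ q, ‖ψ.1.snd q‖ₑ ^ 2 ∂Ω.slobMeasure := by
    rw [← eLpNorm_two_sq, Lp.enorm_def]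
  have h2 : ∀ᵐ q ∂Ω.slobMeasure, ‖ψ.1.snd q‖ₑ ^ 2 = ‖ψ.val q.1 - ψ.val q.2‖ₑ ^ 2 :=
    Eventually.mono (show ∀ᵐ q ∂Ω.slobMeasure, ψ.1.snd q = ψ.val q.1 - ψ.val q.2 from ψ.2)
      fun q hq => by rw [hq]
  rw [h1, lintegral_congr_ae h2, LipschitzDomain.slobMeasure,
    lintegral_withDensity_eq_lintegral_mul _ hd hf, lintegral_prod _ (hd.mul hf).aemeasurable,
    slobSq]
  refine lintegral_congr fun z => lintegral_congr fun y => ?_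
  rw [enorm_sub_rev]
  rfl

theorem Hhalf.norm_sq_eq {Ω : LipschitzDomain} (ψ : Hhalf Ω) :
    ‖ψ‖ ^ 2 = ‖ψ.val‖ ^ 2 + ‖ψ.1.snd‖ ^ 2 :=
  WithLp.prod_norm_sq_eq_of_L2 _

theorem slobSq_add_val {Ω : LipschitzDomain} (ψ : Hhalf Ω) :
    slobSq Ω.surf ψ.val + ∫⁻ y, ‖ψ.val y‖ₑ ^ 2 ∂Ω.surf = ‖ψ‖ₑ ^ 2 := by
  rw [slobSq_val, ← eLpNorm_two_sq, ← Lp.enorm_def, ← ofReal_norm, ← ofReal_norm, ← ofReal_norm,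
    ← ENNReal.ofReal_pow (norm_nonneg _), ← ENNReal.ofReal_pow (norm_nonneg _),
    ← ENNReal.ofReal_pow (norm_nonneg _), ← ENNReal.ofReal_add (by positivity) (by positivity),
    ψ.norm_sq_eq, add_comm]

theorem norm_toLp_le_of_lintegral_le {α F : Type*} [MeasurableSpace α] [NormedAddCommGroup F]
    {μ : Measure α} {f : α → ℂ} (hf : MemLp f 2 μ) {K : ℝ≥0∞} (hK : K ≠ ⊤) {a : F}
    (h : ∫⁻ x, ‖f x‖ₑ ^ 2 ∂μ ≤ K * ‖a‖ₑ ^ 2) : ‖hf.toLp f‖ ≤ (1 + K).toReal * ‖a‖ := by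
  have h1 : eLpNorm f 2 μ ≤ (1 + K) * ‖a‖ₑ := by
    refine eLpNorm_two_le_of_sq_le (h.trans ?_)
    rw [mul_pow]
    gcongr
    calc K ≤ 1 + K := le_add_self
      _ = (1 + K) * 1 := (mul_one _).symm
      _ ≤ (1 + K) * (1 + K) := by gcongr; exact le_self_add
      _ = _ := (sq _).symm
  rw [Lp.norm_toLp]
  have h2 := ENNReal.toReal_mono (by finiteness) h1
  rwa [ENNReal.toReal_mul, toReal_enorm] at h2

/-- A bounded linear map attains on a closed subspace limits of images of bounded sequences. -/
theorem exists_mem_eq_of_bounded_of_tendsto {E F : Type*} [NormedAddCommGroup E]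
    [InnerProductSpace ℂ E] [CompleteSpace E] [NormedAddCommGroup F] [InnerProductSpace ℂ F]
    [CompleteSpace F] {S : Submodule ℂ E} (hS : IsClosed (S : Set E)) (P : E →L[ℂ] F) {x : ℕ → E}
    (hxS : ∀ n, x n ∈ S) {R : ℝ} (hx : ∀ n, ‖x n‖ ≤ R) {y : F}
    (hy : Tendsto (fun n => P (x n)) atTop (𝓝 y)) : ∃ w ∈ S, ‖w‖ ≤ R ∧ P w = y := by
  have : CompleteSpace S := hS.completeSpace_coe
  obtain ⟨w, hw, hPw⟩ := exists_eq_of_bounded_of_tendsto (P.comp S.subtypeL)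
    (x := fun n => ⟨x n, hxS n⟩) hx hy
  exact ⟨w, w.2, hw, hPw⟩

/-- Every `ψ ∈ H^{1/2}(Γ)` is the trace of an `H¹` function with a corresponding bound. -/
theorem exists_hasTrace (Ω : LipschitzDomain) :
    ∃ C : ℝ, 0 ≤ C ∧ ∀ ψ : Hhalf Ω, ∃ w : H1, HasTrace Ω w ψ.val ∧ ‖w‖ ≤ C * ‖ψ‖ := by
  have := Ω.isLocallyFinite_surf
  obtain ⟨r, c, C, hs⟩ := Ω.exists_isSurfaceLike
  have hr := hs.r_pos
  obtain ⟨K₁, hK₁, h₁⟩ := hs.lintegral_avgExt_le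
  obtain ⟨K₂, hK₂, h₂⟩ := hs.lintegral_pderiv_avgExt_le
  obtain ⟨K₃, hK₃, h₃⟩ := hs.lintegral_avgExt_sub_le
  obtain ⟨D, hD0, hD⟩ := exists_bound_pderiv_cutoff
  let K₄ : ℝ≥0∞ := 2 * K₂ + 2 * (ENNReal.ofReal D ^ 2 * K₁)
  have hK₄ : K₄ ≠ ⊤ := by simp only [K₄]; finiteness
  let K₅ : ℝ≥0∞ := 2 * K₃ + 2
  have hK₅ : K₅ ≠ ⊤ := by simp only [K₅]; finiteness
  let R : ℝ := (1 + K₁).toReal + 3 * (1 + K₄).toReal + (1 + K₅).toReal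
  refine ⟨R, by positivity, fun ψ => ?_⟩
  have hψm : Measurable ψ.val := (Lp.stronglyMeasurable ψ.val).measurable
  have hψl : LocallyIntegrable ψ.val Ω.surf := (Lp.memLp ψ.val).locallyIntegrable (by norm_num)
  have hS := slobSq_add_val ψ
  have hL : ∫⁻ y, ‖ψ.val y‖ₑ ^ 2 ∂Ω.surf ≤ ‖ψ‖ₑ ^ 2 := hS ▸ le_add_self
  let ε : ℕ → ℝ := fun n => 1 / ((n : ℝ) + 1)
  have hε : ∀ n, 0 < ε n := fun n => by positivity
  have hε1 : ∀ n, ε n ≤ 1 := fun n => by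
    simp only [ε]
    rw [div_le_one (by positivity)]
    linarith [n.cast_nonneg (α := ℝ)]
  let u : ℕ → E3 → ℂ := fun n => avgExt Ω.surf hr (ε n) ψ.val
  have hu : ∀ n, ContDiff ℝ ∞ (u n) := fun n => contDiff_avgExt hr (hε n) hψl
  -- If Γ is unbounded the averages need not have compact support; the cutoff radius grows while ε
  -- tends to zero.
  let φ : ℕ → E3 → ℂ := fun n x => cutoff n x * u n x
  have hφ : ∀ n, IsTestFunction (φ n) := fun n => (isTestFunction_cutoff n).mul_contDiff (hu n)
  have hcut : ∀ n x, ‖cutoff n x‖ₑ ≤ 1 := fun n x => by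
    rw [← ofReal_norm]
    exact ENNReal.ofReal_le_one.2 (norm_cutoff_le n x)
  have b1 : ∀ n, ‖(hφ n).toH1.val‖ ≤ (1 + K₁).toReal * ‖ψ‖ := fun n => by
    refine norm_toLp_le_of_lintegral_le (hφ n).memLp hK₁ ?_
    calc _ ≤ ∫⁻ x, ‖u n x‖ₑ ^ 2 := by
          refine lintegral_mono fun x => ?_
          simp only [φ, enorm_mul]
          refine pow_le_pow_left' ?_ 2
          exact (mul_le_mul_left (hcut n x) _).trans (one_mul _).le
      _ ≤ _ := (h₁ _ (hε n) _ hψm).trans (mul_le_mul_right hL _)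
  have b2 : ∀ n i, ‖(hφ n).toH1.grad i‖ ≤ (1 + K₄).toReal * ‖ψ‖ := fun n i => by
    refine norm_toLp_le_of_lintegral_le ((hφ n).memLp_pderiv i) hK₄ ?_
    have hum : Measurable fun x => 2 * ‖pderiv i (u n) x‖ₑ ^ 2 := by
      have : Measurable (pderiv i (u n)) := (((hu n).continuous_fderiv (by simp)).clm_apply
        continuous_const).measurable
      fun_prop
    calc _ ≤ ∫⁻ x, (2 * ‖pderiv i (u n) x‖ₑ ^ 2 + 2 * (ENNReal.ofReal D ^ 2 * ‖u n x‖ₑ ^ 2)) := by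
          refine lintegral_mono fun x => ?_
          simp only [φ]
          rw [pderiv_mul ((isTestFunction_cutoff n).differentiableAt x)
            ((hu n).differentiable (by simp) x)]
          refine (enorm_add_sq_le _ _).trans ?_
          rw [enorm_mul, enorm_mul, ← mul_pow]
          gcongr
          · exact (mul_le_mul_left (hcut n x) _).trans (one_mul _).le
          · rw [← ofReal_norm]
            refine ENNReal.ofReal_le_ofReal ((hD n i x).trans (mul_le_of_le_one_right hD0 ?_))
            exact inv_le_one_of_one_le₀ (by linarith [n.cast_nonneg (α := ℝ)])
      _ = 2 * (∫⁻ x, ‖pderiv i (u n) x‖ₑ ^ 2) +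
          2 * (ENNReal.ofReal D ^ 2 * ∫⁻ x, ‖u n x‖ₑ ^ 2) := by
          rw [lintegral_add_left hum, lintegral_const_mul' _ _ (by finiteness),
            lintegral_const_mul' _ _ (by finiteness), lintegral_const_mul' _ _ (by finiteness)]
      _ ≤ 2 * (K₂ * ‖ψ‖ₑ ^ 2) + 2 * (ENNReal.ofReal D ^ 2 * (K₁ * ‖ψ‖ₑ ^ 2)) := by
          gcongr
          · exact (h₂ _ (hε n) (hε1 n) _ hψm hψl i).trans (hS ▸ le_rfl)
          · exact (h₁ _ (hε n) _ hψm).trans (mul_le_mul_right hL _)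
      _ = _ := by ring
  have e3 : ∀ n, ∫⁻ x, ‖u n x - ψ.val x‖ₑ ^ 2 ∂Ω.surf ≤
      ENNReal.ofReal (ε n) * (K₃ * ‖ψ‖ₑ ^ 2) := fun n =>
    (h₃ _ (hε n) (hε1 n) _ hψm hψl).trans (hS ▸ le_rfl)
  have b3 : ∀ n, ‖((hφ n).memLp_surf Ω).toLp (φ n)‖ ≤ (1 + K₅).toReal * ‖ψ‖ := fun n => by
    refine norm_toLp_le_of_lintegral_le ((hφ n).memLp_surf Ω) hK₅ ?_
    calc _ ≤ ∫⁻ x, (2 * ‖u n x - ψ.val x‖ₑ ^ 2 + 2 * ‖ψ.val x‖ₑ ^ 2) ∂Ω.surf := by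
          refine lintegral_mono fun x => ?_
          have e : u n x = (u n x - ψ.val x) + ψ.val x := by ring
          refine le_trans ?_ (enorm_add_sq_le _ _)
          rw [← e]
          simp only [φ, enorm_mul]
          refine pow_le_pow_left' ?_ 2
          exact (mul_le_mul_left (hcut n x) _).trans (one_mul _).le
      _ = 2 * (∫⁻ x, ‖u n x - ψ.val x‖ₑ ^ 2 ∂Ω.surf) + 2 * ∫⁻ x, ‖ψ.val x‖ₑ ^ 2 ∂Ω.surf := by
          rw [lintegral_add_right _ ((hψm.enorm.pow_const 2).const_mul 2),
            lintegral_const_mul' _ _ (by finiteness), lintegral_const_mul' _ _ (by finiteness)]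
      _ ≤ 2 * (1 * (K₃ * ‖ψ‖ₑ ^ 2)) + 2 * ‖ψ‖ₑ ^ 2 := by
          gcongr
          refine (e3 n).trans ?_
          gcongr
          exact ENNReal.ofReal_le_one.2 (hε1 n)
      _ = _ := by ring
  have hlim : Tendsto (fun n => ((hφ n).memLp_surf Ω).toLp (φ n)) atTop (𝓝 ψ.val) := by
    rw [tendsto_toLp_iff]
    have l1 : Tendsto (fun n => eLpNorm (fun x => cutoff n x * (u n x - ψ.val x)) 2 Ω.surf)
        atTop (𝓝 0) := by
      refine tendsto_of_sq_tendsto_zero ?_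
      have l2 : Tendsto (fun n => ENNReal.ofReal (ε n) * (K₃ * ‖ψ‖ₑ ^ 2)) atTop (𝓝 0) := by
        have l3 := ENNReal.tendsto_ofReal (tendsto_one_div_add_atTop_nhds_zero_nat (𝕜 := ℝ))
        have l4 := ENNReal.Tendsto.mul_const (b := K₃ * ‖ψ‖ₑ ^ 2) l3
          (Or.inr (by finiteness))
        simpa only [ENNReal.ofReal_zero, zero_mul] using l4
      refine tendsto_of_tendsto_of_tendsto_of_le_of_le tendsto_const_nhds l2 (fun _ => zero_le)
        fun n => ?_
      simp only [eLpNorm_two_sq]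
      refine le_trans (lintegral_mono fun x => ?_) (e3 n)
      rw [enorm_mul]
      refine pow_le_pow_left' ?_ 2
      exact (mul_le_mul_left (hcut n x) _).trans (one_mul _).le
    have l5 : Tendsto (fun n => eLpNorm (fun x => (cutoff n x - 1) * ψ.val x) 2 Ω.surf)
        atTop (𝓝 0) := by
      refine tendsto_eLpNorm_mul_zero (Lp.memLp ψ.val) (C := 2)
        (fun n => (isTestFunction_cutoff n).smooth.continuous.sub continuous_const)
        (fun n x => ?_) tendsto_cutoff
      refine (norm_sub_le _ _).trans ?_
      rw [norm_one]
      linarith [norm_cutoff_le n x]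
    have l6 := l1.add l5
    rw [add_zero] at l6
    refine tendsto_of_tendsto_of_tendsto_of_le_of_le tendsto_const_nhds l6 (fun _ => zero_le)
      fun n => ?_
    have e : (fun x => φ n x - ψ.val x) = (fun x => cutoff n x * (u n x - ψ.val x)) +
        fun x => (cutoff n x - 1) * ψ.val x := by
      funext x
      simp only [φ, Pi.add_apply]
      ring
    simp only [e]
    have hc := (isTestFunction_cutoff n).smooth.continuous.measurable
    have hc2 := (hu n).continuous.measurable
    refine eLpNorm_add_le ?_ ?_ (by norm_num)
    · exact (hc.mul (hc2.sub hψm)).aestronglyMeasurable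
    · exact ((hc.sub_const 1).mul hψm).aestronglyMeasurable
  let G := (traceGraph Ω).topologicalClosure
  let x : ℕ → WithLp 2 (H1 × Lp ℂ 2 Ω.surf) := fun n =>
    WithLp.toLp 2 ((hφ n).toH1, ((hφ n).memLp_surf Ω).toLp (φ n))
  have hxG : ∀ n, x n ∈ G := fun n => Submodule.le_topologicalClosure _ ⟨φ n, hφ n, rfl⟩
  have hx : ∀ n, ‖x n‖ ≤ R * ‖ψ‖ := fun n => by
    have h1 : ‖x n‖ ≤ ‖(hφ n).toH1‖ + ‖((hφ n).memLp_surf Ω).toLp (φ n)‖ := by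
      have h2 : ‖x n‖ ^ 2 = ‖(hφ n).toH1‖ ^ 2 + ‖((hφ n).memLp_surf Ω).toLp (φ n)‖ ^ 2 :=
        WithLp.prod_norm_sq_eq_of_L2 _
      refine abs_le_of_sq_le_sq' ?_ (by positivity) |>.2
      nlinarith [mul_nonneg (norm_nonneg (hφ n).toH1)
        (norm_nonneg (((hφ n).memLp_surf Ω).toLp (φ n)))]
    have h3 : ∑ i, ‖(hφ n).toH1.grad i‖ ≤ ∑ _i : Fin 3, (1 + K₄).toReal * ‖ψ‖ :=
      Finset.sum_le_sum fun i _ => b2 n i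
    rw [Finset.sum_const, Finset.card_univ, Fintype.card_fin, nsmul_eq_mul] at h3
    push_cast at h3
    calc _ ≤ _ := h1
      _ ≤ (1 + K₁).toReal * ‖ψ‖ + 3 * ((1 + K₄).toReal * ‖ψ‖) + (1 + K₅).toReal * ‖ψ‖ := by
          linarith [b1 n, b3 n, (hφ n).toH1.norm_le_sum]
      _ = _ := by ring
  -- The H¹ components are only bounded, but the boundary components converge to ψ; the closed graph
  -- of the trace contains a weak limit with this boundary value and the same bound.
  obtain ⟨w, hwG, hw, hPw⟩ := exists_mem_eq_of_bounded_of_tendsto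
    (Submodule.isClosed_topologicalClosure (traceGraph Ω))
    (WithLp.sndL 2 ℂ H1 (Lp ℂ 2 Ω.surf)) hxG hx hlim
  refine ⟨w.fst, hasTrace_iff.2 ?_, (WithLp.norm_fst_le _ _).trans hw⟩
  rw [← hPw]
  exact hwG

/-! ### The normal trace -/

theorem isNormalTrace_iff {Ω : LipschitzDomain} {m : Hdiv} {ℓ : HmHalf Ω} :
    IsNormalTrace Ω m ℓ ↔ ∀ (w : H1) (ψ : Hhalf Ω), HasTrace Ω w ψ.val →
      ℓ ψ = domPair Ω.isOpen.measurableSet m w := by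
  simp only [IsNormalTrace, domPair_eq_integral]

/-- Any choice of bounded extensions works: the chosen map ψ ↦ w need not be linear, yet the pairing
is, because it depends on the trace only. Uniqueness holds as every ψ is a trace. -/
theorem existsUnique_isNormalTrace (Ω : LipschitzDomain) (m : Hdiv) :
    ∃! ℓ : HmHalf Ω, IsNormalTrace Ω m ℓ := by
  obtain ⟨C, hC0, hC⟩ := exists_hasTrace Ω
  choose w hw hwb using hC
  let L : Hhalf Ω →ₗ[ℂ] ℂ :=
    { toFun := fun ψ => domPair Ω.isOpen.measurableSet m (w ψ)
      map_add' := fun ψ χ => by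
        rw [← domPair_add_right]
        exact HasTrace.domPair_eq (hw (ψ + χ)) ((hw ψ).add (hw χ)) m
      map_smul' := fun c ψ => by
        rw [RingHom.id_apply, smul_eq_mul, ← domPair_smul_right]
        exact HasTrace.domPair_eq (hw (c • ψ)) ((hw ψ).smul c) m }
  refine ⟨L.mkContinuous (4 * ‖m‖ * C) fun ψ => ?_, ?_, ?_⟩
  · refine (norm_domPair_le _ m (w ψ)).trans ?_
    rw [mul_assoc _ C]
    gcongr
    exact hwb ψ
  · exact isNormalTrace_iff.2 fun v ψ hv => HasTrace.domPair_eq (hw ψ) hv m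
  · intro ℓ hℓ
    ext ψ
    exact isNormalTrace_iff.1 hℓ (w ψ) ψ (hw ψ)

theorem isNormalTrace_normalTrace (Ω : LipschitzDomain) (m : Hdiv) :
    IsNormalTrace Ω m (normalTrace Ω m) := by
  have h := (existsUnique_isNormalTrace Ω m).exists
  rw [normalTrace, dif_pos h]
  exact h.choose_spec

theorem normalTrace_eq {Ω : LipschitzDomain} {w : H1} {ψ : Hhalf Ω} (h : HasTrace Ω w ψ.val)
    (m : Hdiv) : normalTrace Ω m ψ = domPair Ω.isOpen.measurableSet m w :=
  isNormalTrace_iff.1 (isNormalTrace_normalTrace Ω m) w ψ h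

theorem exists_norm_normalTrace_le (Ω : LipschitzDomain) :
    ∃ C : ℝ, 0 ≤ C ∧ ∀ (ψ : Hhalf Ω) (m : Hdiv), ‖normalTrace Ω m ψ‖ ≤ C * ‖ψ‖ * ‖m‖ := by
  obtain ⟨C, hC0, hC⟩ := exists_hasTrace Ω
  refine ⟨4 * C, by positivity, fun ψ m => ?_⟩
  obtain ⟨w, hw, hwb⟩ := hC ψ
  rw [normalTrace_eq hw]
  calc _ ≤ _ := norm_domPair_le _ m w
    _ ≤ 4 * ‖m‖ * (C * ‖ψ‖) := by gcongr
    _ = _ := by ring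

/-! ### Operators on Hilbert spaces -/

section Hilbert

variable {H : Type*} [NormedAddCommGroup H] [InnerProductSpace ℂ H] [CompleteSpace H]

theorem isUnit_of_coercive (T : H →L[ℂ] H) {a : ℝ} (ha : 0 < a)
    (h : ∀ x, a * ‖x‖ ^ 2 ≤ (inner ℂ x (T x)).re) : IsUnit T := by
  refine ContinuousLinearMap.isUnit_of_forall_le_norm_inner_map T (c := ⟨a, ha.le⟩) ha fun x => ?_
  rw [norm_inner_symm, mul_comm]
  exact (h x).trans ((Complex.re_le_norm _))

/-- An operator that is bounded below and whose adjoint is injective is onto. -/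
theorem surjective_of_bounded_below (T : H →L[ℂ] H) {K : ℝ} (hK : ∀ x, ‖x‖ ≤ K * ‖T x‖)
    (hT : ∀ y, (∀ x, inner ℂ y (T x) = 0) → y = 0) : Function.Surjective T := by
  have hanti : AntilipschitzWith K.toNNReal T :=
    ContinuousLinearMap.antilipschitz_of_bound T fun x =>
      (hK x).trans (mul_le_mul_of_nonneg_right (Real.le_coe_toNNReal K) (norm_nonneg _))
  have hcl : IsClosed (T.range : Set H) := by
    rw [LinearMap.coe_range]
    exact hanti.isClosed_range T.uniformContinuous
  have : CompleteSpace T.range := hcl.completeSpace_coe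
  rw [← ContinuousLinearMap.coe_coe, ← LinearMap.range_eq_top,
    ← Submodule.orthogonal_eq_bot_iff, Submodule.eq_bot_iff]
  intro y hy
  refine hT y fun x => ?_
  rw [← inner_conj_symm, (Submodule.mem_orthogonal _ y).1 hy (T x) ⟨x, rfl⟩, map_zero]

end Hilbert

/-! ### Multiplication by the coefficients -/

theorem inner_L2vec (g h : L2vec) : inner ℂ g h = ∑ i, inner ℂ (g i) (h i) :=
  PiLp.inner_apply g h

theorem norm_L2vec_le (g : L2vec) : ‖g‖ ≤ ∑ i, ‖g i‖ := by
  refine abs_le_of_sq_le_sq' ?_ (by positivity) |>.2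
  rw [PiLp.norm_sq_eq_of_L2]
  exact Finset.sum_sq_le_sq_sum_of_nonneg fun i _ => norm_nonneg _

theorem inner_L2vec_eq_integral (g h : L2vec) :
    inner ℂ g h = ∫ x, ∑ i, h i x * conj (g i x) := by
  rw [integral_finsetSum, inner_L2vec]
  · refine Finset.sum_congr rfl fun i _ => ?_
    rw [L2.inner_def]
    simp
  · intro i _
    simpa using L2.integrable_inner (𝕜 := ℂ) (g i) (h i)

theorem re_inner_L2_nonneg {f g : L2} (h : ∀ᵐ x, 0 ≤ (g x * conj (f x)).re) :
    0 ≤ (inner ℂ f g).re := by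
  rw [L2.inner_def]
  have hi := L2.integrable_inner (𝕜 := ℂ) f g
  have h1 := integral_re hi
  simp only [RCLike.re_eq_complex_re, RCLike.inner_apply] at h1 ⊢
  rw [← h1]
  exact integral_nonneg_of_ae h

theorem re_inner_L2vec_nonneg {g h : L2vec} (hp : ∀ᵐ x, 0 ≤ (∑ i, h i x * conj (g i x)).re) :
    0 ≤ (inner ℂ g h).re := by
  rw [inner_L2vec_eq_integral]
  have hi : Integrable fun x => ∑ i, h i x * conj (g i x) :=
    integrable_finsetSum _ fun i _ => by
      simpa using L2.integrable_inner (𝕜 := ℂ) (g i) (h i)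
  have h1 := integral_re hi
  simp only [RCLike.re_eq_complex_re] at h1
  rw [← h1]
  exact integral_nonneg_of_ae hp

theorem inner_mulOp_comm {a b : E3 → ℂ} {C D : ℝ} (ha : IsMultiplier a C) (hb : IsMultiplier b D)
    (hab : ∀ᵐ x, conj (a x) = b x) (f g : L2) :
    inner ℂ (mulOp ha f) g = inner ℂ f (mulOp hb g) := by
  rw [L2.inner_def, L2.inner_def]
  refine integral_congr_ae ?_
  filter_upwards [coeFn_mulOp ha f, coeFn_mulOp hb g, hab] with x h1 h2 h3
  rw [h1, h2, ← h3]
  simp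
  ring

section Coefficients

variable {lam Lam : ℝ} {A : E3 → Matrix (Fin 3) (Fin 3) ℝ} {p : E3 → ℝ}

theorem IsScalarCoeff.lam_le (h : IsScalarCoeff lam Lam p) : lam ≤ Lam := by
  obtain ⟨x, h1, h2⟩ := (h.lower.and h.upper).exists
  exact h1.trans h2

theorem IsScalarCoeff.isMultiplier (h : IsScalarCoeff lam Lam p) (hlam : 0 < lam) :
    IsMultiplier (fun x => (p x : ℂ)) Lam where
  aesm := (Complex.measurable_ofReal.comp_aemeasurable h.aemeasurable).aestronglyMeasurable
  bound := by
    filter_upwards [h.lower, h.upper] with x h1 h2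
    rwa [Complex.norm_real, Real.norm_of_nonneg (hlam.le.trans h1)]

/-- The form bounds control entries by polarization: the upper bound at eᵢ ± eₖ, together with
positive diagonal entries, bounds the entry (i, k) in absolute value. -/
theorem IsMatrixCoeff.isMultiplier (h : IsMatrixCoeff lam Lam A) (hlam : 0 < lam) (i k : Fin 3) :
    IsMultiplier (fun x => (A x i k : ℂ)) Lam where
  aesm := (Complex.measurable_ofReal.comp_aemeasurable (h.aemeasurable i k)).aestronglyMeasurable
  bound := by
    filter_upwards [h.symm, h.lower, h.upper] with x hs hl hu
    rw [Complex.norm_real, Real.norm_eq_abs]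
    have e : ∀ a b : ℝ, (A x).mulVec (Pi.single i a + Pi.single k b) ⬝ᵥ
        (Pi.single i a + Pi.single k b) =
        a * a * A x i i + b * b * A x k k + 2 * a * b * A x i k := by
      intro a b
      have hik : A x k i = A x i k := hs.apply i k
      simp [Matrix.mulVec_add, dotProduct_add, Matrix.mulVec_single]
      rw [hik]
      ring
    have d : ∀ j, lam ≤ A x j j := fun j => by
      have := hl (Pi.single j 1)
      simpa [Matrix.mulVec_single] using this
    by_cases hik : i = k
    · subst hik
      have hu1 := hu (Pi.single i 1)
      simp [Matrix.mulVec_single] at hu1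
      rw [abs_of_nonneg (hlam.le.trans (d i))]
      exact hu1
    · have n : ∀ a b : ℝ, (Pi.single i a + Pi.single k b : Fin 3 → ℝ) ⬝ᵥ
          (Pi.single i a + Pi.single k b) = a * a + b * b := by
        intro a b
        simp [dotProduct_add, hik, Ne.symm hik]
      have h1 := hu (Pi.single i 1 + Pi.single k 1)
      have h2 := hu (Pi.single i 1 + Pi.single k (-1))
      rw [e, n] at h1 h2
      rw [abs_le]
      constructor <;> linarith [d i, d k]

/-- Multiplication by the matrix field on `L²(ℝ³)³`. -/
def matOp (h : IsMatrixCoeff lam Lam A) (hlam : 0 < lam) : L2vec →L[ℂ] L2vec :=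
  ((PiLp.continuousLinearEquiv 2 ℂ (fun _ : Fin 3 => L2)).symm : (Fin 3 → L2) →L[ℂ] L2vec).comp
    (ContinuousLinearMap.pi fun i => ∑ k, (mulOp (h.isMultiplier hlam i k)).comp
      (PiLp.proj 2 (fun _ : Fin 3 => L2) k))

variable (h : IsMatrixCoeff lam Lam A) (hlam : 0 < lam)

theorem matOp_apply (g : L2vec) (i : Fin 3) :
    matOp h hlam g i = ∑ k, mulOp (h.isMultiplier hlam i k) (g k) := by
  simp [matOp]

theorem coeFn_matOp (g : L2vec) (i : Fin 3) :
    ∀ᵐ x, matOp h hlam g i x = ∑ k, (A x i k : ℂ) * g k x := by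
  rw [matOp_apply]
  have h1 : ∀ᵐ x, ∀ k, mulOp (h.isMultiplier hlam i k) (g k) x = (A x i k : ℂ) * g k x :=
    ae_all_iff.2 fun k => coeFn_mulOp _ _
  filter_upwards [h1, Lp.coeFn_finsetSum Finset.univ
    fun k => mulOp (h.isMultiplier hlam i k) (g k)] with x h2 h3
  rw [h3, Finset.sum_apply]
  exact Finset.sum_congr rfl fun k _ => h2 k

/-- A crude entrywise count, 9 = 3 · 3; only the dependence on Λ is of interest. -/
theorem norm_matOp_le (g : L2vec) : ‖matOp h hlam g‖ ≤ 9 * Lam * ‖g‖ := by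
  have h1 : ∀ i, ‖matOp h hlam g i‖ ≤ 3 * Lam * ‖g‖ := fun i => by
    rw [matOp_apply]
    calc _ ≤ ∑ _k : Fin 3, Lam * ‖g‖ := by
          refine (norm_sum_le _ _).trans (Finset.sum_le_sum fun k _ => ?_)
          obtain ⟨x, hx⟩ := (h.isMultiplier hlam i k).bound.exists
          have hL : 0 ≤ Lam := (norm_nonneg _).trans hx
          exact (norm_mulOp_le _ _).trans (mul_le_mul_of_nonneg_left (PiLp.norm_apply_le g k) hL)
      _ = _ := by simp; ring
  calc _ ≤ ∑ i, ‖matOp h hlam g i‖ := norm_L2vec_le _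
    _ ≤ ∑ _i : Fin 3, 3 * Lam * ‖g‖ := Finset.sum_le_sum fun i _ => h1 i
    _ = _ := by simp; ring

theorem inner_matOp_comm (f g : L2vec) :
    inner ℂ (matOp h hlam f) g = inner ℂ f (matOp h hlam g) := by
  simp only [inner_L2vec, matOp_apply, sum_inner, inner_sum]
  rw [Finset.sum_comm]
  refine Finset.sum_congr rfl fun k _ => Finset.sum_congr rfl fun i _ => ?_
  refine inner_mulOp_comm _ _ ?_ _ _
  filter_upwards [h.symm] with x hx
  rw [Complex.conj_ofReal, hx.apply]

theorem le_re_inner_matOp (g : L2vec) : lam * ‖g‖ ^ 2 ≤ (inner ℂ g (matOp h hlam g)).re := by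
  have h1 : 0 ≤ (inner ℂ g (matOp h hlam g - (lam : ℂ) • g)).re := by
    refine re_inner_L2vec_nonneg ?_
    have h2 : ∀ᵐ x, ∀ i, (matOp h hlam g - (lam : ℂ) • g) i x =
        (∑ k, (A x i k : ℂ) * g k x) - lam * g i x := by
      refine ae_all_iff.2 fun i => ?_
      filter_upwards [coeFn_matOp h hlam g i, Lp.coeFn_sub (matOp h hlam g i) ((lam : ℂ) • g i),
        Lp.coeFn_smul (lam : ℂ) (g i)] with x h3 h4 h5
      refine (h4.trans ?_)
      rw [Pi.sub_apply, h3, h5]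
      rfl
    filter_upwards [h2, h.lower] with x h3 hl
    -- The real part of the complex quadratic form of a real matrix is the sum of its real forms at
    -- the real and imaginary parts.
    have ha := hl fun i => (g i x).re
    have hb := hl fun i => (g i x).im
    simp only [h3]
    simp [Matrix.mulVec, dotProduct, Fin.sum_univ_three] at ha hb ⊢
    nlinarith [ha, hb]
  rw [inner_sub_right, inner_smul_right, inner_self_eq_norm_sq_to_K] at h1
  have h6 : ((lam : ℂ) * ((‖g‖ : ℂ)) ^ 2).re = lam * ‖g‖ ^ 2 := by
    norm_cast
  rw [Complex.sub_re] at h1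
  simp only [RCLike.ofReal_eq_complex_ofReal] at h1
  linarith

theorem im_inner_matOp (g : L2vec) : (inner ℂ g (matOp h hlam g)).im = 0 := by
  have h1 := inner_conj_symm (𝕜 := ℂ) g (matOp h hlam g)
  rw [inner_matOp_comm] at h1
  exact Complex.conj_eq_iff_im.1 h1

theorem isUnit_matOp : IsUnit (matOp h hlam) :=
  isUnit_of_coercive _ hlam (le_re_inner_matOp h hlam)

/-- Multiplication by the inverse of the matrix field. -/
def matInvOp : L2vec →L[ℂ] L2vec := ((isUnit_matOp h hlam).unit⁻¹ : (L2vec →L[ℂ] L2vec)ˣ)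

theorem matOp_matInvOp (g : L2vec) : matOp h hlam (matInvOp h hlam g) = g :=
  congrArg (fun T : L2vec →L[ℂ] L2vec => T g) (isUnit_matOp h hlam).mul_val_inv

theorem inner_matInvOp_comm (f g : L2vec) :
    inner ℂ (matInvOp h hlam f) g = inner ℂ f (matInvOp h hlam g) := by
  conv_lhs => rw [← matOp_matInvOp h hlam g]
  rw [← inner_matOp_comm, matOp_matInvOp]

theorem IsMatrixCoeff.ae_isUnit_det (h : IsMatrixCoeff lam Lam A) (hlam : 0 < lam) :
    ∀ᵐ x, IsUnit (A x).det := by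
  filter_upwards [h.lower] with x hl
  rw [isUnit_iff_ne_zero]
  intro h0
  obtain ⟨v, hv, hv0⟩ := Matrix.exists_mulVec_eq_zero_iff.2 h0
  have h1 := hl v
  rw [hv0, zero_dotProduct] at h1
  have h2 : 0 < v ⬝ᵥ v := lt_of_le_of_ne (by
    simpa [dotProduct] using Finset.sum_nonneg fun i _ => mul_self_nonneg (v i))
    (fun h3 => hv (dotProduct_self_eq_zero.1 h3.symm))
  nlinarith

/-- The inverse operator comes from coercivity, without discussing measurability of x ↦ A(x)⁻¹. It
agrees with pointwise inversion, as seen by applying A(x)⁻¹ to the identity g = A (A⁻¹ g). -/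
theorem coeFn_matInvOp (g : L2vec) :
    ∀ᵐ x, ∀ i, ∑ k, ((A x)⁻¹ i k : ℂ) * g k x = matInvOp h hlam g i x := by
  have h1 : ∀ᵐ x, ∀ i, g i x = ∑ k, (A x i k : ℂ) * matInvOp h hlam g k x := by
    refine ae_all_iff.2 fun i => ?_
    have := coeFn_matOp h hlam (matInvOp h hlam g) i
    rwa [matOp_matInvOp] at this
  filter_upwards [h1, h.ae_isUnit_det hlam] with x h2 hdet i
  have h3 : (A x)⁻¹ * A x = 1 := Matrix.nonsing_inv_mul _ hdet
  simp only [h2, Finset.mul_sum]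
  rw [Finset.sum_comm]
  have h4 : ∀ l, ∑ k, ((A x)⁻¹ i k : ℂ) * ((A x k l : ℂ) * matInvOp h hlam g l x) =
      ((1 : Matrix (Fin 3) (Fin 3) ℝ) i l : ℂ) * matInvOp h hlam g l x := by
    intro l
    rw [← h3, Matrix.mul_apply, Complex.ofReal_sum, Finset.sum_mul]
    refine Finset.sum_congr rfl fun k _ => ?_
    push_cast
    ring
  simp only [h4]
  rw [Finset.sum_eq_single i (fun l _ hl => by simp [Ne.symm hl]) (by simp)]
  simp

/-- Multiplication by the scalar coefficient. -/
abbrev scalOp (hp : IsScalarCoeff lam Lam p) (hlam : 0 < lam) : L2 →L[ℂ] L2 :=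
  mulOp (hp.isMultiplier hlam)

theorem inner_scalOp_comm (hp : IsScalarCoeff lam Lam p) (f g : L2) :
    inner ℂ (scalOp hp hlam f) g = inner ℂ f (scalOp hp hlam g) :=
  inner_mulOp_comm _ _ (Eventually.of_forall fun _ => Complex.conj_ofReal _) f g

theorem im_inner_scalOp (hp : IsScalarCoeff lam Lam p) (f : L2) :
    (inner ℂ f (scalOp hp hlam f)).im = 0 := by
  have h1 := inner_conj_symm (𝕜 := ℂ) f (scalOp hp hlam f)
  rw [inner_scalOp_comm] at h1
  exact Complex.conj_eq_iff_im.1 h1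

theorem le_re_inner_scalOp (hp : IsScalarCoeff lam Lam p) (f : L2) :
    lam * ‖f‖ ^ 2 ≤ (inner ℂ f (scalOp hp hlam f)).re := by
  have h1 : 0 ≤ (inner ℂ f (scalOp hp hlam f - (lam : ℂ) • f)).re := by
    refine re_inner_L2_nonneg ?_
    filter_upwards [coeFn_mulOp (hp.isMultiplier hlam) f, hp.lower,
      Lp.coeFn_sub (scalOp hp hlam f) ((lam : ℂ) • f), Lp.coeFn_smul (lam : ℂ) f] with x h2 h3 h4 h5
    rw [h4, Pi.sub_apply, h2, h5, Pi.smul_apply, smul_eq_mul, ← sub_mul, mul_assoc,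
      Complex.mul_conj, ← Complex.ofReal_sub, ← Complex.ofReal_mul, Complex.ofReal_re]
    exact mul_nonneg (sub_nonneg.2 h3) (Complex.normSq_nonneg _)
  rw [inner_sub_right, inner_smul_right, inner_self_eq_norm_sq_to_K] at h1
  have h6 : ((lam : ℂ) * ((‖f‖ : ℂ)) ^ 2).re = lam * ‖f‖ ^ 2 := by
    norm_cast
  rw [Complex.sub_re] at h1
  simp only [RCLike.ofReal_eq_complex_ofReal] at h1
  linarith

end Coefficients

/-! ### Duality between the weak gradient and the weak divergence -/

/-- The field `φ eᵢ` of a test function `φ`. -/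
def IsTestFunction.toHdiv {φ : E3 → ℂ} (hφ : IsTestFunction φ) (i : Fin 3) : Hdiv :=
  ⟨WithLp.toLp 2 (WithLp.toLp 2 (Pi.single i (hφ.memLp.toLp φ)), (hφ.memLp_pderiv i).toLp _), by
    refine isWeakDiv_iff.2 fun χ hχ => ?_
    rw [Finset.sum_eq_single i (fun k _ hk => by simp [hk]) (by simp)]
    change inner ℂ _ ((Pi.single i (hφ.memLp.toLp φ) : Fin 3 → L2) i) =
      -inner ℂ _ ((hφ.memLp_pderiv i).toLp _)
    rw [Pi.single_eq_same, ← integral_mul_toLp_eq_inner, ← integral_mul_toLp_eq_inner]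
    have h := hφ.integral_mul_pderiv hχ i
    rw [integral_congr_ae ((hφ.memLp.coeFn_toLp).mono fun x hx =>
      congrArg (· * pderiv i χ x) hx), h]
    congr 1
    exact (integral_congr_ae (((hφ.memLp_pderiv i).coeFn_toLp).mono fun x hx =>
      congrArg (· * χ x) hx)).symm⟩

/-- A converse to integration by parts: fields φ eᵢ with φ a test function already lie in 𝐇(ℝ³,
div), and testing with their conjugates gives the definition of the weak gradient. This is how H¹
regularity is read off from the first mixed equation. -/
theorem isWeakGrad_of_orthogonal {v : L2} {w : L2vec}
    (h : ∀ m : Hdiv, inner ℂ m.field w + inner ℂ m.div v = 0) : IsWeakGrad v w := by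
  intro φ hφ i
  have h1 := h (hφ.toHdiv i).conj
  have h2 : inner ℂ (hφ.toHdiv i).conj.field w = inner ℂ (star (hφ.memLp.toLp φ)) (w i) := by
    rw [inner_L2vec, Finset.sum_eq_single i]
    · change inner ℂ (star ((Pi.single i (hφ.memLp.toLp φ) : Fin 3 → L2) i)) _ = _
      rw [Pi.single_eq_same]
    · intro k _ hk
      change inner ℂ (star ((Pi.single i (hφ.memLp.toLp φ) : Fin 3 → L2) k)) _ = _
      have h0 : star (0 : L2) = 0 := norm_eq_zero.1 (by rw [norm_star_L2, norm_zero])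
      rw [Pi.single_eq_of_ne hk]
      exact (congrArg (fun f => inner ℂ f (w k)) h0).trans (inner_zero_left _)
    · simp
  rw [h2] at h1
  rw [integral_mul_toLp_eq_inner _ (hφ.memLp_pderiv i), integral_mul_toLp_eq_inner _ hφ.memLp]
  exact eq_neg_of_add_eq_zero_right h1

theorem inner_star_star (f g : L2) : inner ℂ (star f) (star g) = inner ℂ g f := by
  rw [← integral_mul_eq_inner, integral_mul_star_eq_inner]

theorem inner_grad_field (v : H1) (j : Hdiv) :
    inner ℂ v.grad j.field = -inner ℂ v.val j.div := by
  have h := j.integration_by_parts v.conj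
  have h1 : ∀ i, v.conj.grad i = star (v.grad i) := fun _ => rfl
  have h2 : v.conj.val = star v.val := rfl
  simp only [h1, h2, inner_star_star] at h
  rw [inner_L2vec, h]

/-! ### The operator of the mixed problem -/

section Saddle

variable {M V K : Type*} [NormedAddCommGroup M] [InnerProductSpace ℂ M] [CompleteSpace M]
  [NormedAddCommGroup V] [InnerProductSpace ℂ V] [CompleteSpace V]
  [NormedAddCommGroup K] [InnerProductSpace ℂ K] [CompleteSpace K]

/-- The operator representing a saddle point form. -/
theorem exists_saddleOp (J : M →L[ℂ] V) (D U : M →L[ℂ] K) (Q : V →L[ℂ] V) (P : K →L[ℂ] K)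
    (c : ℂ) : ∃ T : M → M,
    (∀ z t, inner ℂ t (T z) = -inner ℂ (J t) (Q (J z)) - inner ℂ (D t) (U z) -
      inner ℂ (U t) (D z) + c * inner ℂ (U t) (P (U z))) ∧
    (∀ y z, T (y - z) = T y - T z) ∧ (∃ C, ∀ z, ‖T z‖ ≤ C * ‖z‖) ∧
    ∀ C : ℝ, (∀ z, ‖z‖ ≤ C * ‖T z‖) → (∀ y, (∀ z, inner ℂ y (T z) = 0) → y = 0) →
      Function.Surjective T := by
  let T : M →L[ℂ] M := -(J.adjoint.comp (Q.comp J)) - D.adjoint.comp U - U.adjoint.comp D +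
    c • U.adjoint.comp (P.comp U)
  refine ⟨T, fun z t => ?_, fun y z => map_sub T y z, ⟨‖T‖, T.le_opNorm⟩,
    fun C h h' => surjective_of_bounded_below T h h'⟩
  have e : T z = -J.adjoint (Q (J z)) - D.adjoint (U z) - U.adjoint (D z) +
    c • U.adjoint (P (U z)) := rfl
  rw [e, inner_add_right, inner_sub_right, inner_sub_right, inner_neg_right, inner_smul_right]
  simp only [ContinuousLinearMap.adjoint_inner_right]

theorem exists_inner_eq (J : M →L[ℂ] V) (D : M →L[ℂ] K) (g : V) (f : K) :
    ∃ y : M, ∀ t, inner ℂ t y = inner ℂ (J t) g + inner ℂ (D t) f :=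
  ⟨J.adjoint g + D.adjoint f, fun t => by
    rw [inner_add_right, ContinuousLinearMap.adjoint_inner_right,
      ContinuousLinearMap.adjoint_inner_right]⟩

end Saddle

/-- The vector field as a bounded operator. -/
def mixedField : MixedSpace →L[ℂ] L2vec :=
  ((WithLp.fstL 2 ℂ L2vec L2).comp HdivSub.subtypeL).comp (WithLp.fstL 2 ℂ Hdiv L2)

/-- The divergence as a bounded operator. -/
def mixedDiv : MixedSpace →L[ℂ] L2 :=
  ((WithLp.sndL 2 ℂ L2vec L2).comp HdivSub.subtypeL).comp (WithLp.fstL 2 ℂ Hdiv L2)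

/-- The scalar component as a bounded operator. -/
def mixedVal : MixedSpace →L[ℂ] L2 := WithLp.sndL 2 ℂ Hdiv L2

/-- The inner product of `𝐇(ℝ³, div) × L²(ℝ³)`. -/
def mixedInner (t y : MixedSpace) : ℂ :=
  inner ℂ t.fst.field y.fst.field + inner ℂ t.fst.div y.fst.div + inner ℂ t.snd y.snd

theorem inner_eq_mixedInner (t y : MixedSpace) :
    @inner ℂ MixedSpace InnerProductSpace.toInner t y = mixedInner t y := rfl

theorem norm_mixedInner_le (t y : MixedSpace) : ‖mixedInner t y‖ ≤ ‖t‖ * ‖y‖ :=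
  norm_inner_le_norm (𝕜 := ℂ) (E := MixedSpace) t y

theorem norm_mixedInner_self (t : MixedSpace) : ‖mixedInner t t‖ = ‖t‖ ^ 2 := by
  have h : mixedInner t t = (‖t‖ : ℂ) ^ 2 :=
    inner_self_eq_norm_sq_to_K (𝕜 := ℂ) (E := MixedSpace) t
  rw [h, norm_pow, Complex.norm_real, norm_norm]

theorem mixedInner_conj_symm (t y : MixedSpace) : conj (mixedInner y t) = mixedInner t y :=
  inner_conj_symm (𝕜 := ℂ) (E := MixedSpace) t y

theorem norm_mixedSpace_le (z : MixedSpace) :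
    ‖z‖ ≤ ‖z.fst.field‖ + ‖z.fst.div‖ + ‖z.snd‖ := by
  have h1 : ‖z‖ ^ 2 = ‖z.fst‖ ^ 2 + ‖z.snd‖ ^ 2 := WithLp.prod_norm_sq_eq_of_L2 _
  have h2 := z.fst.norm_sq_eq
  refine abs_le_of_sq_le_sq' ?_ (by positivity) |>.2
  nlinarith [norm_nonneg z.fst.field, norm_nonneg z.fst.div, norm_nonneg z.snd,
    mul_nonneg (norm_nonneg z.fst.field) (norm_nonneg z.fst.div),
    mul_nonneg (norm_nonneg z.fst.field) (norm_nonneg z.snd),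
    mul_nonneg (norm_nonneg z.fst.div) (norm_nonneg z.snd)]

theorem exists_mixedInner_eq (g : L2vec) (f : L2) :
    ∃ y : MixedSpace, ∀ t, mixedInner t y = inner ℂ t.fst.field g + inner ℂ t.fst.div f := by
  obtain ⟨y, hy⟩ := exists_inner_eq (M := MixedSpace) (V := L2vec) (K := L2)
    mixedField mixedDiv g f
  refine ⟨y, fun t => ?_⟩
  rw [← inner_eq_mixedInner]
  exact hy t

section Mixed

variable {lam Lam : ℝ} {A : E3 → Matrix (Fin 3) (Fin 3) ℝ} {p : E3 → ℝ}
  (hA : IsMatrixCoeff lam Lam A) (hp : IsScalarCoeff lam Lam p) (hlam : 0 < lam)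

theorem exists_mixedOp (s : ℂ) : ∃ T : MixedSpace → MixedSpace,
    (∀ z t, mixedInner t (T z) =
      -inner ℂ t.fst.field (matInvOp hA hlam z.fst.field) - inner ℂ t.fst.div z.snd -
        inner ℂ t.snd z.fst.div + s ^ 2 * inner ℂ t.snd (scalOp hp hlam z.snd)) ∧
    (∀ y z, T (y - z) = T y - T z) ∧ (∃ C, ∀ z, ‖T z‖ ≤ C * ‖z‖) ∧
    ∀ C : ℝ, (∀ z, ‖z‖ ≤ C * ‖T z‖) → (∀ y, (∀ z, mixedInner y (T z) = 0) → y = 0) →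
      Function.Surjective T := by
  obtain ⟨T, h1, h2, h3, h4⟩ := exists_saddleOp (M := MixedSpace) (V := L2vec) (K := L2)
    mixedField mixedDiv mixedVal (matInvOp hA hlam) (scalOp hp hlam) (s ^ 2)
  refine ⟨T, fun z t => ?_, h2, h3, fun C h h' => h4 C h fun y hy => h' y fun z => ?_⟩
  · rw [← inner_eq_mixedInner]
    exact h1 z t
  · rw [← inner_eq_mixedInner]
    exact hy z

/-- The operator representing the form of the mixed problem. -/
def mixedOp (s : ℂ) : MixedSpace → MixedSpace := (exists_mixedOp hA hp hlam s).choose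

theorem mixedInner_mixedOp (s : ℂ) (z t : MixedSpace) : mixedInner t (mixedOp hA hp hlam s z) =
    -inner ℂ t.fst.field (matInvOp hA hlam z.fst.field) - inner ℂ t.fst.div z.snd -
      inner ℂ t.snd z.fst.div + s ^ 2 * inner ℂ t.snd (scalOp hp hlam z.snd) :=
  (exists_mixedOp hA hp hlam s).choose_spec.1 z t

theorem exists_norm_mixedOp_le (s : ℂ) : ∃ C, ∀ z, ‖mixedOp hA hp hlam s z‖ ≤ C * ‖z‖ :=
  (exists_mixedOp hA hp hlam s).choose_spec.2.2.1

theorem surjective_mixedOp (s : ℂ) {C : ℝ} (h : ∀ z, ‖z‖ ≤ C * ‖mixedOp hA hp hlam s z‖)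
    (h' : ∀ y, (∀ z, mixedInner y (mixedOp hA hp hlam s z) = 0) → y = 0) :
    Function.Surjective (mixedOp hA hp hlam s) :=
  (exists_mixedOp hA hp hlam s).choose_spec.2.2.2 C h h'

theorem invPairing_conj (j m : Hdiv) :
    invPairing A j m.conj = inner ℂ m.field (matInvOp hA hlam j.field) := by
  rw [inner_L2vec_eq_integral, invPairing]
  refine integral_congr_ae ?_
  have h1 : ∀ᵐ x, ∀ i, m.conj.field i x = conj (m.field i x) :=
    ae_all_iff.2 fun i => Lp.coeFn_star (m.field i)
  filter_upwards [coeFn_matInvOp hA hlam j.field, h1] with x h2 h3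
  simp only [h2, h3]

theorem integral_mul_conj_div (u : L2) (m : Hdiv) :
    ∫ x, u x * m.conj.div x = inner ℂ m.div u :=
  integral_mul_star_eq_inner u m.div

theorem integral_scal_mul_star (u q : L2) :
    ∫ x, (p x : ℂ) * u x * (star q) x = inner ℂ q (scalOp hp hlam u) := by
  rw [← integral_mul_star_eq_inner]
  refine integral_congr_ae ?_
  filter_upwards [coeFn_mulOp (hp.isMultiplier hlam) u] with x hx
  rw [hx]

theorem mixedForm_eq (s : ℂ) (z t : MixedSpace) :
    mixedForm A p s z t = mixedInner t (mixedOp hA hp hlam s z) := by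
  rw [mixedInner_mixedOp, mixedForm, invPairing_conj hA hlam, integral_mul_conj_div,
    integral_mul_star_eq_inner, integral_scal_mul_star hp hlam]

/-- A⁻¹ and p are self-adjoint and conjugation exchanges the two coupling terms, so passing to the
adjoint only replaces s by its conjugate. The stability bound at conj s thus also gives injectivity
of the adjoint. -/
theorem mixedInner_mixedOp_comm (s : ℂ) (z t : MixedSpace) :
    mixedInner t (mixedOp hA hp hlam s z) = mixedInner (mixedOp hA hp hlam (conj s) t) z := by
  rw [← mixedInner_conj_symm (mixedOp hA hp hlam (conj s) t) z, mixedInner_mixedOp,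
    mixedInner_mixedOp]
  simp only [map_add, map_sub, map_neg, map_mul, map_pow, Complex.conj_conj, inner_conj_symm]
  rw [inner_matInvOp_comm, inner_scalOp_comm]
  ring

/-- The scalar component of a solution of the mixed equations, up to the defect, is an `H¹`
function. -/
theorem exists_H1_of_mixedOp (s : ℂ) (z : MixedSpace) :
    ∃ v : H1, v.val = z.snd + (mixedOp hA hp hlam s z).fst.div ∧
      z.fst.field = matOp hA hlam (v.grad - (mixedOp hA hp hlam s z).fst.field) ∧
      z.fst.div = s ^ 2 • scalOp hp hlam z.snd - (mixedOp hA hp hlam s z).snd := by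
  set y := mixedOp hA hp hlam s z with hy
  have h0 := mixedInner_mixedOp hA hp hlam s z
  rw [← hy] at h0
  -- Testing with q = 0 says that A⁻¹ j plus the field of y, paired with m, cancels u plus the
  -- divergence of y, paired with div m.
  have hw : IsWeakGrad (z.snd + y.fst.div) (matInvOp hA hlam z.fst.field + y.fst.field) := by
    refine isWeakGrad_of_orthogonal fun m => ?_
    have h1 := h0 (WithLp.toLp 2 (m, 0))
    rw [mixedInner] at h1
    simp only [WithLp.toLp_fst, WithLp.toLp_snd, inner_zero_left] at h1
    rw [inner_add_right, inner_add_right]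
    linear_combination h1
  refine ⟨⟨WithLp.toLp 2 (_, _), hw⟩, rfl, ?_, ?_⟩
  · change _ = matOp hA hlam (matInvOp hA hlam z.fst.field + y.fst.field - y.fst.field)
    rw [add_sub_cancel_right, matOp_matInvOp]
  · refine ext_inner_left ℂ fun q => ?_
    have h1 := h0 (WithLp.toLp 2 (0, q))
    rw [mixedInner] at h1
    have e1 : (0 : Hdiv).field = 0 := rfl
    have e2 : (0 : Hdiv).div = 0 := rfl
    simp only [WithLp.toLp_fst, WithLp.toLp_snd, inner_zero_left, e1, e2] at h1
    rw [inner_sub_right, inner_smul_right]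
    linear_combination h1

/-- The energy estimate. -/
theorem energy_le {s : ℂ} {v : H1} {j : Hdiv} {g₀ : L2vec} {g₁ f : L2}
    (hj : j.field = matOp hA hlam (v.grad - g₀))
    (hd : j.div = s ^ 2 • scalOp hp hlam (v.val - g₁) - f) (hs : 0 < s.re) :
    s.re * (lam * (‖v.grad‖ ^ 2 + ‖s‖ ^ 2 * ‖v.val‖ ^ 2)) ≤
      ‖s‖ * (9 * Lam * ‖v.grad‖ * ‖g₀‖ + ‖s‖ ^ 2 * Lam * ‖v.val‖ * ‖g₁‖ + ‖v.val‖ * ‖f‖) := by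
  have h := inner_grad_field v j
  rw [hj, hd, map_sub, map_sub, inner_sub_right, inner_sub_right, inner_smul_right,
    inner_sub_right] at h
  set X := inner ℂ v.grad (matOp hA hlam v.grad) with hX
  set Y := inner ℂ v.val (scalOp hp hlam v.val) with hY
  have hX1 : lam * ‖v.grad‖ ^ 2 ≤ X.re := le_re_inner_matOp hA hlam v.grad
  have hY1 : lam * ‖v.val‖ ^ 2 ≤ Y.re := le_re_inner_scalOp hlam hp v.val
  have hX2 : X.im = 0 := im_inner_matOp hA hlam v.grad
  have hY2 : Y.im = 0 := im_inner_scalOp hlam hp v.val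
  -- Since conj s · s² = |s|² s and X, Y are real, multiplication by conj s gives both terms a real
  -- part proportional to Re s > 0.
  have h1 : conj s * (X + s ^ 2 * Y) = conj s * (inner ℂ v.grad (matOp hA hlam g₀) +
      s ^ 2 * inner ℂ v.val (scalOp hp hlam g₁) + inner ℂ v.val f) := by
    congr 1
    linear_combination h
  have h2 : (conj s * (X + s ^ 2 * Y)).re = s.re * (X.re + ‖s‖ ^ 2 * Y.re) := by
    have e : conj s * (X + s ^ 2 * Y) = conj s * X + (s * conj s) * (s * Y) := by ring
    rw [e, Complex.mul_conj, Complex.normSq_eq_norm_sq]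
    simp only [Complex.add_re, Complex.mul_re, Complex.conj_re, Complex.conj_im,
      Complex.ofReal_re, Complex.ofReal_im, hX2, hY2]
    ring
  calc _ ≤ s.re * (X.re + ‖s‖ ^ 2 * Y.re) := by
        refine mul_le_mul_of_nonneg_left ?_ hs.le
        nlinarith [mul_le_mul_of_nonneg_left hY1 (sq_nonneg ‖s‖)]
    _ = (conj s * (X + s ^ 2 * Y)).re := h2.symm
    _ ≤ ‖conj s * (X + s ^ 2 * Y)‖ := Complex.re_le_norm _
    _ = ‖s‖ * ‖inner ℂ v.grad (matOp hA hlam g₀) +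
      s ^ 2 * inner ℂ v.val (scalOp hp hlam g₁) + inner ℂ v.val f‖ := by
        rw [h1, norm_mul, Complex.norm_conj]
    _ ≤ _ := by
        refine mul_le_mul_of_nonneg_left ?_ (norm_nonneg _)
        refine (norm_add₃_le).trans ?_
        have n1 : ‖inner ℂ v.grad (matOp hA hlam g₀)‖ ≤ 9 * Lam * ‖v.grad‖ * ‖g₀‖ := by
          refine (norm_inner_le_norm _ _).trans ?_
          nlinarith [mul_le_mul_of_nonneg_left (norm_matOp_le hA hlam g₀) (norm_nonneg v.grad)]
        have n2 : ‖s ^ 2 * inner ℂ v.val (scalOp hp hlam g₁)‖ ≤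
            ‖s‖ ^ 2 * Lam * ‖v.val‖ * ‖g₁‖ := by
          rw [norm_mul, norm_pow, mul_assoc, mul_assoc]
          refine mul_le_mul_of_nonneg_left ?_ (by positivity)
          refine (norm_inner_le_norm _ _).trans ?_
          nlinarith [mul_le_mul_of_nonneg_left (norm_mulOp_le (hp.isMultiplier hlam) g₁)
            (norm_nonneg v.val)]
        exact add_le_add (add_le_add n1 n2) (norm_inner_le_norm _ _)

end Mixed

/-! ### Stability constants -/

/-- Here σ = Re s, S = |s|, a = ‖∇v‖, b = ‖v‖, and N is the size of the data. The left side controls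
(a + S b)² / 2 and the right side is linear in a + S b, so one factor cancels. Lower powers of S are
raised to S² using S ≥ s₀, which explains the three summands of c₂. -/
theorem energy_bound {σ S a b N c₁ c₂ L lam s₀ : ℝ} (hσ : 0 < σ) (hs₀ : 0 < s₀) (hS : s₀ ≤ S)
    (hlam : 0 < lam) (ha : 0 ≤ a) (hb : 0 ≤ b) (hN : 0 ≤ N) (hc₁ : 0 ≤ c₁) (hL : 0 ≤ L)
    (h : σ * (lam * (a ^ 2 + S ^ 2 * b ^ 2)) ≤
      S * (c₁ * a * N + S ^ 2 * L * b * N + b * N))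
    (hc₂ : c₂ = 1 / s₀ ^ 2 + c₁ / s₀ + L) :
    a + S * b ≤ 2 / lam * c₂ * (S ^ 2 / σ) * N := by
  have hSp : 0 < S := hs₀.trans_le hS
  have hc₂0 : 0 ≤ c₂ := by rw [hc₂]; positivity
  rcases (show 0 ≤ a + S * b by positivity).eq_or_lt with hE | hE
  · rw [← hE]; positivity
  have h1 : S * (c₁ * a * N + S ^ 2 * L * b * N + b * N) ≤ N * (a + S * b) * (S ^ 2 * c₂) := by
    have e1 : S * c₁ ≤ S ^ 2 * (c₁ / s₀) := by
      rw [← mul_div_assoc, le_div_iff₀ hs₀]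
      nlinarith [mul_le_mul_of_nonneg_left hS (mul_nonneg hSp.le hc₁)]
    have e2 : 1 ≤ S ^ 2 * (1 / s₀ ^ 2) := by
      rw [mul_one_div, le_div_iff₀ (by positivity), one_mul]
      exact pow_le_pow_left₀ hs₀.le hS 2
    calc _ = N * (a * (S * c₁) + S * b * (S ^ 2 * L) + S * b * 1) := by ring
      _ ≤ N * (a * (S ^ 2 * (c₁ / s₀)) + S * b * (S ^ 2 * L) +
          S * b * (S ^ 2 * (1 / s₀ ^ 2))) := by gcongr
      _ ≤ N * ((a + S * b) * (S ^ 2 * (c₁ / s₀)) + (a + S * b) * (S ^ 2 * L) +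
          (a + S * b) * (S ^ 2 * (1 / s₀ ^ 2))) := by
          have : 0 ≤ S * b := by positivity
          gcongr <;> linarith
      _ = _ := by rw [hc₂]; ring
  have h2 : σ * lam / 2 * (a + S * b) * (a + S * b) ≤ N * (S ^ 2 * c₂) * (a + S * b) := by
    have : (a + S * b) ^ 2 ≤ 2 * (a ^ 2 + S ^ 2 * b ^ 2) := by
      nlinarith [sq_nonneg (a - S * b)]
    nlinarith [mul_le_mul_of_nonneg_left this (mul_pos hσ hlam).le]
  have h3 := le_of_mul_le_mul_right h2 hE
  have e : 2 / lam * c₂ * (S ^ 2 / σ) * N = (N * (S ^ 2 * c₂)) / (σ * lam / 2) := by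
    field_simp
  rw [e, le_div_iff₀ (by positivity)]
  linarith

/-- The stability constant of the mixed problem. -/
def mixedConst (lam L s₀ : ℝ) : ℝ :=
  2 / lam * (1 / s₀ ^ 2 + 9 * L / s₀ + L) ^ 2 + ((2 + 9 * L) / s₀ ^ 2 + L)

/-- The stability constant of the ultra-weak problem. -/
def ultraWeakConst (lam L s₀ : ℝ) : ℝ := 2 / lam * (1 / s₀ ^ 2 + 1 / s₀ + L) + 1

/-- The variables x, y, w bound the norms of j, div j, u. The energy gives S² / σ, and the
divergence term S² b = S · (S b) costs one further power of S; the direct data terms fit because S²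
≤ S³ / σ. -/
theorem mixed_bound {σ S a b N L lam s₀ x y w : ℝ} (hσ : 0 < σ) (hσS : σ ≤ S) (hs₀ : 0 < s₀)
    (hS : s₀ ≤ S) (hlam : 0 < lam) (ha : 0 ≤ a) (hb : 0 ≤ b) (hN : 0 ≤ N) (hL : 0 ≤ L)
    (h : σ * (lam * (a ^ 2 + S ^ 2 * b ^ 2)) ≤
      S * (9 * L * a * N + S ^ 2 * L * b * N + b * N))
    (hw : w ≤ b + N) (hx : x ≤ 9 * L * (a + N)) (hy : y ≤ S ^ 2 * L * (b + N) + N) :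
    x + y + w ≤ mixedConst lam L s₀ * (S ^ 3 / σ) * N := by
  have hSp : 0 < S := hs₀.trans_le hS
  set D := 1 / s₀ ^ 2 + 9 * L / s₀ + L with hD
  have hD0 : 0 ≤ D := by positivity
  have hE := energy_bound hσ hs₀ hS hlam ha hb hN (by positivity) hL h hD
  have e1 : 1 ≤ S * (1 / s₀) := by
    rw [mul_one_div, le_div_iff₀ hs₀]; linarith
  have e2 : 1 ≤ S ^ 2 * (1 / s₀ ^ 2) := by
    rw [mul_one_div, le_div_iff₀ (by positivity), one_mul]
    exact pow_le_pow_left₀ hs₀.le hS 2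
  have e3 : S ^ 2 ≤ S ^ 3 / σ := by
    rw [le_div_iff₀ hσ]
    nlinarith [mul_le_mul_of_nonneg_left hσS (sq_nonneg S)]
  have h1 : b + 9 * L * a + S ^ 2 * L * b ≤ (a + S * b) * (S * D) := by
    have i1 : b ≤ S * b * (S * (1 / s₀ ^ 2)) := by
      calc b = b * 1 := by ring
        _ ≤ b * (S ^ 2 * (1 / s₀ ^ 2)) := by gcongr
        _ = _ := by ring
    have i2 : 9 * L * a ≤ a * (S * (9 * L / s₀)) := by
      calc 9 * L * a = 9 * L * a * 1 := by ring
        _ ≤ 9 * L * a * (S * (1 / s₀)) := by gcongr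
        _ = _ := by ring
    have i3 : 0 ≤ S * b * (S * (9 * L / s₀)) := by positivity
    have i4 : 0 ≤ a * (S * (1 / s₀ ^ 2)) := by positivity
    have i5 : 0 ≤ a * (S * L) := by positivity
    calc _ ≤ S * b * (S * (1 / s₀ ^ 2)) + a * (S * (9 * L / s₀)) + S * b * (S * L) := by
          nlinarith
      _ ≤ S * b * (S * (1 / s₀ ^ 2)) + a * (S * (9 * L / s₀)) + S * b * (S * L) +
          (S * b * (S * (9 * L / s₀)) + a * (S * (1 / s₀ ^ 2)) + a * (S * L)) := by linarith
      _ = _ := by rw [hD]; ring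
  have h2 : (2 + 9 * L + S ^ 2 * L) * N ≤ S ^ 3 / σ * (((2 + 9 * L) / s₀ ^ 2 + L) * N) := by
    calc _ ≤ ((2 + 9 * L) * (S ^ 2 * (1 / s₀ ^ 2)) + S ^ 2 * L) * N := by
          gcongr
          exact le_mul_of_one_le_right (by positivity) e2
      _ = S ^ 2 * (((2 + 9 * L) / s₀ ^ 2 + L) * N) := by ring
      _ ≤ _ := by gcongr
  calc x + y + w ≤ (b + 9 * L * a + S ^ 2 * L * b) + (2 + 9 * L + S ^ 2 * L) * N := by linarith
    _ ≤ (2 / lam * D * (S ^ 2 / σ) * N) * (S * D) +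
        S ^ 3 / σ * (((2 + 9 * L) / s₀ ^ 2 + L) * N) :=
        add_le_add (h1.trans (by gcongr)) h2
    _ = _ := by rw [mixedConst]; ring

/-- Only b N appears on the right, and S b ≤ a + S b, so the energy yields the bound N / σ without
any power of S; recovering the divergence costs a single one. -/
theorem ultraWeak_bound {σ S a b N L lam s₀ y : ℝ} (hσ : 0 < σ) (hσS : σ ≤ S) (hs₀ : 0 < s₀)
    (hS : s₀ ≤ S) (hlam : 0 < lam) (ha : 0 ≤ a) (hb : 0 ≤ b) (hN : 0 ≤ N) (hL : 0 ≤ L)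
    (h : σ * (lam * (a ^ 2 + S ^ 2 * b ^ 2)) ≤ S * (b * N)) (hy : y ≤ S ^ 2 * L * b + N) :
    b + a + y ≤ ultraWeakConst lam L s₀ * (S / σ) * N := by
  have hSp : 0 < S := hs₀.trans_le hS
  have hE : a + S * b ≤ 2 / lam / σ * N := by
    rcases (show 0 ≤ a + S * b by positivity).eq_or_lt with hE | hE
    · rw [← hE]; positivity
    have h2 : σ * lam / 2 * (a + S * b) * (a + S * b) ≤ N * (a + S * b) := by
      have : (a + S * b) ^ 2 ≤ 2 * (a ^ 2 + S ^ 2 * b ^ 2) := by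
        nlinarith [sq_nonneg (a - S * b)]
      nlinarith [mul_le_mul_of_nonneg_left this (mul_pos hσ hlam).le, mul_nonneg ha hN]
    have h3 := le_of_mul_le_mul_right h2 hE
    have e : 2 / lam / σ * N = N / (σ * lam / 2) := by field_simp
    rw [e, le_div_iff₀ (by positivity)]
    linarith
  have e1 : 1 ≤ S * (1 / s₀) := by
    rw [mul_one_div, le_div_iff₀ hs₀]; linarith
  have e2 : 1 ≤ S ^ 2 * (1 / s₀ ^ 2) := by
    rw [mul_one_div, le_div_iff₀ (by positivity), one_mul]
    exact pow_le_pow_left₀ hs₀.le hS 2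
  have e3 : 1 ≤ S / σ := (one_le_div hσ).2 hσS
  have h1 : b + a + S ^ 2 * L * b ≤ (a + S * b) * (S * (1 / s₀ ^ 2 + 1 / s₀ + L)) := by
    have i1 : b ≤ S * b * (S * (1 / s₀ ^ 2)) := by
      calc b = b * 1 := by ring
        _ ≤ b * (S ^ 2 * (1 / s₀ ^ 2)) := by gcongr
        _ = _ := by ring
    have i2 : a ≤ a * (S * (1 / s₀)) := le_mul_of_one_le_right ha e1
    have i3 : 0 ≤ S * b * (S * (1 / s₀)) := by positivity
    have i4 : 0 ≤ a * (S * (1 / s₀ ^ 2)) := by positivity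
    have i5 : 0 ≤ a * (S * L) := by positivity
    calc _ ≤ S * b * (S * (1 / s₀ ^ 2)) + a * (S * (1 / s₀)) + S * b * (S * L) := by
          nlinarith
      _ ≤ S * b * (S * (1 / s₀ ^ 2)) + a * (S * (1 / s₀)) + S * b * (S * L) +
          (S * b * (S * (1 / s₀)) + a * (S * (1 / s₀ ^ 2)) + a * (S * L)) := by linarith
      _ = _ := by ring
  calc b + a + y ≤ (b + a + S ^ 2 * L * b) + 1 * N := by linarith
    _ ≤ (2 / lam / σ * N) * (S * (1 / s₀ ^ 2 + 1 / s₀ + L)) + S / σ * N :=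
        add_le_add (h1.trans (by gcongr)) (by gcongr)
    _ = _ := by rw [ultraWeakConst]; ring

/-! ### A criterion for well-posedness -/

/-- Uniqueness and stability follow from the inf-sup condition applied to a difference and to a
solution; existence is left as a hypothesis. -/
theorem isWellPosed_of {X Y D : Type*} [NormedAddCommGroup X] [NormedAddCommGroup Y]
    [NormedAddCommGroup D] {b : X → Y → ℂ} {f : D → Y → ℂ} {sol : D → X → Prop} {β : ℝ}
    (hb : ∃ C : ℝ, ∀ u v, ‖b u v‖ ≤ C * ‖u‖ * ‖v‖)
    (hsub : ∀ u u' v, b (u - u') v = b u v - b u' v)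
    (hf : ∃ C : ℝ, ∀ ψ v, ‖f ψ v‖ ≤ C * ‖ψ‖ * ‖v‖) (hβ : 0 < β)
    (hinf : ∀ u, ∃ v, v ≠ 0 ∧ β * ‖u‖ * ‖v‖ ≤ ‖b u v‖)
    (hnd : ∀ v, (∀ u, b u v = 0) → v = 0)
    (hsol : ∀ ψ u, sol ψ u ↔ ∀ v, b u v = f ψ v) (hex : ∀ ψ, ∃ u, sol ψ u) :
    IsWellPosed b f sol β where
  form_bounded := hb
  rhs_bounded := hf
  beta_pos := hβ
  inf_sup := hinf
  nondegenerate := hnd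
  existsUnique := fun ψ => by
    obtain ⟨u, hu⟩ := hex ψ
    refine ⟨u, hu, fun u' hu' => ?_⟩
    obtain ⟨v, hv, h⟩ := hinf (u' - u)
    rw [hsub, (hsol ψ u').1 hu' v, (hsol ψ u).1 hu v, sub_self, norm_zero] at h
    have hv' : 0 < ‖v‖ := norm_pos_iff.2 hv
    by_contra hne
    have hpos : 0 < ‖u' - u‖ := norm_pos_iff.2 (sub_ne_zero.2 hne)
    exact absurd h (not_le.2 (by positivity))
  stable := by
    obtain ⟨C, hC⟩ := hf
    refine ⟨C / β, fun ψ u hu => ?_⟩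
    obtain ⟨v, hv, h⟩ := hinf u
    rw [(hsol ψ u).1 hu v] at h
    have hv' : 0 < ‖v‖ := norm_pos_iff.2 hv
    have h2 := le_of_mul_le_mul_right (h.trans (hC ψ v)) hv'
    rw [div_mul_eq_mul_div, le_div_iff₀ hβ]
    linarith

/-- The inf-sup condition asks for a nonzero test function even for the zero trial function. -/
theorem exists_L2_ne_zero : ∃ u : L2, u ≠ 0 := by
  refine ⟨indicatorConstLp 2 (μ := volume) (s := Metric.ball (0 : E3) 1) measurableSet_ball
    measure_ball_lt_top.ne (1 : ℂ), fun h => ?_⟩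
  have h1 := congrArg norm h
  rw [norm_zero, norm_indicatorConstLp (by norm_num) (by norm_num), norm_one, one_mul] at h1
  have h2 : 0 < (volume : Measure E3).real (Metric.ball (0 : E3) 1) :=
    ENNReal.toReal_pos (Metric.measure_ball_pos _ _ one_pos).ne' measure_ball_lt_top.ne
  exact absurd h1 (Real.rpow_pos_of_pos h2 _).ne'

/-! ### Conjugation and traces -/

theorem Hdiv.norm_conj (m : Hdiv) : ‖m.conj‖ = ‖m‖ := by
  have h1 : ‖m.conj.field‖ ^ 2 = ‖m.field‖ ^ 2 := by
    rw [PiLp.norm_sq_eq_of_L2, PiLp.norm_sq_eq_of_L2]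
    exact Finset.sum_congr rfl fun i _ => congrArg (· ^ 2) (norm_star_L2 (m.field i))
  have h2 : ‖m.conj.div‖ = ‖m.div‖ := norm_star_L2 m.div
  have h3 := m.conj.norm_sq_eq
  rw [h1, h2, ← m.norm_sq_eq] at h3
  exact (sq_eq_sq₀ (norm_nonneg _) (norm_nonneg _)).1 h3

theorem normalTraceS_apply (Ω : LipschitzDomain) (s : ℂ) (m : Hdiv) (ψ : Hhalf Ω) :
    normalTraceS Ω s m ψ = s ^ (-(1 / 2) : ℂ) * normalTrace Ω m ψ := rfl

theorem exists_norm_normalTraceS_le (Ω : LipschitzDomain) (s : ℂ) :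
    ∃ C : ℝ, 0 ≤ C ∧ ∀ (ψ : Hhalf Ω) (m : Hdiv),
      ‖normalTraceS Ω s m.conj ψ‖ ≤ C * ‖ψ‖ * ‖m‖ := by
  obtain ⟨C, hC0, hC⟩ := exists_norm_normalTrace_le Ω
  refine ⟨‖s ^ (-(1 / 2) : ℂ)‖ * C, by positivity, fun ψ m => ?_⟩
  rw [normalTraceS_apply, norm_mul, mul_assoc, mul_assoc]
  refine mul_le_mul_of_nonneg_left ?_ (norm_nonneg _)
  have := hC ψ m.conj
  rwa [m.norm_conj, mul_assoc] at this

/-- With w an extension of ψ, the right-hand side is the inner product of t with the pair formed by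
the restrictions of ∇w and w to Ω, scaled by s^{-1/2}; adjoints of the field and divergence maps
turn this pair into a vector of the mixed space. -/
theorem exists_mixedInner_eq_normalTraceS (Ω : LipschitzDomain) (s : ℂ) (ψ : Hhalf Ω) :
    ∃ y : MixedSpace, ∀ t, mixedInner t y = normalTraceS Ω s t.fst.conj ψ := by
  obtain ⟨C, -, hC⟩ := exists_hasTrace Ω
  obtain ⟨w, hw, -⟩ := hC ψ
  have hS := Ω.isOpen.measurableSet
  obtain ⟨y, hy⟩ := exists_mixedInner_eq
    (s ^ (-(1 / 2) : ℂ) • WithLp.toLp 2 fun i => indOp hS (w.grad i))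
    (s ^ (-(1 / 2) : ℂ) • indOp hS w.val)
  refine ⟨y, fun t => ?_⟩
  rw [hy, normalTraceS_apply, normalTrace_eq hw, inner_smul_right, inner_smul_right, ← mul_add]
  congr 1
  have h1 : ∀ i, star (t.fst.conj.field i) = t.fst.field i := fun i => star_star (t.fst.field i)
  have h2 : star t.fst.conj.div = t.fst.div := star_star t.fst.div
  rw [domPair, h2, inner_L2vec]
  simp only [h1]

section WellPosed

variable {lam Lam s₀ : ℝ} {A : E3 → Matrix (Fin 3) (Fin 3) ℝ} {p : E3 → ℝ} {s : ℂ}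
  (hA : IsMatrixCoeff lam Lam A) (hp : IsScalarCoeff lam Lam p) (hlam : 0 < lam)

/-! ### The mixed problem -/

theorem norm_le_mixedOp (hs₀ : 0 < s₀) (hs : 0 < s.re) (hs' : s₀ ≤ ‖s‖) (z : MixedSpace) :
    ‖z‖ ≤ mixedConst lam Lam s₀ * (‖s‖ ^ 3 / s.re) * ‖mixedOp hA hp hlam s z‖ := by
  have hL : 0 < Lam := hlam.trans_le hp.lam_le
  obtain ⟨v, hv, hj, hd⟩ := exists_H1_of_mixedOp hA hp hlam s z
  set y := mixedOp hA hp hlam s z with hy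
  have n0 : ‖y.fst‖ ≤ ‖y‖ := WithLp.norm_fst_le _ _
  have n1 : ‖y.fst.field‖ ≤ ‖y‖ := y.fst.norm_field_le.trans n0
  have n2 : ‖y.fst.div‖ ≤ ‖y‖ := y.fst.norm_div_le.trans n0
  have n3 : ‖y.snd‖ ≤ ‖y‖ := WithLp.norm_snd_le _ _
  have hu : z.snd = v.val - y.fst.div := by rw [hv]; abel
  -- The data are g₀ = field of y, g₁ = div of y and f = scalar part of y, each bounded by ‖y‖.
  have hE := energy_le hA hp hlam hj (hu ▸ hd) hs
  have hu' : ‖z.snd‖ ≤ ‖v.val‖ + ‖y‖ := by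
    rw [hu]
    exact (norm_sub_le _ _).trans (by linarith)
  refine (norm_mixedSpace_le z).trans
    (mixed_bound hs (Complex.re_le_norm s) hs₀ hs' hlam (norm_nonneg v.grad) (norm_nonneg v.val)
      (norm_nonneg y) hL.le (hE.trans ?_) hu' ?_ ?_)
  · gcongr
  · rw [hj]
    refine (norm_matOp_le hA hlam _).trans ?_
    gcongr
    exact (norm_sub_le _ _).trans (by linarith)
  · rw [hd]
    refine (norm_sub_le _ _).trans (add_le_add ?_ n3)
    rw [norm_smul, norm_pow, mul_assoc]
    gcongr
    refine (norm_mulOp_le (hp.isMultiplier hlam) z.snd).trans ?_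
    gcongr

theorem mixedOp_nondegenerate (hs : 0 < s.re) {y : MixedSpace}
    (h : ∀ z, mixedInner y (mixedOp hA hp hlam s z) = 0) : y = 0 := by
  have hs0 : 0 < ‖s‖ := hs.trans_le (Complex.re_le_norm s)
  have h1 : ‖mixedOp hA hp hlam (conj s) y‖ = 0 := by
    -- With z = T(conj s) y the hypothesis becomes ‖T(conj s) y‖² = 0.
    have h2 := h (mixedOp hA hp hlam (conj s) y)
    rw [mixedInner_mixedOp_comm] at h2
    have h3 := norm_mixedInner_self (mixedOp hA hp hlam (conj s) y)
    rw [h2, norm_zero] at h3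
    exact pow_eq_zero_iff two_ne_zero |>.1 h3.symm
  -- Only qualitative information is needed, so the lower frequency bound is taken to be ‖s‖ itself.
  have h4 := norm_le_mixedOp hA hp hlam (s := conj s) hs0 (by simpa using hs) (by simp) y
  rw [h1, mul_zero] at h4
  exact norm_le_zero_iff.1 h4

theorem mixedOp_surjective (hs : 0 < s.re) : Function.Surjective (mixedOp hA hp hlam s) :=
  surjective_mixedOp hA hp hlam s
    (norm_le_mixedOp hA hp hlam (hs.trans_le (Complex.re_le_norm s)) hs le_rfl)
    fun _ => mixedOp_nondegenerate hA hp hlam hs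

theorem isMixedSolution_iff (hp : IsScalarCoeff lam Lam p)
    (hlam : 0 < lam) (Ω : LipschitzDomain) (ψ : Hhalf Ω) (z : MixedSpace) :
    IsMixedSolution Ω A p s ψ z ↔ ∀ t, mixedForm A p s z t = mixedRhs Ω s ψ t := by
  have key : ∀ t : MixedSpace, mixedForm A p s z t =
      (-invPairing A z.fst t.fst.conj - (∫ x, z.snd x * t.fst.conj.div x)) +
      (-(∫ x, z.fst.div x * (star t.snd) x)
        + s ^ 2 * (∫ x, (p x : ℂ) * z.snd x * (star t.snd) x)) := fun t => by
    rw [mixedForm]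
    ring
  have e1 : (0 : Hdiv).field = 0 := rfl
  have e2 : (0 : Hdiv).div = 0 := rfl
  constructor
  · rintro ⟨h1, h2⟩ t
    rw [key, h1, h2, add_zero]
    rfl
  · intro h
    have h1 : ∀ m : Hdiv, -invPairing A z.fst m.conj - (∫ x, z.snd x * m.conj.div x)
        = normalTraceS Ω s m.conj ψ := fun m => by
      have h3 := h (WithLp.toLp 2 (m, 0))
      rw [key, integral_mul_star_eq_inner, integral_scal_mul_star hp hlam] at h3
      simp only [WithLp.toLp_fst, WithLp.toLp_snd, inner_zero_left, mul_zero, neg_zero,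
        add_zero] at h3
      exact h3
    refine ⟨h1, fun q => ?_⟩
    have h3 := h (WithLp.toLp 2 (0, q))
    rw [key] at h3
    have h4 : mixedRhs Ω s ψ (WithLp.toLp 2 (0, q)) = _ := (h1 0).symm
    rw [h4] at h3
    exact add_eq_left.1 h3

theorem isWellPosed_mixed (hA : IsMatrixCoeff lam Lam A) (hp : IsScalarCoeff lam Lam p)
    (hlam : 0 < lam) (Ω : LipschitzDomain) (hs₀ : 0 < s₀) (hs : 0 < s.re) (hs' : s₀ ≤ ‖s‖) {c : ℝ}
    (hc : 0 < c) (hc' : c * mixedConst lam Lam s₀ ≤ 1) :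
    IsWellPosed (mixedForm A p s) (mixedRhs Ω s) (IsMixedSolution Ω A p s)
      (c * (s.re / ‖s‖ ^ 3)) := by
  have hs0 : 0 < ‖s‖ := hs₀.trans_le hs'
  have hform := mixedForm_eq hA hp hlam s
  have hsol := isMixedSolution_iff (A := A) hp hlam (s := s) Ω
  refine isWellPosed_of ?_ ?_ ?_ (by positivity) ?_ ?_ hsol ?_
  · obtain ⟨C, hC⟩ := exists_norm_mixedOp_le hA hp hlam s
    refine ⟨C, fun z t => ?_⟩
    rw [hform]
    refine (norm_mixedInner_le _ _).trans ?_
    rw [mul_comm]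
    gcongr
    exact hC z
  · intro y z t
    rw [hform, hform, hform, mixedInner_mixedOp, mixedInner_mixedOp, mixedInner_mixedOp]
    have e1 : (y - z).fst.field = y.fst.field - z.fst.field := rfl
    have e2 : (y - z).fst.div = y.fst.div - z.fst.div := rfl
    have e3 : (y - z).snd = y.snd - z.snd := rfl
    rw [e1, e2, e3, map_sub, map_sub, inner_sub_right, inner_sub_right, inner_sub_right,
      inner_sub_right]
    ring
  · obtain ⟨C, hC0, hC⟩ := exists_norm_normalTraceS_le Ω s
    refine ⟨C, fun ψ t => (hC ψ t.fst).trans ?_⟩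
    gcongr
    exact WithLp.norm_fst_le _ _
  · intro z
    rcases eq_or_ne z 0 with rfl | hz
    · obtain ⟨u, hu⟩ := exists_L2_ne_zero
      refine ⟨WithLp.toLp 2 (0, u), fun h => hu (congrArg WithLp.snd h), ?_⟩
      simp
    · have hb := norm_le_mixedOp hA hp hlam hs₀ hs hs' z
      -- For the test function T z the form equals ‖T z‖², and the stability bound converts one
      -- factor into ‖z‖.
      refine ⟨mixedOp hA hp hlam s z, fun h => hz ?_, ?_⟩
      · rw [h, norm_zero, mul_zero] at hb
        exact norm_le_zero_iff.1 hb
      · rw [hform, norm_mixedInner_self, sq]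
        refine mul_le_mul_of_nonneg_right ?_ (norm_nonneg _)
        calc _ ≤ c * (s.re / ‖s‖ ^ 3) *
              (mixedConst lam Lam s₀ * (‖s‖ ^ 3 / s.re) * ‖mixedOp hA hp hlam s z‖) := by gcongr
          _ = c * mixedConst lam Lam s₀ * ‖mixedOp hA hp hlam s z‖ := by field_simp
          _ ≤ 1 * ‖mixedOp hA hp hlam s z‖ := by gcongr
          _ = _ := one_mul _
  · intro t ht
    refine mixedOp_nondegenerate hA hp hlam hs fun z => ?_
    rw [← hform, ht]
  · intro ψ
    obtain ⟨y, hy⟩ := exists_mixedInner_eq_normalTraceS Ω s ψ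
    obtain ⟨z, hz⟩ := mixedOp_surjective hA hp hlam hs y
    refine ⟨z, (hsol ψ z).2 fun t => ?_⟩
    rw [hform, hz, hy]
    rfl

/-! ### The ultra-weak problem -/

theorem isFlux_iff {v : H1} {m : Hdiv} : IsFlux A v m ↔ m.field = matOp hA hlam v.grad := by
  constructor
  · intro h
    ext i : 1
    refine Lp.ext ?_
    filter_upwards [h i, coeFn_matOp hA hlam v.grad i] with x h1 h2
    rw [h1, h2]
  · intro h i
    rw [h]
    exact coeFn_matOp hA hlam v.grad i

/-- The flux is obtained by choice, but almost everywhere it equals A∇v, and A is real. -/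
theorem flux_conj (v : H1B A) : v.conj.flux = v.flux.conj := by
  refine Subtype.ext (WithLp.ofLp_injective 2 (Prod.ext ?_ ?_))
  · change v.conj.flux.field = v.flux.conj.field
    ext i : 1
    refine Lp.ext ?_
    have h6 : ∀ᵐ x, ∀ k, v.conj.toH1.grad k x = star (v.toH1.grad k x) :=
      ae_all_iff.2 fun k => Lp.coeFn_star (v.toH1.grad k)
    have h7 : ∀ᵐ x, v.flux.conj.field i x = star (v.flux.field i x) :=
      Lp.coeFn_star (v.flux.field i)
    filter_upwards [v.conj.isFlux_flux i, v.isFlux_flux i, h6, h7] with x h1 h2 h3 h4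
    rw [h1, h4, h2]
    simp [h3]
  · change v.conj.flux.div = v.flux.conj.div
    rw [v.conj.div_flux]
    change star v.divFlux = star v.flux.div
    rw [v.div_flux]

theorem H1B.norm_sq_eq (v : H1B A) : ‖v‖ ^ 2 = ‖v.toH1‖ ^ 2 + ‖v.divFlux‖ ^ 2 :=
  WithLp.prod_norm_sq_eq_of_L2 _

theorem H1B.norm_toH1_le (v : H1B A) : ‖v.toH1‖ ≤ ‖v‖ := by
  have h1 := v.norm_sq_eq
  exact abs_le_of_sq_le_sq' (by nlinarith [norm_nonneg v.divFlux]) (by positivity) |>.2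

theorem H1B.norm_divFlux_le (v : H1B A) : ‖v.divFlux‖ ≤ ‖v‖ := by
  have h1 := v.norm_sq_eq
  exact abs_le_of_sq_le_sq' (by nlinarith [norm_nonneg v.toH1]) (by positivity) |>.2

theorem H1B.norm_le (v : H1B A) : ‖v‖ ≤ ‖v.toH1.val‖ + ‖v.toH1.grad‖ + ‖v.divFlux‖ := by
  have h1 := v.norm_sq_eq
  have h2 : ‖v.toH1‖ ^ 2 = ‖v.toH1.val‖ ^ 2 + ‖v.toH1.grad‖ ^ 2 :=
    WithLp.prod_norm_sq_eq_of_L2 _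
  refine abs_le_of_sq_le_sq' ?_ (by positivity) |>.2
  nlinarith [mul_nonneg (norm_nonneg v.toH1.val) (norm_nonneg v.toH1.grad),
    mul_nonneg (norm_nonneg v.toH1.val) (norm_nonneg v.divFlux),
    mul_nonneg (norm_nonneg v.toH1.grad) (norm_nonneg v.divFlux)]

theorem uwForm_eq (u : L2) (v : H1B A) : uwForm A p s u v =
    -inner ℂ v.divFlux u + s ^ 2 * inner ℂ v.toH1.val (scalOp hp hlam u) := by
  rw [← integral_mul_star_eq_inner, ← integral_mul_star_eq_inner, ← integral_neg,
    ← integral_const_mul, ← integral_add]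
  · refine integral_congr_ae ?_
    filter_upwards [coeFn_mulOp (hp.isMultiplier hlam) u] with x hx
    rw [hx, opL]
    change u x * (-(star v.divFlux) x + s ^ 2 * (p x : ℂ) * (star v.toH1.val) x) = _
    ring
  · exact (integrable_L2_mul _ (Lp.memLp _)).neg
  · exact (integrable_L2_mul _ (Lp.memLp _)).const_mul _

/-- Solvability of the adjoint equation. -/
theorem exists_adjoint_solution (hA : IsMatrixCoeff lam Lam A) (hp : IsScalarCoeff lam Lam p)
    (hlam : 0 < lam) (hs₀ : 0 < s₀) (hs : 0 < s.re) (hs' : s₀ ≤ ‖s‖) (u : L2) :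
    ∃ v : H1B A, uwForm A p s u v = inner ℂ u u ∧
      ‖v‖ ≤ ultraWeakConst lam Lam s₀ * (‖s‖ / s.re) * ‖u‖ := by
  have hL : 0 < Lam := hlam.trans_le hp.lam_le
  have hsc : 0 < (conj s).re := by simpa using hs
  -- The datum (0, u) leaves the first equation without defect, so the scalar part is an H¹ function
  -- w with j = A∇w, and the second equation reads L(conj s) w = u. The parameter is conj s because
  -- test functions are conjugated in the form.
  obtain ⟨z, hz⟩ := mixedOp_surjective hA hp hlam hsc (WithLp.toLp 2 (0, u))
  obtain ⟨w, hw, hj, hd⟩ := exists_H1_of_mixedOp hA hp hlam (conj s) z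
  rw [hz] at hw hj hd
  have e1 : (0 : Hdiv).field = 0 := rfl
  have e2 : (0 : Hdiv).div = 0 := rfl
  simp only [WithLp.toLp_fst, WithLp.toLp_snd, e1, e2, add_zero, sub_zero] at hw hj hd
  rw [← hw] at hd
  refine ⟨⟨WithLp.toLp 2 (w, z.fst.div), z.fst, (isFlux_iff hA hlam).2 hj, rfl⟩, ?_, ?_⟩
  · rw [uwForm_eq hp hlam]
    change -inner ℂ z.fst.div u + s ^ 2 * inner ℂ w.val (scalOp hp hlam u) = _
    rw [hd, inner_sub_left, inner_smul_left, inner_scalOp_comm, map_pow, Complex.conj_conj]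
    ring
  · have hE := energy_le hA hp hlam (s := conj s) (v := w) (j := z.fst) (g₀ := 0) (g₁ := 0) (f := u)
      (by rw [sub_zero]; exact hj) (by rw [sub_zero]; exact hd) hsc
    simp only [norm_zero, mul_zero, zero_add, Complex.norm_conj, Complex.conj_re] at hE
    refine (H1B.norm_le _).trans (ultraWeak_bound hs (Complex.re_le_norm s) hs₀ hs' hlam
      (norm_nonneg w.grad) (norm_nonneg w.val) (norm_nonneg u) hL.le hE ?_)
    change ‖z.fst.div‖ ≤ ‖s‖ ^ 2 * Lam * ‖w.val‖ + ‖u‖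
    rw [hd]
    refine (norm_sub_le _ _).trans (add_le_add ?_ le_rfl)
    rw [norm_smul, norm_pow, Complex.norm_conj, mul_assoc]
    gcongr
    exact norm_mulOp_le (hp.isMultiplier hlam) w.val

/-- Vanishing against all u means L(conj s) v = 0, and the energy estimate without data forces v =
0. -/
theorem uwForm_nondegenerate (hA : IsMatrixCoeff lam Lam A) (hp : IsScalarCoeff lam Lam p)
    (hlam : 0 < lam) (hs : 0 < s.re) {v : H1B A} (h : ∀ u, uwForm A p s u v = 0) :
    v = 0 := by
  have hs0 : 0 < ‖s‖ := hs.trans_le (Complex.re_le_norm s)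
  have hd : v.flux.div = (conj s) ^ 2 • scalOp hp hlam v.toH1.val := by
    refine ext_inner_right ℂ fun u => ?_
    have h1 := h u
    rw [uwForm_eq hp hlam] at h1
    rw [v.div_flux, inner_smul_left, inner_scalOp_comm, map_pow, Complex.conj_conj]
    linear_combination -h1
  have hE := energy_le hA hp hlam (s := conj s) (v := v.toH1) (j := v.flux) (g₀ := 0) (g₁ := 0)
    (f := 0) (by rw [sub_zero]; exact (isFlux_iff hA hlam).1 v.isFlux_flux)
    (by rw [sub_zero, sub_zero]; exact hd) (by simpa using hs)
  simp only [norm_zero, mul_zero, zero_add, Complex.norm_conj, Complex.conj_re] at hE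
  have h2 : ‖v.toH1.grad‖ ^ 2 + ‖s‖ ^ 2 * ‖v.toH1.val‖ ^ 2 ≤ 0 := by
    by_contra hne
    have : 0 < s.re * (lam * (‖v.toH1.grad‖ ^ 2 + ‖s‖ ^ 2 * ‖v.toH1.val‖ ^ 2)) :=
      mul_pos hs (mul_pos hlam (not_le.1 hne))
    linarith
  have h3 : ‖v.toH1.grad‖ = 0 := by
    have : 0 ≤ ‖s‖ ^ 2 * ‖v.toH1.val‖ ^ 2 := by positivity
    exact pow_eq_zero_iff two_ne_zero |>.1 (le_antisymm (by linarith) (sq_nonneg _))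
  have h4 : ‖v.toH1.val‖ = 0 := by
    rw [h3] at h2
    have h5 : ‖v.toH1.val‖ ^ 2 ≤ 0 := by
      by_contra hne
      nlinarith [mul_pos (pow_pos hs0 2) (not_le.1 hne)]
    exact pow_eq_zero_iff two_ne_zero |>.1 (le_antisymm h5 (sq_nonneg _))
  have h6 : ‖v.divFlux‖ = 0 := by
    rw [← v.div_flux, hd, norm_eq_zero.1 h4, map_zero, smul_zero, norm_zero]
  have h7 := v.norm_le
  rw [h3, h4, h6] at h7
  exact norm_le_zero_iff.1 (h7.trans_eq (by norm_num))

theorem isWellPosed_ultraWeak (hA : IsMatrixCoeff lam Lam A) (hp : IsScalarCoeff lam Lam p)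
    (hlam : 0 < lam) (Ω : LipschitzDomain) (hs₀ : 0 < s₀) (hs : 0 < s.re)
    (hs' : s₀ ≤ ‖s‖) {c : ℝ} (hc : 0 < c) (hc' : c * ultraWeakConst lam Lam s₀ ≤ 1) :
    IsWellPosed (uwForm A p s) (uwRhs Ω A s) (IsUWSolution Ω A p s) (c * (s.re / ‖s‖)) := by
  have hs0 : 0 < ‖s‖ := hs₀.trans_le hs'
  have hL : 0 < Lam := hlam.trans_le hp.lam_le
  have hb : ∀ (u : L2) (v : H1B A), ‖uwForm A p s u v‖ ≤ (1 + ‖s‖ ^ 2 * Lam) * ‖u‖ * ‖v‖ := by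
    intro u v
    rw [uwForm_eq hp hlam]
    calc _ ≤ ‖v.divFlux‖ * ‖u‖ + ‖s‖ ^ 2 * (‖v.toH1.val‖ * (Lam * ‖u‖)) := by
          refine (norm_add_le _ _).trans (add_le_add ?_ ?_)
          · rw [norm_neg]
            exact norm_inner_le_norm _ _
          · rw [norm_mul, norm_pow]
            gcongr
            refine (norm_inner_le_norm _ _).trans ?_
            gcongr
            exact norm_mulOp_le (hp.isMultiplier hlam) u
      _ ≤ ‖v‖ * ‖u‖ + ‖s‖ ^ 2 * (‖v‖ * (Lam * ‖u‖)) := by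
          gcongr
          · exact v.norm_divFlux_le
          · exact v.toH1.norm_val_le.trans v.norm_toH1_le
      _ = _ := by ring
  refine isWellPosed_of ⟨_, hb⟩ ?_ ?_ (by positivity) ?_ ?_ (fun _ _ => Iff.rfl) ?_
  · intro u u' v
    rw [uwForm_eq hp hlam, uwForm_eq hp hlam, uwForm_eq hp hlam, map_sub, inner_sub_right,
      inner_sub_right]
    ring
  · obtain ⟨C, hC0, hC⟩ := exists_norm_normalTraceS_le Ω s
    refine ⟨C * (9 * Lam + 1), fun ψ v => ?_⟩
    rw [uwRhs, conormalS, flux_conj]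
    refine (hC ψ v.flux).trans ?_
    have h1 : ‖v.flux‖ ≤ (9 * Lam + 1) * ‖v‖ := by
      have h2 : ‖v.flux.field‖ ≤ 9 * Lam * ‖v‖ := by
        rw [(isFlux_iff hA hlam).1 v.isFlux_flux]
        refine (norm_matOp_le hA hlam _).trans ?_
        gcongr
        exact v.toH1.norm_grad_le.trans v.norm_toH1_le
      have h3 : ‖v.flux.div‖ ≤ ‖v‖ := by
        rw [v.div_flux]
        exact v.norm_divFlux_le
      have h4 := v.flux.norm_sq_eq
      have h6 := mul_nonneg (norm_nonneg v.flux.field) (norm_nonneg v.flux.div)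
      have h5 : ‖v.flux‖ ≤ ‖v.flux.field‖ + ‖v.flux.div‖ :=
        abs_le_of_sq_le_sq' (by nlinarith) (by positivity) |>.2
      linarith
    calc _ ≤ C * ‖ψ‖ * ((9 * Lam + 1) * ‖v‖) := by gcongr
      _ = _ := by ring
  · intro u
    -- The adjoint solution with datum u gives the form the value ‖u‖².
    have main : ∀ u : L2, u ≠ 0 → ∃ v : H1B A, v ≠ 0 ∧
        c * (s.re / ‖s‖) * ‖u‖ * ‖v‖ ≤ ‖uwForm A p s u v‖ := by
      intro u hu
      obtain ⟨v, hv, hvb⟩ := exists_adjoint_solution hA hp hlam hs₀ hs hs' u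
      have hn : ‖uwForm A p s u v‖ = ‖u‖ ^ 2 := by
        rw [hv, inner_self_eq_norm_sq_to_K, norm_pow]
        simp
      refine ⟨v, fun h => hu ?_, ?_⟩
      · have h1 := hb u v
        have h0 : ‖(0 : H1B A)‖ = 0 := norm_zero
        rw [hn, h, h0, mul_zero] at h1
        exact norm_eq_zero.1 (pow_eq_zero_iff two_ne_zero |>.1 (le_antisymm h1 (sq_nonneg _)))
      · rw [hn]
        calc _ ≤ c * (s.re / ‖s‖) * ‖u‖ *
              (ultraWeakConst lam Lam s₀ * (‖s‖ / s.re) * ‖u‖) := by gcongr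
          _ = c * ultraWeakConst lam Lam s₀ * ‖u‖ ^ 2 := by field_simp
          _ ≤ 1 * ‖u‖ ^ 2 := by gcongr
          _ = _ := one_mul _
    rcases eq_or_ne u 0 with rfl | hu
    · obtain ⟨u, hu⟩ := exists_L2_ne_zero
      obtain ⟨v, hv, -⟩ := main u hu
      refine ⟨v, hv, ?_⟩
      simp
    · exact main u hu
  · exact fun v hv => uwForm_nondegenerate hA hp hlam hs hv
  · intro ψ
    obtain ⟨y, hy⟩ := exists_mixedInner_eq_normalTraceS Ω s ψ
    obtain ⟨z, hz⟩ := mixedOp_surjective hA hp hlam hs y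
    refine ⟨z.snd, fun v => ?_⟩
    -- Testing the first mixed equation with m = A∇v cancels A against A⁻¹; integration by parts
    -- then leaves ⟨v, div j⟩ in place of -⟨∇v, j⟩.
    have h1 := hy (WithLp.toLp 2 (v.flux, 0))
    rw [← hz, mixedInner_mixedOp] at h1
    simp only [WithLp.toLp_fst, WithLp.toLp_snd, inner_zero_left, mul_zero, add_zero,
      sub_zero] at h1
    rw [uwRhs, conormalS, flux_conj]
    change _ = normalTraceS Ω s v.flux.conj ψ
    rw [← h1, uwForm_eq hp hlam, (isFlux_iff hA hlam).1 v.isFlux_flux, inner_matOp_comm,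
      matOp_matInvOp, inner_grad_field, v.div_flux]
    -- The datum functional ignores q, so the second mixed equation is homogeneous.
    have h2 : z.fst.div = s ^ 2 • scalOp hp hlam z.snd := by
      refine ext_inner_left ℂ fun q => ?_
      have e1 : (0 : Hdiv).field = 0 := rfl
      have e2 : (0 : Hdiv).div = 0 := rfl
      have h3 : mixedInner (WithLp.toLp 2 ((0 : Hdiv), q)) y = 0 := by
        refine (hy (WithLp.toLp 2 (0, q))).trans
          ((hy (WithLp.toLp 2 ((0 : Hdiv), 0))).symm.trans ?_)
        simp [mixedInner, e1, e2]
      rw [← hz, mixedInner_mixedOp] at h3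
      simp only [WithLp.toLp_fst, WithLp.toLp_snd, inner_zero_left, e1, e2] at h3
      rw [inner_smul_right]
      linear_combination -h3
    rw [h2, inner_smul_right]
    ring

end WellPosed

end UltraWeak

end

/-! ### Choice of the constant and conclusion -/

theorem mainTheorem5 (lam Lam s₀ : ℝ) (hlam : 0 < lam) (hs₀ : 0 < s₀) :
    ∃ c : ℝ, 0 < c ∧
      ∀ (Ω : UltraWeak.LipschitzDomain)
        (A : UltraWeak.E3 → Matrix (Fin 3) (Fin 3) ℝ) (p : UltraWeak.E3 → ℝ) (s : ℂ),
        UltraWeak.IsMatrixCoeff lam Lam A → UltraWeak.IsScalarCoeff lam Lam p →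
        0 < s.re → s₀ ≤ ‖s‖ →
        (∀ m : UltraWeak.Hdiv, ∃! ℓ : UltraWeak.HmHalf Ω, UltraWeak.IsNormalTrace Ω m ℓ) ∧
        UltraWeak.IsWellPosed (UltraWeak.uwForm A p s) (UltraWeak.uwRhs Ω A s)
          (UltraWeak.IsUWSolution Ω A p s) (c * (s.re / ‖s‖)) ∧
        UltraWeak.IsWellPosed (UltraWeak.mixedForm A p s) (UltraWeak.mixedRhs Ω s)
          (UltraWeak.IsMixedSolution Ω A p s) (c * (s.re / ‖s‖ ^ 3)) := by
  -- The constant must be fixed before any coefficients are given, when Λ > 0 is not yet known; the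
  -- absolute value keeps it positive. Once p is given, 0 < λ ≤ Λ removes it.
  have hm : 0 < UltraWeak.mixedConst lam |Lam| s₀ := by
    unfold UltraWeak.mixedConst
    positivity
  have hu : 0 < UltraWeak.ultraWeakConst lam |Lam| s₀ := by
    unfold UltraWeak.ultraWeakConst
    positivity
  have hc : 0 < min (1 / UltraWeak.mixedConst lam |Lam| s₀)
      (1 / UltraWeak.ultraWeakConst lam |Lam| s₀) := by positivity
  refine ⟨_, hc, fun Ω A p s hA hp hs hs' => ?_⟩
  have hcm := (le_div_iff₀ hm).1 (min_le_left (1 / UltraWeak.mixedConst lam |Lam| s₀)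
    (1 / UltraWeak.ultraWeakConst lam |Lam| s₀))
  have hcu := (le_div_iff₀ hu).1 (min_le_right (1 / UltraWeak.mixedConst lam |Lam| s₀)
    (1 / UltraWeak.ultraWeakConst lam |Lam| s₀))
  have hL : |Lam| = Lam := abs_of_pos (hlam.trans_le hp.lam_le)
  rw [hL] at hc hcm hcu ⊢
  exact ⟨UltraWeak.existsUnique_isNormalTrace Ω,
    UltraWeak.isWellPosed_ultraWeak hA hp hlam Ω hs₀ hs hs' hc hcu,
    UltraWeak.isWellPosed_mixed hA hp hlam Ω hs₀ hs hs' hc hcm⟩
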